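/- **Setting.** Let $n\ge 2$, $m>0$, $\mu,\gamma\in\mathbb R^n$, let $\Sigma$ be a real symmetric positive definite $n\times n$ matrix and $\Sigma^{1/2}$ its positive definite square root. The density of $St_d(\mu,\Sigma,\nu)$ on $\mathbb R^d$ is $$\frac{\Gamma(\frac{\nu+d}2)}{\Gamma(\frac\nu2)(\nu\pi)^{d/2}\sqrt{|\Sigma|}}\Big(1+\tfrac{(x-\mu)^T\Sigma^{-1}(x-\mu)}{\nu}\Big)^{-(\nu+d)/2}.$$ A skewing function is a measurable $H:\mathbb R\to[0,1]$ with $H(-x)=1-H(x)$. Write $Y\sim GSSt_n(\mu,\Sigma,\gamma,m,H)$ if $Y$ has density $2\,f_{St_n(\mu,\Sigma,m)}(y)\,H(\gamma^T\Sigma^{-1/2}(y-\mu))$. For a generator $G$ on $[0,\infty)$ put $N_d(G)=\frac{\Gamma(d/2)}{(2\pi)^{d/2}}\big[\int_0^\infty s^{d/2-1}G(s)\,ds\big]^{-1}$ for $d\ge1$ and $N_0(G)=1/G(0)$. The elliptical density $E_d(\mu,\Sigma,G)$ is $\frac{N_d(G)}{\sqrt{|\Sigma|}}G(\frac12(x-\mu)^T\Sigma^{-1}(x-\mu))$,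 and $GSE_d(\mu,\Sigma,G,K)$ has density $2E_d(\mu,\Sigma,G)(y)\,K(\Sigma^{-1/2}(y-\mu))$. Put $g_n(u)=(1+2u/m)^{-(m+n)/2}$, $\overline G_n(u)=\int_u^\infty g_n$, $\overline{\mathcal G}_n(u)=\int_u^\infty\overline G_n$, $c_n=N_n(g_n)$, $c_n^*=N_n(\overline G_n)$, $c_n^{**}=N_n(\overline{\mathcal G}_n)$. For $\lambda\in\mathbb R^n$ put $c^*_{n-1,k}=N_{n-1}(\overline G_n(\cdot+\frac{\lambda_k^2}2))$, $c^{**}_{n-1,k}=N_{n-1}(\overline{\mathcal G}_n(\cdot+\frac{\lambda_k^2}2))$, $c^{**}_{n-2,ij}=N_{n-2}(\overline{\mathcal G}_n(\cdot+\frac{\lambda_i^2+\lambda_j^2}2))$, and let $W_{-k},V_{-k},U_{-ij}$ $(i\ne j)$ have the densities $$f_{W_{-k}}(w)=c^*_{n-1,k}\overline G_n\big(\tfrac{|w|^2+\lambda_k^2}2\big),\quad f_{V_{-k}}(v)=c^{**}_{n-1,k}\overline{\mathcal G}_n\big(\tfrac{|v|^2+\lambda_k^2}2\big),\quad f_{U_{-ij}}(u)=c^{**}_{n-2,ij}\overline{\mathcal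 G}_n\big(\tfrac{|u|^2+\lambda_i^2+\lambda_j^2}2\big)$$ on $\mathbb R^{n-1},\mathbb R^{n-1},\mathbb R^{n-2}$; coordinates are indexed by the indices other than $k$, resp. $i,j$. $\xi_k$ (resp. $\eta_k$) is $w$ (resp. $v$) with $\lambda_k$ inserted at place $k$, $\tau_{ij}$ is $u$ with $\lambda_i,\lambda_j$ inserted at places $i,j$; $\lambda_{-k},\lambda_{-ij}$ are $\lambda$ with these coordinates deleted. For a density $f_X$, $\overline E^t_X[h(X)]=\int_{\{x:\,x_i>t_i\ \forall i\}}h f_X$ and $\overline F_X(t)=\overline E_X^t[1]$. Inequalities between vectors are componentwise. **1. Generators and constants.** The density of $GSSt_n(\mu,\Sigma,\gamma,m,H)$ is that of $GSE_n(\mu,\Sigma,g_n,H(\gamma^T\cdot))$, with $c_n=\Gamma(\frac{m+n}2)/(\Gamma(\frac m2)(m\pi)^{n/2})$. For $t\ge0$, $\overline G_n(t)=\frac m{m+n-2}(1+\frac{2t}m)^{-(m+n-2)/2}$, and, if $m+n>4$, $\overline{\mathcal G}_n(t)=\frac m{m+n-2}\frac m{m+n-4}(1+\frac{2t}m)^{-(m+n-4)/2}$.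 If $m>2$, $$c_n^*=\tfrac{(m+n-2)\Gamma(n/2)}{(2\pi)^{n/2}m}\Big[\int_0^\infty t^{\frac n2-1}(1+\tfrac{2t}m)^{-\frac{m+n-2}2}dt\Big]^{-1}=\tfrac{(m+n-2)\Gamma(n/2)}{(m\pi)^{n/2}mB(\frac n2,\frac{m-2}2)},\qquad \tfrac{c_n}{c_n^*}=\tfrac m{m-2}.$$ If $m>4$, $$c_n^{**}=\tfrac{(m+n-2)(m+n-4)\Gamma(n/2)}{(2\pi)^{n/2}m^2}\Big[\int_0^\infty t^{\frac n2-1}(1+\tfrac{2t}m)^{-\frac{m+n-4}2}dt\Big]^{-1}=\tfrac{(m+n-2)(m+n-4)\Gamma(n/2)}{(m\pi)^{n/2}m^2B(\frac n2,\frac{m-4}2)},\qquad \tfrac{c_n}{c_n^{**}}=\tfrac{m^2}{(m-2)(m-4)}.$$ **2. The vectors $W,V,U$.** Let $\Delta_k=\frac{m+\lambda_k^2}{m-1}I_{n-1}$, $\Lambda_k=\frac{m+\lambda_k^2}{m-3}I_{n-1}$, $\Theta_{ij}=\frac{m+\lambda_i^2+\lambda_j^2}{m-2}I_{n-2}$.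 For every $\lambda\in\mathbb R^n$: If $m>1$: $f_{W_{-k}}(w)=c^*_{n-1,k}\frac m{m+n-2}(1+\frac{\lambda_k^2}m)^{-\frac{m+n-2}2}(1+\frac{w^T\Delta_k^{-1}w}{m-1})^{-\frac{m+n-2}2}$, $W_{-k}\sim St_{n-1}(0,\Delta_k,m-1)$, $$c^*_{n-1,k}=\tfrac{\Gamma(\frac{m+n-2}2)(m+n-2)}{\Gamma(\frac{m-1}2)\pi^{\frac{n-1}2}m^{\frac{m+n}2}}(m+\lambda_k^2)^{\frac{m-1}2},\qquad \tfrac{c_n}{c^*_{n-1,k}}=\tfrac{\Gamma(\frac{m-1}2)m^{m/2}}{2\Gamma(\frac m2)\sqrt\pi}(m+\lambda_k^2)^{-\frac{m-1}2}.$$ If $m>3$: $f_{V_{-k}}(v)=c^{**}_{n-1,k}\frac m{m+n-2}\frac m{m+n-4}(1+\frac{\lambda_k^2}m)^{-\frac{m+n-4}2}(1+\frac{v^T\Lambda_k^{-1}v}{m-3})^{-\frac{m+n-4}2}$, $V_{-k}\sim St_{n-1}(0,\Lambda_k,m-3)$, $$c^{**}_{n-1,k}=\tfrac{\Gamma(\frac{m+n-4}2)(m+n-2)(m+n-4)}{\Gamma(\frac{m-3}2)\pi^{\frac{n-1}2}m^{\frac{m+n}2}}(m+\lambda_k^2)^{\frac{m-3}2},\qquad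 \tfrac{c_n}{c^{**}_{n-1,k}}=\tfrac{\Gamma(\frac{m-3}2)m^{m/2}}{4\Gamma(\frac m2)\sqrt\pi}(m+\lambda_k^2)^{-\frac{m-3}2}.$$ If $m>2$ and $i\ne j$: $f_{U_{-ij}}(u)=c^{**}_{n-2,ij}\frac m{m+n-2}\frac m{m+n-4}(1+\frac{\lambda_i^2+\lambda_j^2}m)^{-\frac{m+n-4}2}(1+\frac{u^T\Theta_{ij}^{-1}u}{m-2})^{-\frac{m+n-4}2}$, $U_{-ij}\sim St_{n-2}(0,\Theta_{ij},m-2)$, $$c^{**}_{n-2,ij}=\tfrac{\Gamma(\frac{m+n-4}2)(m+n-2)(m+n-4)}{\Gamma(\frac{m-2}2)\pi^{\frac{n-2}2}m^{\frac{m+n}2}}(m+\lambda_i^2+\lambda_j^2)^{\frac{m-2}2},\qquad \tfrac{c_n}{c^{**}_{n-2,ij}}=\tfrac{m^{m/2}}{2(m-2)\pi}(m+\lambda_i^2+\lambda_j^2)^{-\frac{m-2}2}.$$ **3. Standardization.** Let $Y\sim GSSt_n(\mu,\Sigma,\gamma,m,H)$ with $H$ a skewing function, and $Z=\Sigma^{-1/2}(Y-\mu)$.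 Then $Z\sim GSSt_n(0,I_n,\gamma,m,H)$. Put $MTCE_Z(\lambda)=E[Z\mid Z>\lambda]$ and $\Omega(\lambda)=\operatorname{Cov}(Z\mid Z>\lambda)$. If $m>2$, $Y$ and $Z$ are square integrable. If moreover $q\in(0,1)^n$, $y_q=(VaR_{q_i}(Y_i))_i$ with $VaR_q(X)=\inf\{x:F_X(x)\ge q\}$, $\lambda_q=\Sigma^{-1/2}(y_q-\mu)$ and $\overline F_Z(\lambda_q)>0$, then $$E[Y\mid Z>\lambda_q]=\mu+\Sigma^{1/2}MTCE_Z(\lambda_q),\qquad \operatorname{Cov}(Y\mid Z>\lambda_q)=\Sigma^{1/2}\,\Omega(\lambda_q)\,\Sigma^{1/2};$$ if $\Sigma$ is diagonal, the same holds with the event $\{Y>y_q\}$ in place of $\{Z>\lambda_q\}$, i.e. $MTCov_Y(y_q)=\Sigma^{1/2}\Omega(\lambda_q)\Sigma^{1/2}$. **4. Entries of $\Omega$, general $H$.** Let $m>4$, $H$ a twice continuously differentiable skewing function, $Y$, $Z$ as in 3, and $\lambda\in\mathbb R^n$ with $\overline F_Z(\lambda)>0$ such that the tail expectations below that contain $H'$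 or $H''$ (those of $M$ and $X^{**}$, and those of $V_{-k}$ for all $k$) exist as absolutely convergent integrals. With $M\sim St_n(0,I_n,m)$, $X^{**}\sim E_n(0,I_n,\overline{\mathcal G}_n)$, $Z^*\sim GSE_n(0,I_n,\overline G_n,H(\gamma^T\cdot))$, $$MTCE_Z(\lambda)_k=\tfrac1{\overline F_Z(\lambda)}\Big\{\tfrac{2c_n}{c^*_{n-1,k}}\overline E^{\lambda_{-k}}_{W_{-k}}[H(\gamma^T\xi_k)]+\tfrac{2m\gamma_k}{m+n-2}\overline E^{\lambda}_M\big[(1+\tfrac{M^TM}m)H'(\gamma^TM)\big]\Big\},$$ for $i\neq j$ $$\Omega_{ij}=\tfrac2{\overline F_Z(\lambda)}\Big\{\tfrac{c_n}{c^{**}_{n-2,ij}}\overline E^{\lambda_{-ij}}_{U_{-ij}}[H(\gamma^T\tau_{ij})]+\tfrac{c_n}{c^{**}_{n-1,i}}\gamma_j\overline E^{\lambda_{-i}}_{V_{-i}}[H'(\gamma^T\eta_i)]+\tfrac{c_n}{c^{**}_{n-1,j}}\gamma_i\overline E^{\lambda_{-j}}_{V_{-j}}[H'(\gamma^T\eta_j)]+\tfrac{m^2\gamma_i\gamma_j}{(m-2)(m-4)}\overline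 E^\lambda_{X^{**}}[H''(\gamma^TX^{**})]\Big\}-MTCE_Z(\lambda)_iMTCE_Z(\lambda)_j,$$ $$\Omega_{ii}=\tfrac2{\overline F_Z(\lambda)}\Big\{\tfrac{c_n}{c^*_{n-1,i}}\lambda_i\overline E^{\lambda_{-i}}_{W_{-i}}[H(\gamma^T\xi_i)]+\tfrac{c_n}{c^{**}_{n-1,i}}\gamma_i\overline E^{\lambda_{-i}}_{V_{-i}}[H'(\gamma^T\eta_i)]+\tfrac{m^2\gamma_i^2}{(m-2)(m-4)}\overline E^\lambda_{X^{**}}[H''(\gamma^TX^{**})]\Big\}+\tfrac m{m-2}\tfrac{\overline F_{Z^*}(\lambda)}{\overline F_Z(\lambda)}-MTCE_Z(\lambda)_i^2 .$$ **5. Skew Student-$t$.** Let $m>4$, let $H=T$ be the distribution function and $\mathbf t$ the density of the one-dimensional standard Student-$t$ distribution with $m$ degrees of freedom. Then for every $\lambda\in\mathbb R^n$ the three formulas of 4 hold with $H$ replaced by $T$, $H'$ by $\mathbf t$, and $\frac{m^2}{(m-2)(m-4)}\overline E^\lambda_{X^{**}}[H''(\gamma^TX^{**})]$ by $-\frac{(m+1)m}{(m-2)(m-4)}\overline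 E^\lambda_{X^{**}}\big[(1+\frac{(\gamma^TX^{**})^2}m)^{-1}\gamma^TX^{**}\,\mathbf t(\gamma^TX^{**})\big]$. **6. Symmetric Student-$t$.** Let $m>2$ and $H\equiv\frac12$. Then $Z\sim St_n(0,I_n,m)$ and, with $Z^*\sim E_n(0,I_n,\overline G_n)$, for every $\lambda\in\mathbb R^n$ $$MTCE_Z(\lambda)_k=\tfrac{1}{\overline F_Z(\lambda)}\tfrac{c_n}{c^*_{n-1,k}}\overline F_{W_{-k}}(\lambda_{-k}),\qquad \Omega_{ij}=\tfrac1{\overline F_Z(\lambda)}\tfrac{c_n}{c^{**}_{n-2,ij}}\overline F_{U_{-ij}}(\lambda_{-ij})-MTCE_Z(\lambda)_iMTCE_Z(\lambda)_j\ (i\ne j),$$ $$\Omega_{ii}=\tfrac1{\overline F_Z(\lambda)}\tfrac{c_n}{c^*_{n-1,i}}\lambda_i\overline F_{W_{-i}}(\lambda_{-i})+\tfrac m{m-2}\tfrac{\overline F_{Z^*}(\lambda)}{\overline F_Z(\lambda)}-MTCE_Z(\lambda)_i^2 .$$ -/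

import Mathlib

open MeasureTheory ProbabilityTheory Matrix

noncomputable section

namespace SkewStudent

/-! ### Linear algebra and index bookkeeping -/

open scoped MatrixOrder in
/-- The positive semidefinite square root `A^{1/2}` of a positive semidefinite real matrix. -/
def msqrt {ι : Type*} [Fintype ι] [DecidableEq ι] (A : Matrix ι ι ℝ) : Matrix ι ι ℝ :=
  CFC.sqrt A

/-- The open upper orthant `{z : z_i > t_i for all i}`, i.e. the domain of `∫_t^∞`. -/
def orthant {ι : Type*} (t : ι → ℝ) : Set (ι → ℝ) := {z | ∀ i, t i < z i}

/-- Index set of the coordinates other than `k`. -/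
abbrev Drop1 {n : ℕ} (k : Fin n) : Type := {l : Fin n // l ≠ k}

/-- Index set of the coordinates other than `i` and `j`. -/
abbrev Drop2 {n : ℕ} (i j : Fin n) : Type := {l : Fin n // l ≠ i ∧ l ≠ j}

/-- The vector `lam_{-k}`, obtained from `lam` by deleting coordinate `k`. -/
def drop1 {n : ℕ} (k : Fin n) (lam : Fin n → ℝ) : Drop1 k → ℝ := fun l => lam l

/-- The vector `lam_{-ij}`, obtained from `lam` by deleting the coordinates `i` and `j`. -/
def drop2 {n : ℕ} (i j : Fin n) (lam : Fin n → ℝ) : Drop2 i j → ℝ := fun l => lam l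

/-- The vector `(w_1, …, w_{k-1}, lam_k, w_{k+1}, …, w_n)`. -/
def insert1 {n : ℕ} (k : Fin n) (lam : Fin n → ℝ) (w : Drop1 k → ℝ) : Fin n → ℝ :=
  fun l => if h : l ≠ k then w ⟨l, h⟩ else lam l

/-- The vector with coordinates `lam_i`, `lam_j` in the places `i`, `j` and `u_l` elsewhere. -/
def insert2 {n : ℕ} (i j : Fin n) (lam : Fin n → ℝ) (u : Drop2 i j → ℝ) : Fin n → ℝ :=
  fun l => if h : l ≠ i ∧ l ≠ j then u ⟨l, h⟩ else lam l

/-! ### Density generators and (skew-)elliptical densities -/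

/-- Cumulative generator `u ↦ ∫_u^∞ g(v) dv`. -/
def cumGen (g : ℝ → ℝ) : ℝ → ℝ := fun u => ∫ v in Set.Ioi u, g v

/-- Shifted generator `u ↦ G(u + a)`. -/
def shiftGen (G : ℝ → ℝ) (a : ℝ) : ℝ → ℝ := fun u => G (u + a)

/-- Normalizing constant of the `d`-variate elliptical density with generator `G`:
`Γ(d/2) / (2π)^{d/2} * [∫_0^∞ s^{d/2-1} G(s) ds]⁻¹`.  In dimension `0` (where `ℝ^0` is one point of
mass one and the formula has no meaning) it is `1 / G(0)`. -/
def normConst (d : ℕ) (G : ℝ → ℝ) : ℝ :=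
  if d = 0 then (G 0)⁻¹
  else Real.Gamma ((d : ℝ) / 2) / (2 * Real.pi) ^ ((d : ℝ) / 2) *
    (∫ s in Set.Ioi (0 : ℝ), s ^ ((d : ℝ) / 2 - 1) * G s)⁻¹

section densities

variable {ι : Type*} [Fintype ι] [DecidableEq ι]

/-- Density of the elliptical distribution `E(μ, Σ, G)`. -/
def ellPDF (μ : ι → ℝ) (Sig : Matrix ι ι ℝ) (G : ℝ → ℝ) (x : ι → ℝ) : ℝ :=
  normConst (Fintype.card ι) G / √Sig.det * G (1 / 2 * ((x - μ) ⬝ᵥ (Sig⁻¹ *ᵥ (x - μ))))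

/-- Density of the generalized skew-elliptical distribution `GSE(μ, Σ, G, K)`, for a skewing
function `K` on `ℝ^ι`. -/
def gsePDF (μ : ι → ℝ) (Sig : Matrix ι ι ℝ) (G : ℝ → ℝ) (K : (ι → ℝ) → ℝ) (y : ι → ℝ) : ℝ :=
  2 * ellPDF μ Sig G y * K ((msqrt Sig)⁻¹ *ᵥ (y - μ))

/-- Density of the multivariate Student-t distribution `St(μ, Σ, ν)`. -/
def stPDF (μ : ι → ℝ) (Sig : Matrix ι ι ℝ) (ν : ℝ) (x : ι → ℝ) : ℝ :=
  Real.Gamma ((ν + Fintype.card ι) / 2) /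
      (Real.Gamma (ν / 2) * (ν * Real.pi) ^ ((Fintype.card ι : ℝ) / 2) * √Sig.det) *
    (1 + (x - μ) ⬝ᵥ (Sig⁻¹ *ᵥ (x - μ)) / ν) ^ (-(ν + Fintype.card ι) / 2)

/-- Density of the generalized skew Student-t distribution `GSSt(μ, Σ, γ, m, H)`. -/
def gsstPDF (μ : ι → ℝ) (Sig : Matrix ι ι ℝ) (γ : ι → ℝ) (m : ℝ) (H : ℝ → ℝ) (y : ι → ℝ) : ℝ :=
  2 * stPDF μ Sig m y * H (γ ⬝ᵥ ((msqrt Sig)⁻¹ *ᵥ (y - μ)))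

/-- Tail expectation `∫_t^∞ h(z) f(z) dz` with respect to a density `f`. -/
def tailExp (f : (ι → ℝ) → ℝ) (t : ι → ℝ) (h : (ι → ℝ) → ℝ) : ℝ :=
  ∫ z in orthant t, h z * f z

/-- The tail expectation `∫_t^∞ h(z) f(z) dz` exists as a finite Lebesgue integral. -/
def HasTailExp (f : (ι → ℝ) → ℝ) (t : ι → ℝ) (h : (ι → ℝ) → ℝ) : Prop :=
  IntegrableOn (fun z => h z * f z) (orthant t)

/-- Tail function `∫_t^∞ f(z) dz` of a density `f`. -/
def tailFn (f : (ι → ℝ) → ℝ) (t : ι → ℝ) : ℝ := ∫ z in orthant t, f z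

end densities

/-- `H` is a skewing function on the line. -/
def IsSkewing (H : ℝ → ℝ) : Prop :=
  Measurable H ∧ (∀ x, H (-x) = 1 - H x) ∧ ∀ x, 0 ≤ H x ∧ H x ≤ 1

/-- Density of the standard one-dimensional Student-t distribution with `m` degrees of freedom. -/
def tPDF (m x : ℝ) : ℝ :=
  Real.Gamma ((m + 1) / 2) / (Real.Gamma (m / 2) * √(m * Real.pi)) *
    (1 + x ^ 2 / m) ^ (-(m + 1) / 2)

/-- Distribution function of the standard one-dimensional Student-t distribution. -/
def tCDF (m x : ℝ) : ℝ := ∫ s in Set.Iic x, tPDF m s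

/-! ### The Student-t generator and the associated constants -/

/-- Student-t generator `g_n(u) = (1 + 2u/m)^{-(m+n)/2}`. -/
def stGen (n : ℕ) (m u : ℝ) : ℝ := (1 + 2 * u / m) ^ (-(m + n) / 2)

/-- First cumulative generator of `g_n`. -/
def G1 (n : ℕ) (m : ℝ) : ℝ → ℝ := cumGen (stGen n m)

/-- Second cumulative generator of `g_n`. -/
def G2 (n : ℕ) (m : ℝ) : ℝ → ℝ := cumGen (G1 n m)

/-- `c_n`. -/
def c0 (n : ℕ) (m : ℝ) : ℝ := normConst n (stGen n m)

/-- `c*_n`. -/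
def c1 (n : ℕ) (m : ℝ) : ℝ := normConst n (G1 n m)

/-- `c**_n`. -/
def c2 (n : ℕ) (m : ℝ) : ℝ := normConst n (G2 n m)

/-- `c*_{n-1,k}`, as a function of `a = lam_k`. -/
def cW (n : ℕ) (m a : ℝ) : ℝ := normConst (n - 1) (shiftGen (G1 n m) (a ^ 2 / 2))

/-- `c**_{n-1,k}`, as a function of `a = lam_k`. -/
def cV (n : ℕ) (m a : ℝ) : ℝ := normConst (n - 1) (shiftGen (G2 n m) (a ^ 2 / 2))

/-- `c**_{n-2,ij}`, as a function of `a = lam_i` and `b = lam_j`. -/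
def cU (n : ℕ) (m a b : ℝ) : ℝ := normConst (n - 2) (shiftGen (G2 n m) (a ^ 2 / 2 + b ^ 2 / 2))

/-- The density of `W_{-k}`. -/
def fW {n : ℕ} (m : ℝ) (lam : Fin n → ℝ) (k : Fin n) (w : Drop1 k → ℝ) : ℝ :=
  cW n m (lam k) * G1 n m (1 / 2 * (w ⬝ᵥ w) + 1 / 2 * lam k ^ 2)

/-- The density of `V_{-k}`. -/
def fV {n : ℕ} (m : ℝ) (lam : Fin n → ℝ) (k : Fin n) (v : Drop1 k → ℝ) : ℝ :=
  cV n m (lam k) * G2 n m (1 / 2 * (v ⬝ᵥ v) + 1 / 2 * lam k ^ 2)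

/-- The density of `U_{-ij}`. -/
def fU {n : ℕ} (m : ℝ) (lam : Fin n → ℝ) (i j : Fin n) (u : Drop2 i j → ℝ) : ℝ :=
  cU n m (lam i) (lam j) * G2 n m (1 / 2 * (u ⬝ᵥ u) + 1 / 2 * lam i ^ 2 + 1 / 2 * lam j ^ 2)

/-- Scale matrix `Δ_k` of `W_{-k}`. -/
def scaleW {n : ℕ} (m : ℝ) (lam : Fin n → ℝ) (k : Fin n) : Matrix (Drop1 k) (Drop1 k) ℝ :=
  ((m + lam k ^ 2) / (m - 1)) • 1

/-- Scale matrix `Λ_k` of `V_{-k}`. -/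
def scaleV {n : ℕ} (m : ℝ) (lam : Fin n → ℝ) (k : Fin n) : Matrix (Drop1 k) (Drop1 k) ℝ :=
  ((m + lam k ^ 2) / (m - 3)) • 1

/-- Scale matrix `Θ_ij` of `U_{-ij}`. -/
def scaleU {n : ℕ} (m : ℝ) (lam : Fin n → ℝ) (i j : Fin n) : Matrix (Drop2 i j) (Drop2 i j) ℝ :=
  ((m + lam i ^ 2 + lam j ^ 2) / (m - 2)) • 1

/-- Density of `St_{n-1}(0, Δ_k, m-1)`. -/
def stW {n : ℕ} (m : ℝ) (lam : Fin n → ℝ) (k : Fin n) : (Drop1 k → ℝ) → ℝ :=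
  stPDF 0 (scaleW m lam k) (m - 1)

/-- Density of `St_{n-1}(0, Λ_k, m-3)`. -/
def stV {n : ℕ} (m : ℝ) (lam : Fin n → ℝ) (k : Fin n) : (Drop1 k → ℝ) → ℝ :=
  stPDF 0 (scaleV m lam k) (m - 3)

/-- Density of `St_{n-2}(0, Θ_ij, m-2)`. -/
def stU {n : ℕ} (m : ℝ) (lam : Fin n → ℝ) (i j : Fin n) : (Drop2 i j → ℝ) → ℝ :=
  stPDF 0 (scaleU m lam i j) (m - 2)

/-! ### Random vectors, value at risk, tail mean and tail covariance -/

section probability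

variable {S ι : Type*} [MeasurableSpace S] [Fintype ι]

/-- The random vector `Y` has the density `f` with respect to Lebesgue measure. -/
def HasDensity (P : Measure S) (Y : S → ι → ℝ) (f : (ι → ℝ) → ℝ) : Prop :=
  Measurable Y ∧ P.map Y = (volume : Measure (ι → ℝ)).withDensity fun y => ENNReal.ofReal (f y)

/-- Value at risk `inf {x : F_X(x) ≥ q}` of a random variable. -/
def VaR (P : Measure S) (X : S → ℝ) (q : ℝ) : ℝ := sInf {x | q ≤ P.real {s | X s ≤ x}}

/-- Componentwise value at risk of a random vector. -/
def VaRVec (P : Measure S) (Y : S → ι → ℝ) (q : ι → ℝ) : ι → ℝ :=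
  fun i => VaR P (fun s => Y s i) (q i)

/-- Conditional mean vector `E[X | A]`. -/
def condMean (P : Measure S) (X : S → ι → ℝ) (A : Set S) : ι → ℝ :=
  fun i => ∫ s, X s i ∂(P[|A])

/-- Conditional covariance matrix `E[(X - E[X|A]) (X - E[X|A])ᵀ | A]`. -/
def condCov (P : Measure S) (X : S → ι → ℝ) (A : Set S) : Matrix ι ι ℝ :=
  Matrix.of fun i j => ∫ s, (X s i - condMean P X A i) * (X s j - condMean P X A j) ∂(P[|A])

/-- Multivariate tail conditional expectation `E[X | X > t]`. -/
def MTCE (P : Measure S) (X : S → ι → ℝ) (t : ι → ℝ) : ι → ℝ :=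
  condMean P X {s | ∀ i, t i < X s i}

/-- Multivariate tail covariance `Cov(X | X > t)`. -/
def MTCov (P : Measure S) (X : S → ι → ℝ) (t : ι → ℝ) : Matrix ι ι ℝ :=
  condCov P X {s | ∀ i, t i < X s i}

variable [DecidableEq ι]

/-- The standardization `Σ^{-1/2} (y - μ)`. -/
def standardize (μ : ι → ℝ) (Sig : Matrix ι ι ℝ) (y : ι → ℝ) : ι → ℝ :=
  (msqrt Sig)⁻¹ *ᵥ (y - μ)

end probability

end SkewStudent

end

/-!
Differentiating `(1 + |z|² / m)^{-p}` in the coordinate `z k` produces `z k` times the kernel with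
exponent `p + 1`, so multiplying a Student density by a coordinate amounts to differentiating its
cumulative generator. Integrating by parts over the orthant `{z > lam}`, once for the mean and twice
for the covariance, turns the tail moments into boundary terms on the faces `z k = lam k` and on the
edges `z i = lam i`, `z j = lam j`, and into bulk terms in which the derivative has fallen on `H`.
The power generators are closed under cumulation and under the shifts `u ↦ u + lam k ^ 2 / 2`, so
the kernels restricted to faces and edges are rescaled Student kernels: these are the laws of `W`,
`V` and `U`, and a single Beta integral gives all normalizing constants. Standardization is an
affine change of variables.
-/

noncomputable section

namespace SkewStudent

/-! ### Power generators -/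

theorem integral_Ioo_rpow_mul_one_sub_rpow {a b : ℝ} (ha : 0 < a) (hb : 0 < b) :
    ∫ x in Set.Ioo (0 : ℝ) 1, x ^ (a - 1) * (1 - x) ^ (b - 1) = beta a b := by
  have hcomplex : Complex.betaIntegral a b =
      ((∫ x in (0 : ℝ)..1, x ^ (a - 1) * (1 - x) ^ (b - 1) : ℝ) : ℂ) := by
    rw [Complex.betaIntegral, ← intervalIntegral.integral_ofReal]
    refine intervalIntegral.integral_congr fun x hx => ?_
    rw [Set.uIcc_of_le zero_le_one] at hx
    push_cast [Complex.ofReal_cpow hx.1, Complex.ofReal_cpow (sub_nonneg.2 hx.2)]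
    rfl
  rw [beta_eq_betaIntegralReal a b ha hb, hcomplex, Complex.ofReal_re,
    intervalIntegral.integral_of_le zero_le_one, integral_Ioc_eq_integral_Ioo]

theorem image_div_one_add_Ioi : (fun s : ℝ => s / (1 + s)) '' Set.Ioi 0 = Set.Ioo 0 1 := by
  ext x
  constructor
  · rintro ⟨s, hs : 0 < s, rfl⟩
    exact ⟨by positivity, (div_lt_one (by positivity)).2 (by linarith)⟩
  · rintro ⟨hx0, hx1⟩
    have hsub : 0 < 1 - x := sub_pos.2 hx1
    exact ⟨x / (1 - x), div_pos hx0 hsub, by field_simp; ring⟩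

theorem injOn_div_one_add_Ioi : Set.InjOn (fun s : ℝ => s / (1 + s)) (Set.Ioi 0) := by
  intro s (hs : 0 < s) t (ht : 0 < t) h
  simp only [div_eq_div_iff (show 1 + s ≠ 0 by positivity) (show 1 + t ≠ 0 by positivity)] at h
  linarith

theorem hasDerivAt_div_one_add {s : ℝ} (hs : 1 + s ≠ 0) :
    HasDerivAt (fun s : ℝ => s / (1 + s)) (1 / (1 + s) ^ 2) s := by
  refine ((hasDerivAt_id' s).fun_div ((hasDerivAt_id' s).const_add 1) hs).congr_deriv ?_
  ring

theorem integral_Ioi_rpow_mul_one_add_rpow {a b : ℝ} (ha : 0 < a) (hb : 0 < b) :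
    ∫ s in Set.Ioi (0 : ℝ), s ^ (a - 1) * (1 + s) ^ (-(a + b)) = beta a b := by
  rw [← integral_Ioo_rpow_mul_one_sub_rpow ha hb, ← image_div_one_add_Ioi,
    integral_image_eq_integral_abs_deriv_smul measurableSet_Ioi
      (fun s (hs : 0 < s) => (hasDerivAt_div_one_add (by positivity)).hasDerivWithinAt)
      injOn_div_one_add_Ioi]
  refine setIntegral_congr_fun measurableSet_Ioi fun s (hs : 0 < s) => ?_
  have hs1 : 0 < 1 + s := by positivity
  have hsub : 1 - s / (1 + s) = (1 + s)⁻¹ := by field_simp; ring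
  simp only [smul_eq_mul]
  rw [hsub, abs_of_pos (by positivity), Real.div_rpow hs.le hs1.le, Real.inv_rpow hs1.le,
    Real.rpow_neg hs1.le, Real.rpow_add hs1, Real.rpow_sub hs1, Real.rpow_sub hs1, Real.rpow_one]
  field_simp

theorem normConst_congr {d : ℕ} {G G' : ℝ → ℝ} (h : ∀ u, 0 ≤ u → G u = G' u) :
    normConst d G = normConst d G' := by
  have hint : ∫ s in Set.Ioi (0 : ℝ), s ^ ((d : ℝ) / 2 - 1) * G s =
      ∫ s in Set.Ioi (0 : ℝ), s ^ ((d : ℝ) / 2 - 1) * G' s :=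
    setIntegral_congr_fun measurableSet_Ioi fun s (hs : 0 < s) => by simp only [h s hs.le]
  simp only [normConst, hint, h 0 le_rfl]

theorem integral_Ioi_one_add_rpow {M p : ℝ} (hM : 0 < M) (hp : 1 < p) {t : ℝ} (ht : 0 ≤ t) :
    ∫ v in Set.Ioi t, (1 + 2 * v / M) ^ (-p) =
      M / 2 * ((1 + 2 * t / M) ^ (-(p - 1)) / (p - 1)) := by
  have hscale (v : ℝ) : 1 + 2 * v / M = 1 + 2 / M * v := by ring
  have hshift : ∫ y in Set.Ioi (2 / M * t), (1 + y) ^ (-p) =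
      ∫ y in Set.Ioi (1 + 2 / M * t), y ^ (-p) := by
    have h := (measurePreserving_add_left volume (1 : ℝ)).setIntegral_preimage_emb
      (MeasurableEquiv.addLeft (1 : ℝ)).measurableEmbedding (fun y => y ^ (-p))
      (Set.Ioi (1 + 2 / M * t))
    rwa [Set.preimage_const_add_Ioi, add_sub_cancel_left] at h
  simp_rw [hscale]
  rw [integral_comp_mul_left_Ioi (fun y : ℝ => (1 + y) ^ (-p)) t (by positivity), hshift,
    integral_Ioi_rpow_of_lt (by linarith) (by positivity), inv_div, smul_eq_mul,
    neg_add_eq_sub, ← neg_sub p 1, neg_div_neg_eq]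

theorem dotProduct_inv_smul_mulVec {ι : Type*} [Fintype ι] [DecidableEq ι]
    {Sig : Matrix ι ι ℝ} (hSig : Sig.PosDef) {c : ℝ} (hc : c ≠ 0) (x : ι → ℝ) :
    x ⬝ᵥ ((c • Sig)⁻¹ *ᵥ x) = x ⬝ᵥ (Sig⁻¹ *ᵥ x) / c := by
  have := invertibleOfNonzero hc
  rw [Matrix.inv_smul _ _ hSig.det_pos.ne'.isUnit, invOf_eq_inv, smul_mulVec, dotProduct_smul,
    smul_eq_mul, inv_mul_eq_div]

/-- `G` is the power generator `A Γ(p) (1 + 2u/M)^{-p}` on `[0, ∞)`. With `Γ(p)` split off from the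
coefficient, passing to the cumulative generator is `(A, M, p) ↦ (A * (M / 2), M, p - 1)`, and the
`d`-variate normalizing constant is `(A Γ(p - d/2) (Mπ)^{d/2})⁻¹`. -/
def IsPowerGen (G : ℝ → ℝ) (A M p : ℝ) : Prop :=
  ∀ u, 0 ≤ u → G u = A * Real.Gamma p * (1 + 2 * u / M) ^ (-p)

namespace IsPowerGen

variable {G : ℝ → ℝ} {A M p a ν : ℝ} {d : ℕ}

theorem cumGen (hG : IsPowerGen G A M p) (hM : 0 < M) (hp : 1 < p) :
    IsPowerGen (SkewStudent.cumGen G) (A * (M / 2)) M (p - 1) := by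
  intro t ht
  have hp1 : p - 1 ≠ 0 := by linarith
  have hΓ : Real.Gamma p = (p - 1) * Real.Gamma (p - 1) := by
    simpa using Real.Gamma_add_one hp1
  rw [SkewStudent.cumGen, setIntegral_congr_fun measurableSet_Ioi
    fun v (hv : t < v) => hG v (ht.trans hv.le), integral_const_mul,
    integral_Ioi_one_add_rpow hM hp ht, hΓ]
  field_simp

theorem shiftGen (hG : IsPowerGen G A M p) (hM : 0 < M) (ha : 0 ≤ a) :
    IsPowerGen (shiftGen G a) (A * (1 + 2 * a / M) ^ (-p)) (M + 2 * a) p := by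
  intro u hu
  have hprod : 1 + 2 * (u + a) / M = (1 + 2 * a / M) * (1 + 2 * u / (M + 2 * a)) := by
    field_simp
    ring
  rw [SkewStudent.shiftGen, hG _ (by positivity), hprod,
    Real.mul_rpow (by positivity) (by positivity)]
  ring

theorem normConst_eq_integral (hG : IsPowerGen G A M p) (hd : d ≠ 0) :
    normConst d G = Real.Gamma ((d : ℝ) / 2) / ((2 * Real.pi) ^ ((d : ℝ) / 2) *
      (A * Real.Gamma p)) * (∫ t in Set.Ioi (0 : ℝ),
        t ^ ((d : ℝ) / 2 - 1) * (1 + 2 * t / M) ^ (-p))⁻¹ := by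
  rw [normConst_congr hG, normConst, if_neg hd]
  simp_rw [mul_left_comm _ (A * Real.Gamma p)]
  rw [integral_const_mul, mul_inv, ← mul_assoc, div_mul_eq_div_div, div_eq_mul_inv _ (A * _)]

theorem normConst_eq_beta (hG : IsPowerGen G A M p) (hM : 0 < M) (hd : d ≠ 0)
    (hp : (d : ℝ) / 2 < p) :
    normConst d G = Real.Gamma ((d : ℝ) / 2) / ((M * Real.pi) ^ ((d : ℝ) / 2) *
      (A * Real.Gamma p) * beta ((d : ℝ) / 2) (p - d / 2)) := by
  have hd' : (0 : ℝ) < d / 2 := by positivity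
  have hM2 : 0 < 2 / M := by positivity
  have hscale : ∫ t in Set.Ioi (0 : ℝ), t ^ ((d : ℝ) / 2 - 1) * (1 + 2 * t / M) ^ (-p) =
      (M / 2) ^ ((d : ℝ) / 2) * beta ((d : ℝ) / 2) (p - d / 2) := by
    have h := integral_comp_mul_left_Ioi'
      (fun s : ℝ => s ^ ((d : ℝ) / 2 - 1) * (1 + s) ^ (-p)) 0 hM2
    have hbeta := integral_Ioi_rpow_mul_one_add_rpow hd' (sub_pos.2 hp)
    rw [add_sub_cancel] at hbeta
    rw [mul_zero, hbeta] at h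
    rw [← h, smul_eq_mul, ← integral_const_mul, ← integral_const_mul]
    refine setIntegral_congr_fun measurableSet_Ioi fun s (hs : 0 < s) => ?_
    simp only [Real.mul_rpow hM2.le hs.le, Real.rpow_sub hM2, Real.rpow_one,
      Real.div_rpow hM.le zero_le_two, Real.div_rpow zero_le_two hM.le]
    field_simp
  rw [hG.normConst_eq_integral hd, hscale, Real.mul_rpow zero_le_two Real.pi_pos.le,
    Real.mul_rpow hM.le Real.pi_pos.le, Real.div_rpow hM.le zero_le_two]
  field_simp

theorem normConst_eq (hG : IsPowerGen G A M p) (hM : 0 < M) (hp : (d : ℝ) / 2 < p) :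
    normConst d G = (A * Real.Gamma (p - d / 2) * (M * Real.pi) ^ ((d : ℝ) / 2))⁻¹ := by
  have hp0 : 0 < p := lt_of_le_of_lt (by positivity) hp
  rcases eq_or_ne d 0 with rfl | hd
  · simp [normConst, hG 0 le_rfl]
  · have hΓd : Real.Gamma ((d : ℝ) / 2) ≠ 0 := (Real.Gamma_pos_of_pos (by positivity)).ne'
    have hΓp : Real.Gamma p ≠ 0 := (Real.Gamma_pos_of_pos hp0).ne'
    rw [hG.normConst_eq_beta hM hd hp, beta, add_sub_cancel]
    field_simp

theorem normConst_shiftGen (hG : IsPowerGen G A M p) (hM : 0 < M) (ha : 0 ≤ a)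
    (hp : (d : ℝ) / 2 < p) :
    normConst d (SkewStudent.shiftGen G a) = (M + 2 * a) ^ (p - d / 2) /
      (A * Real.Gamma (p - d / 2) * M ^ p * Real.pi ^ ((d : ℝ) / 2)) := by
  have hMa : 0 < M + 2 * a := by positivity
  have hfrac : 1 + 2 * a / M = (M + 2 * a) / M := by field_simp
  rw [(hG.shiftGen hM ha).normConst_eq hMa hp, hfrac, Real.rpow_neg (by positivity),
    Real.div_rpow hMa.le hM.le, Real.mul_rpow hMa.le Real.pi_pos.le, Real.rpow_sub hMa]
  field_simp

variable {ι : Type*} [Fintype ι] [DecidableEq ι]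

theorem ellPDF_eq_stPDF (hG : IsPowerGen G A M p) (hM : 0 < M) (hA : A ≠ 0) (hν : 0 < ν)
    (hp : ν + Fintype.card ι = 2 * p) (μ : ι → ℝ) {Sig : Matrix ι ι ℝ} (hSig : Sig.PosDef) :
    ellPDF μ Sig G = stPDF μ ((M / ν) • Sig) ν := by
  funext x
  have hquad : 0 ≤ (x - μ) ⬝ᵥ (Sig⁻¹ *ᵥ (x - μ)) := by
    simpa using hSig.inv.posSemidef.dotProduct_mulVec_nonneg (x - μ)
  have hp_eq : (ν + Fintype.card ι) / 2 = p := by linarith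
  have hp_sub : p - (Fintype.card ι : ℝ) / 2 = ν / 2 := by linarith
  have hΓ : Real.Gamma (ν / 2) ≠ 0 := (Real.Gamma_pos_of_pos (half_pos hν)).ne'
  have hsqrt : √((M / ν) ^ Fintype.card ι) = (M / ν) ^ ((Fintype.card ι : ℝ) / 2) := by
    rw [Real.sqrt_eq_rpow, ← Real.rpow_natCast_mul (by positivity), mul_one_div]
  rw [ellPDF, stPDF, hG _ (by positivity), hG.normConst_eq hM (by linarith), hp_sub,
    dotProduct_inv_smul_mulVec hSig (by positivity), Matrix.det_smul, neg_div, hp_eq,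
    Real.sqrt_mul (by positivity), hsqrt, Real.mul_rpow hM.le Real.pi_pos.le,
    Real.mul_rpow hν.le Real.pi_pos.le, Real.div_rpow hM.le hν.le]
  have hdet : √Sig.det ≠ 0 := (Real.sqrt_pos.2 hSig.det_pos).ne'
  have hbase : 1 + 2 * (1 / 2 * ((x - μ) ⬝ᵥ (Sig⁻¹ *ᵥ (x - μ)))) / M =
      1 + (x - μ) ⬝ᵥ (Sig⁻¹ *ᵥ (x - μ)) / (M / ν) / ν := by field_simp
  rw [hbase]
  field_simp

theorem shiftGen_half_dotProduct (hG : IsPowerGen G A M p) (hM : 0 < M) (ha : 0 ≤ a)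
    (hν : ν ≠ 0) (x : ι → ℝ) :
    SkewStudent.shiftGen G a (1 / 2 * (x ⬝ᵥ x)) =
      A * Real.Gamma p * (1 + 2 * a / M) ^ (-p) *
        (1 + x ⬝ᵥ ((((M + 2 * a) / ν) • (1 : Matrix ι ι ℝ))⁻¹ *ᵥ x) / ν) ^ (-p) := by
  have hx : 0 ≤ x ⬝ᵥ x := Finset.sum_nonneg fun i _ => mul_self_nonneg (x i)
  have hbase : 2 * (1 / 2 * (x ⬝ᵥ x)) / (M + 2 * a) = x ⬝ᵥ x / ((M + 2 * a) / ν) / ν := by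
    field_simp
  rw [hG.shiftGen hM ha _ (by positivity), dotProduct_inv_smul_mulVec Matrix.PosDef.one
    (by positivity), inv_one, one_mulVec, hbase]
  ring

end IsPowerGen

/-! ### Constants -/

theorem Gamma_eq_sub_one_mul {x : ℝ} (hx : 1 < x) :
    Real.Gamma x = (x - 1) * Real.Gamma (x - 1) := by
  simpa using Real.Gamma_add_one (sub_pos.2 hx).ne'

section constants

variable {n d j : ℕ} {m : ℝ}

theorem isPowerGen_iterate_cumGen_stGen (hm : 0 < m) (hj : (j : ℝ) < (m + n) / 2) :
    IsPowerGen (cumGen^[j] (stGen n m)) ((m / 2) ^ j / Real.Gamma ((m + n) / 2)) m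
      ((m + n) / 2 - j) := by
  induction j with
  | zero =>
    intro u _
    have hΓ : Real.Gamma ((m + n) / 2) ≠ 0 := (Real.Gamma_pos_of_pos (by positivity)).ne'
    rw [Function.iterate_zero, id, stGen, Nat.cast_zero, sub_zero, neg_div]
    field_simp
  | succ j ih =>
    push_cast at hj
    convert (ih (by linarith)).cumGen hm (by linarith) using 1
    · rw [Function.iterate_succ_apply']
    · rw [pow_succ]
      ring
    · push_cast
      ring

theorem isPowerGen_stGen (hm : 0 < m) :
    IsPowerGen (stGen n m) (Real.Gamma ((m + n) / 2))⁻¹ m ((m + n) / 2) := by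
  simpa using isPowerGen_iterate_cumGen_stGen (n := n) (j := 0) hm (by push_cast; positivity)

theorem isPowerGen_G1 (hm : 0 < m) (h : 2 < m + n) :
    IsPowerGen (G1 n m) (m / 2 / Real.Gamma ((m + n) / 2)) m ((m + n - 2) / 2) := by
  convert isPowerGen_iterate_cumGen_stGen (n := n) (j := 1) hm (by push_cast; linarith) using 1
  · rfl
  · rw [pow_one]
  · push_cast
    ring

theorem isPowerGen_G2 (hm : 0 < m) (h : 4 < m + n) :
    IsPowerGen (G2 n m) ((m / 2) ^ 2 / Real.Gamma ((m + n) / 2)) m ((m + n - 4) / 2) := by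
  convert isPowerGen_iterate_cumGen_stGen (n := n) (j := 2) hm (by push_cast; linarith) using 1
  · rfl
  · push_cast
    ring

theorem coeff_G1 (h : 2 < m + n) :
    m / 2 / Real.Gamma ((m + n) / 2) * Real.Gamma ((m + n - 2) / 2) = m / (m + n - 2) := by
  have hΓ : Real.Gamma ((m + n - 2) / 2) ≠ 0 := (Real.Gamma_pos_of_pos (by linarith)).ne'
  have h2 : m + n - 2 ≠ 0 := by linarith
  have hsub : (m + n) / 2 - 1 = (m + n - 2) / 2 := by ring
  rw [Gamma_eq_sub_one_mul (by linarith : 1 < (m + n) / 2), hsub]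
  field_simp

theorem coeff_G2 (h : 4 < m + n) :
    (m / 2) ^ 2 / Real.Gamma ((m + n) / 2) * Real.Gamma ((m + n - 4) / 2) =
      m / (m + n - 2) * (m / (m + n - 4)) := by
  have hΓ : Real.Gamma ((m + n - 4) / 2) ≠ 0 := (Real.Gamma_pos_of_pos (by linarith)).ne'
  have h4 : m + n - 4 ≠ 0 := by linarith
  have hsub : (m + n - 2) / 2 - 1 = (m + n - 4) / 2 := by ring
  rw [← coeff_G1 (by linarith), Gamma_eq_sub_one_mul (by linarith : 1 < (m + n - 2) / 2), hsub]
  field_simp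

theorem G1_eq (hm : 0 < m) (h : 2 < m + n) {t : ℝ} (ht : 0 ≤ t) :
    G1 n m t = m / (m + n - 2) * (1 + 2 * t / m) ^ (-(m + n - 2) / 2) := by
  rw [isPowerGen_G1 hm h t ht, coeff_G1 h, neg_div]

theorem G2_eq (hm : 0 < m) (h : 4 < m + n) {t : ℝ} (ht : 0 ≤ t) :
    G2 n m t = m / (m + n - 2) * (m / (m + n - 4)) *
      (1 + 2 * t / m) ^ (-(m + n - 4) / 2) := by
  rw [isPowerGen_G2 hm h t ht, coeff_G2 h, neg_div]

theorem c0_eq (hm : 0 < m) : c0 n m = Real.Gamma ((m + n) / 2) /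
    (Real.Gamma (m / 2) * (m * Real.pi) ^ ((n : ℝ) / 2)) := by
  have hsub : (m + n) / 2 - n / 2 = m / 2 := by ring
  rw [c0, (isPowerGen_stGen hm).normConst_eq hm (by linarith), hsub]
  field_simp

theorem c1_eq_integral (hm : 2 < m) (hn : n ≠ 0) :
    c1 n m = (m + n - 2) * Real.Gamma ((n : ℝ) / 2) / ((2 * Real.pi) ^ ((n : ℝ) / 2) * m) *
      (∫ t in Set.Ioi (0 : ℝ),
        t ^ ((n : ℝ) / 2 - 1) * (1 + 2 * t / m) ^ (-(m + n - 2) / 2))⁻¹ := by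
  have h2 : 2 < m + n := by linarith [n.cast_nonneg (α := ℝ)]
  have hne : m + n - 2 ≠ 0 := by linarith
  rw [c1, (isPowerGen_G1 (by linarith) h2).normConst_eq_integral hn, coeff_G1 h2, neg_div]
  congr 1
  field_simp

theorem c2_eq_integral (hm : 4 < m) (hn : n ≠ 0) :
    c2 n m = (m + n - 2) * (m + n - 4) * Real.Gamma ((n : ℝ) / 2) /
        ((2 * Real.pi) ^ ((n : ℝ) / 2) * m ^ 2) *
      (∫ t in Set.Ioi (0 : ℝ),
        t ^ ((n : ℝ) / 2 - 1) * (1 + 2 * t / m) ^ (-(m + n - 4) / 2))⁻¹ := by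
  have h4 : 4 < m + n := by linarith [n.cast_nonneg (α := ℝ)]
  have hne2 : m + n - 2 ≠ 0 := by linarith
  have hne4 : m + n - 4 ≠ 0 := by linarith
  rw [c2, (isPowerGen_G2 (by linarith) h4).normConst_eq_integral hn, coeff_G2 h4, neg_div]
  congr 1
  field_simp

theorem c1_eq_beta (hm : 2 < m) (hn : n ≠ 0) :
    c1 n m = (m + n - 2) * Real.Gamma ((n : ℝ) / 2) /
      ((m * Real.pi) ^ ((n : ℝ) / 2) * m * beta ((n : ℝ) / 2) ((m - 2) / 2)) := by
  have h2 : 2 < m + n := by linarith [n.cast_nonneg (α := ℝ)]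
  have hne : m + n - 2 ≠ 0 := by linarith
  have hsub : (m + n - 2) / 2 - n / 2 = (m - 2) / 2 := by ring
  rw [c1, (isPowerGen_G1 (by linarith) h2).normConst_eq_beta (by linarith) hn (by linarith),
    coeff_G1 h2, hsub]
  field_simp

theorem c2_eq_beta (hm : 4 < m) (hn : n ≠ 0) :
    c2 n m = (m + n - 2) * (m + n - 4) * Real.Gamma ((n : ℝ) / 2) /
      ((m * Real.pi) ^ ((n : ℝ) / 2) * m ^ 2 * beta ((n : ℝ) / 2) ((m - 4) / 2)) := by
  have h4 : 4 < m + n := by linarith [n.cast_nonneg (α := ℝ)]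
  have hne2 : m + n - 2 ≠ 0 := by linarith
  have hne4 : m + n - 4 ≠ 0 := by linarith
  have hsub : (m + n - 4) / 2 - n / 2 = (m - 4) / 2 := by ring
  rw [c2, (isPowerGen_G2 (by linarith) h4).normConst_eq_beta (by linarith) hn (by linarith),
    coeff_G2 h4, hsub]
  field_simp

theorem normConst_shiftGen_iterate_cumGen (hm : 0 < m) {a q : ℝ} (ha : 0 ≤ a) (hq : 0 < q)
    (hqd : q + d / 2 + j = (m + n) / 2) :
    normConst d (shiftGen (cumGen^[j] (stGen n m)) a) = Real.Gamma ((m + n) / 2) * 2 ^ j /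
      (Real.Gamma q * Real.pi ^ ((d : ℝ) / 2) * m ^ ((m + n) / 2)) * (m + 2 * a) ^ q := by
  have hd : (0 : ℝ) ≤ d / 2 := by positivity
  have hsub : (m + n) / 2 - j - d / 2 = q := by linarith
  rw [(isPowerGen_iterate_cumGen_stGen hm (by linarith)).normConst_shiftGen hm ha (by linarith),
    hsub, Real.rpow_sub_natCast hm.ne', div_pow]
  field_simp

theorem c0_div_normConst_shiftGen_iterate_cumGen (hm : 0 < m) {a q : ℝ} (ha : 0 ≤ a) (hq : 0 < q)
    (hqd : q + d / 2 + j = (m + n) / 2) :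
    c0 n m / normConst d (shiftGen (cumGen^[j] (stGen n m)) a) =
      Real.Gamma q * m ^ (m / 2) / (2 ^ j * Real.Gamma (m / 2)) *
        Real.pi ^ (-((n - d : ℝ) / 2)) * (m + 2 * a) ^ (-q) := by
  have hΓ : Real.Gamma ((m + n) / 2) ≠ 0 := (Real.Gamma_pos_of_pos (by positivity)).ne'
  have hma : 0 < m + 2 * a := by positivity
  rw [c0_eq hm, normConst_shiftGen_iterate_cumGen hm ha hq hqd, Real.mul_rpow hm.le Real.pi_pos.le,
    Real.rpow_neg hma.le, Real.rpow_neg Real.pi_pos.le, sub_div, Real.rpow_sub Real.pi_pos,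
    add_div, Real.rpow_add hm]
  field_simp

theorem shiftGen_zero (G : ℝ → ℝ) : shiftGen G 0 = G := by
  funext u
  rw [shiftGen, add_zero]

theorem c0_div_c1 (hm : 2 < m) : c0 n m / c1 n m = m / (m - 2) := by
  have hq : 0 < (m - 2) / 2 := by linarith
  have hm0 : 0 < m := by linarith
  have h := c0_div_normConst_shiftGen_iterate_cumGen (n := n) (d := n) (j := 1) hm0 le_rfl hq
    (by push_cast; ring)
  have hm_eq : m / 2 = (m - 2) / 2 + 1 := by ring
  have hΓ : Real.Gamma ((m - 2) / 2) ≠ 0 := (Real.Gamma_pos_of_pos hq).ne'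
  rw [shiftGen_zero, mul_zero, add_zero, sub_self, zero_div, neg_zero, Real.rpow_zero,
    hm_eq, Real.Gamma_add_one hq.ne', Real.rpow_add hm0, Real.rpow_neg hm0.le] at h
  refine h.trans ?_
  field_simp
  simp

theorem c0_div_c2 (hm : 4 < m) : c0 n m / c2 n m = m ^ 2 / ((m - 2) * (m - 4)) := by
  have hq : 0 < (m - 4) / 2 := by linarith
  have hm0 : 0 < m := by linarith
  have h2 : m - 2 ≠ 0 := by linarith
  have h := c0_div_normConst_shiftGen_iterate_cumGen (n := n) (d := n) (j := 2) hm0 le_rfl hq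
    (by push_cast; ring)
  have hm_eq : m / 2 = (m - 4) / 2 + 1 + 1 := by ring
  have hΓ : Real.Gamma ((m - 4) / 2) ≠ 0 := (Real.Gamma_pos_of_pos hq).ne'
  have hsucc : (m - 4) / 2 + 1 = (m - 2) / 2 := by ring
  rw [shiftGen_zero, mul_zero, add_zero, sub_self, zero_div, neg_zero, Real.rpow_zero,
    hm_eq, Real.Gamma_add_one (by linarith), Real.Gamma_add_one hq.ne', Real.rpow_add hm0,
    Real.rpow_add hm0, Real.rpow_neg hm0.le, hsucc] at h
  refine h.trans ?_
  field_simp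
  simp

end constants

/-! ### The densities of `W`, `V` and `U` -/

section marginals

variable {n : ℕ} {m : ℝ}

theorem card_drop1 (k : Fin n) : Fintype.card (Drop1 k) = n - 1 := by
  simp [Drop1]

theorem card_drop2 {i j : Fin n} (hij : i ≠ j) : Fintype.card (Drop2 i j) = n - 2 := by
  have hset : ({l | l ≠ i ∧ l ≠ j} : Finset (Fin n)) = {i, j}ᶜ := by
    ext l
    simp
  rw [Fintype.card_subtype, hset, Finset.card_compl, Finset.card_pair hij, Fintype.card_fin]

theorem cast_card_drop1 (k : Fin n) : (Fintype.card (Drop1 k) : ℝ) = n - 1 := by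
  rw [card_drop1, Nat.cast_sub (Nat.one_le_of_lt k.isLt), Nat.cast_one]

theorem two_le_of_fin_ne {i j : Fin n} (hij : i ≠ j) : 2 ≤ n := by
  have := Finset.card_le_univ {i, j}
  rwa [Finset.card_pair hij, Fintype.card_fin] at this

theorem cast_card_drop2 {i j : Fin n} (hij : i ≠ j) :
    (Fintype.card (Drop2 i j) : ℝ) = n - 2 := by
  rw [card_drop2 hij, Nat.cast_sub (two_le_of_fin_ne hij), Nat.cast_two]

theorem ellPDF_zero_one {ι : Type*} [Fintype ι] [DecidableEq ι] (G : ℝ → ℝ) (x : ι → ℝ) :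
    ellPDF 0 1 G x = normConst (Fintype.card ι) G * G (1 / 2 * (x ⬝ᵥ x)) := by
  rw [ellPDF, sub_zero, inv_one, one_mulVec, det_one, Real.sqrt_one, div_one]

theorem fW_eq_ellPDF (lam : Fin n → ℝ) (k : Fin n) :
    fW m lam k = ellPDF 0 1 (shiftGen (G1 n m) (lam k ^ 2 / 2)) := by
  funext w
  rw [ellPDF_zero_one, card_drop1, shiftGen, fW, cW, one_div_mul_eq_div 2 (lam k ^ 2)]

theorem fV_eq_ellPDF (lam : Fin n → ℝ) (k : Fin n) :
    fV m lam k = ellPDF 0 1 (shiftGen (G2 n m) (lam k ^ 2 / 2)) := by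
  funext v
  rw [ellPDF_zero_one, card_drop1, shiftGen, fV, cV, one_div_mul_eq_div 2 (lam k ^ 2)]

theorem fU_eq_ellPDF (lam : Fin n → ℝ) {i j : Fin n} (hij : i ≠ j) :
    fU m lam i j = ellPDF 0 1 (shiftGen (G2 n m) (lam i ^ 2 / 2 + lam j ^ 2 / 2)) := by
  funext u
  rw [ellPDF_zero_one, card_drop2 hij, shiftGen, fU, cU, one_div_mul_eq_div 2 (lam i ^ 2),
    one_div_mul_eq_div 2 (lam j ^ 2), add_assoc]

theorem fW_eq (hm : 1 < m) (lam : Fin n → ℝ) (k : Fin n) (w : Drop1 k → ℝ) :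
    fW m lam k w = cW n m (lam k) * (m / (m + n - 2)) *
      (1 + lam k ^ 2 / m) ^ (-(m + n - 2) / 2) *
      (1 + w ⬝ᵥ ((scaleW m lam k)⁻¹ *ᵥ w) / (m - 1)) ^ (-(m + n - 2) / 2) := by
  have hn : (1 : ℝ) ≤ n := by exact_mod_cast Nat.one_le_of_lt k.isLt
  have h2 : 2 < m + n := by linarith
  rw [fW_eq_ellPDF, ellPDF_zero_one, card_drop1, ← cW, (isPowerGen_G1 (by linarith)
    h2).shiftGen_half_dotProduct (by linarith) (by positivity) (by linarith : m - 1 ≠ 0),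
    coeff_G1 h2, mul_div_cancel₀ _ two_ne_zero, ← scaleW, neg_div]
  ring

theorem fV_eq (hm : 3 < m) (lam : Fin n → ℝ) (k : Fin n) (v : Drop1 k → ℝ) :
    fV m lam k v = cV n m (lam k) * (m / (m + n - 2)) * (m / (m + n - 4)) *
      (1 + lam k ^ 2 / m) ^ (-(m + n - 4) / 2) *
      (1 + v ⬝ᵥ ((scaleV m lam k)⁻¹ *ᵥ v) / (m - 3)) ^ (-(m + n - 4) / 2) := by
  have hn : (1 : ℝ) ≤ n := by exact_mod_cast Nat.one_le_of_lt k.isLt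
  have h4 : 4 < m + n := by linarith
  rw [fV_eq_ellPDF, ellPDF_zero_one, card_drop1, ← cV, (isPowerGen_G2 (by linarith)
    h4).shiftGen_half_dotProduct (by linarith) (by positivity) (by linarith : m - 3 ≠ 0),
    coeff_G2 h4, mul_div_cancel₀ _ two_ne_zero, ← scaleV, neg_div]
  ring

theorem fU_eq (hm : 2 < m) (lam : Fin n → ℝ) {i j : Fin n} (hij : i ≠ j) (u : Drop2 i j → ℝ) :
    fU m lam i j u = cU n m (lam i) (lam j) * (m / (m + n - 2)) * (m / (m + n - 4)) *
      (1 + (lam i ^ 2 + lam j ^ 2) / m) ^ (-(m + n - 4) / 2) *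
      (1 + u ⬝ᵥ ((scaleU m lam i j)⁻¹ *ᵥ u) / (m - 2)) ^ (-(m + n - 4) / 2) := by
  have hn : (2 : ℝ) ≤ n := by exact_mod_cast two_le_of_fin_ne hij
  have h4 : 4 < m + n := by linarith
  have hsum : 2 * (lam i ^ 2 / 2 + lam j ^ 2 / 2) = lam i ^ 2 + lam j ^ 2 := by ring
  rw [fU_eq_ellPDF lam hij, ellPDF_zero_one, card_drop2 hij, ← cU, (isPowerGen_G2 (by linarith)
    h4).shiftGen_half_dotProduct (by linarith) (by positivity) (by linarith : m - 2 ≠ 0),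
    coeff_G2 h4, hsum, ← add_assoc m, ← scaleU, neg_div]
  ring

theorem fW_eq_stW (hm : 1 < m) (lam : Fin n → ℝ) (k : Fin n) : fW m lam k = stW m lam k := by
  have hn : (1 : ℝ) ≤ n := by exact_mod_cast Nat.one_le_of_lt k.isLt
  have hm0 : 0 < m := by linarith
  have ha : 0 ≤ lam k ^ 2 / 2 := by positivity
  have := Real.Gamma_pos_of_pos (by positivity : 0 < (m + n) / 2)
  rw [fW_eq_ellPDF, ((isPowerGen_G1 hm0 (by linarith)).shiftGen hm0 ha).ellPDF_eq_stPDF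
    (by positivity) (by positivity) (by linarith : 0 < m - 1)
    (by rw [cast_card_drop1]; ring) 0 Matrix.PosDef.one, mul_div_cancel₀ _ two_ne_zero]
  rfl

theorem fV_eq_stV (hm : 3 < m) (lam : Fin n → ℝ) (k : Fin n) : fV m lam k = stV m lam k := by
  have hn : (1 : ℝ) ≤ n := by exact_mod_cast Nat.one_le_of_lt k.isLt
  have hm0 : 0 < m := by linarith
  have ha : 0 ≤ lam k ^ 2 / 2 := by positivity
  have := Real.Gamma_pos_of_pos (by positivity : 0 < (m + n) / 2)
  rw [fV_eq_ellPDF, ((isPowerGen_G2 hm0 (by linarith)).shiftGen hm0 ha).ellPDF_eq_stPDF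
    (by positivity) (by positivity) (by linarith : 0 < m - 3)
    (by rw [cast_card_drop1]; ring) 0 Matrix.PosDef.one, mul_div_cancel₀ _ two_ne_zero]
  rfl

theorem fU_eq_stU (hm : 2 < m) (lam : Fin n → ℝ) {i j : Fin n} (hij : i ≠ j) :
    fU m lam i j = stU m lam i j := by
  have hn : (2 : ℝ) ≤ n := by exact_mod_cast two_le_of_fin_ne hij
  have hm0 : 0 < m := by linarith
  have ha : 0 ≤ lam i ^ 2 / 2 + lam j ^ 2 / 2 := by positivity
  have hsum : m + 2 * (lam i ^ 2 / 2 + lam j ^ 2 / 2) = m + lam i ^ 2 + lam j ^ 2 := by ring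
  have := Real.Gamma_pos_of_pos (by positivity : 0 < (m + n) / 2)
  rw [fU_eq_ellPDF lam hij, ((isPowerGen_G2 hm0 (by linarith)).shiftGen hm0 ha).ellPDF_eq_stPDF
    (by positivity) (by positivity) (by linarith : 0 < m - 2)
    (by rw [cast_card_drop2 hij]; ring) 0 Matrix.PosDef.one, hsum]
  rfl

theorem cW_eq (hn : 1 ≤ n) (hm : 1 < m) (a : ℝ) :
    cW n m a = Real.Gamma ((m + n - 2) / 2) * (m + n - 2) /
      (Real.Gamma ((m - 1) / 2) * Real.pi ^ (((n : ℝ) - 1) / 2) * m ^ ((m + n) / 2)) *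
      (m + a ^ 2) ^ ((m - 1) / 2) := by
  have hn' : (1 : ℝ) ≤ n := by exact_mod_cast hn
  have h := normConst_shiftGen_iterate_cumGen (n := n) (d := n - 1) (j := 1) (a := a ^ 2 / 2)
    (q := (m - 1) / 2) (by linarith) (by positivity) (by linarith) (by push_cast [hn]; ring)
  have hsub : (m + n) / 2 - 1 = (m + n - 2) / 2 := by ring
  push_cast [hn] at h
  rw [Gamma_eq_sub_one_mul (by linarith : 1 < (m + n) / 2), hsub, mul_div_cancel₀ _ two_ne_zero,
    pow_one] at h
  refine h.trans ?_
  ring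

theorem cV_eq (hn : 1 ≤ n) (hm : 3 < m) (a : ℝ) :
    cV n m a = Real.Gamma ((m + n - 4) / 2) * (m + n - 2) * (m + n - 4) /
      (Real.Gamma ((m - 3) / 2) * Real.pi ^ (((n : ℝ) - 1) / 2) * m ^ ((m + n) / 2)) *
      (m + a ^ 2) ^ ((m - 3) / 2) := by
  have hn' : (1 : ℝ) ≤ n := by exact_mod_cast hn
  have h := normConst_shiftGen_iterate_cumGen (n := n) (d := n - 1) (j := 2) (a := a ^ 2 / 2)
    (q := (m - 3) / 2) (by linarith) (by positivity) (by linarith) (by push_cast [hn]; ring)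
  have hsub : (m + n) / 2 - 1 = (m + n - 2) / 2 := by ring
  have hsub' : (m + n - 2) / 2 - 1 = (m + n - 4) / 2 := by ring
  push_cast [hn] at h
  rw [Gamma_eq_sub_one_mul (by linarith : 1 < (m + n) / 2), hsub,
    Gamma_eq_sub_one_mul (by linarith : 1 < (m + n - 2) / 2), hsub',
    mul_div_cancel₀ _ two_ne_zero] at h
  refine h.trans ?_
  ring

theorem cU_eq (hn : 2 ≤ n) (hm : 2 < m) (a b : ℝ) :
    cU n m a b = Real.Gamma ((m + n - 4) / 2) * (m + n - 2) * (m + n - 4) /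
      (Real.Gamma ((m - 2) / 2) * Real.pi ^ (((n : ℝ) - 2) / 2) * m ^ ((m + n) / 2)) *
      (m + a ^ 2 + b ^ 2) ^ ((m - 2) / 2) := by
  have hn' : (2 : ℝ) ≤ n := by exact_mod_cast hn
  have h := normConst_shiftGen_iterate_cumGen (n := n) (d := n - 2) (j := 2)
    (a := a ^ 2 / 2 + b ^ 2 / 2) (q := (m - 2) / 2) (by linarith) (by positivity) (by linarith)
    (by push_cast [hn]; ring)
  have hsub : (m + n) / 2 - 1 = (m + n - 2) / 2 := by ring
  have hsub' : (m + n - 2) / 2 - 1 = (m + n - 4) / 2 := by ring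
  have hsum : m + 2 * (a ^ 2 / 2 + b ^ 2 / 2) = m + a ^ 2 + b ^ 2 := by ring
  push_cast [hn] at h
  rw [Gamma_eq_sub_one_mul (by linarith : 1 < (m + n) / 2), hsub,
    Gamma_eq_sub_one_mul (by linarith : 1 < (m + n - 2) / 2), hsub', hsum] at h
  refine h.trans ?_
  ring

theorem c0_div_cW (hn : 1 ≤ n) (hm : 1 < m) (a : ℝ) :
    c0 n m / cW n m a = Real.Gamma ((m - 1) / 2) * m ^ (m / 2) /
      (2 * Real.Gamma (m / 2) * √Real.pi) * (m + a ^ 2) ^ (-(m - 1) / 2) := by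
  have h := c0_div_normConst_shiftGen_iterate_cumGen (n := n) (d := n - 1) (j := 1)
    (a := a ^ 2 / 2) (q := (m - 1) / 2) (by linarith) (by positivity) (by linarith)
    (by push_cast [hn]; ring)
  push_cast [hn] at h
  rw [sub_sub_cancel, Real.rpow_neg Real.pi_pos.le, ← Real.sqrt_eq_rpow,
    mul_div_cancel₀ _ two_ne_zero, ← neg_div, pow_one] at h
  refine h.trans ?_
  field_simp

theorem c0_div_cV (hn : 1 ≤ n) (hm : 3 < m) (a : ℝ) :
    c0 n m / cV n m a = Real.Gamma ((m - 3) / 2) * m ^ (m / 2) /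
      (4 * Real.Gamma (m / 2) * √Real.pi) * (m + a ^ 2) ^ (-(m - 3) / 2) := by
  have h := c0_div_normConst_shiftGen_iterate_cumGen (n := n) (d := n - 1) (j := 2)
    (a := a ^ 2 / 2) (q := (m - 3) / 2) (by linarith) (by positivity) (by linarith)
    (by push_cast [hn]; ring)
  push_cast [hn] at h
  rw [sub_sub_cancel, Real.rpow_neg Real.pi_pos.le, ← Real.sqrt_eq_rpow,
    mul_div_cancel₀ _ two_ne_zero, ← neg_div] at h
  refine h.trans ?_
  ring

theorem c0_div_cU (hn : 2 ≤ n) (hm : 2 < m) (a b : ℝ) :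
    c0 n m / cU n m a b = m ^ (m / 2) / (2 * (m - 2) * Real.pi) *
      (m + a ^ 2 + b ^ 2) ^ (-(m - 2) / 2) := by
  have hq : 0 < (m - 2) / 2 := by linarith
  have h := c0_div_normConst_shiftGen_iterate_cumGen (n := n) (d := n - 2) (j := 2)
    (a := a ^ 2 / 2 + b ^ 2 / 2) (q := (m - 2) / 2) (by linarith) (by positivity) hq
    (by push_cast [hn]; ring)
  have hΓ : Real.Gamma ((m - 2) / 2) ≠ 0 := (Real.Gamma_pos_of_pos hq).ne'
  have hsub : m / 2 - 1 = (m - 2) / 2 := by ring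
  have hsum : m + 2 * (a ^ 2 / 2 + b ^ 2 / 2) = m + a ^ 2 + b ^ 2 := by ring
  push_cast [hn] at h
  rw [sub_sub_cancel, div_self two_ne_zero, Real.rpow_neg_one,
    Gamma_eq_sub_one_mul (by linarith : 1 < m / 2), hsub, hsum, ← neg_div] at h
  refine h.trans ?_
  field_simp

end marginals

/-! ### Integrability of powers of `b + |z|² / m` -/

section tPow

variable {ι : Type*} [Fintype ι]

theorem dotProduct_self_nonneg (z : ι → ℝ) : 0 ≤ z ⬝ᵥ z :=
  dotProduct_self_star_nonneg z

theorem sq_le_dotProduct_self (z : ι → ℝ) (i : ι) : z i ^ 2 ≤ z ⬝ᵥ z := by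
  rw [sq]
  exact Finset.single_le_sum (f := fun i => z i * z i) (fun i _ => mul_self_nonneg (z i))
    (Finset.mem_univ i)

theorem norm_sq_le_dotProduct_self (z : ι → ℝ) : ‖z‖ ^ 2 ≤ z ⬝ᵥ z := by
  have h : ‖z‖ ≤ √(z ⬝ᵥ z) := (pi_norm_le_iff_of_nonneg (Real.sqrt_nonneg _)).2 fun i =>
    Real.abs_le_sqrt (sq_le_dotProduct_self z i)
  calc ‖z‖ ^ 2 ≤ √(z ⬝ᵥ z) ^ 2 := by gcongr
    _ = z ⬝ᵥ z := Real.sq_sqrt (dotProduct_self_nonneg z)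

theorem continuous_const_dotProduct (γ : ι → ℝ) : Continuous fun z : ι → ℝ => γ ⬝ᵥ z := by
  unfold dotProduct
  fun_prop

/-- The function `z ↦ (b + |z|² / m)^{-p}`. The parameter `b` absorbs the square of a coordinate
that has been fixed, so that restrictions to coordinate hyperplanes are of the same form. -/
def tPow (m b p : ℝ) (z : ι → ℝ) : ℝ := (b + z ⬝ᵥ z / m) ^ (-p)

variable {m b : ℝ}

theorem tPow_base_pos (hm : 0 < m) (hb : 0 < b) (z : ι → ℝ) : 0 < b + z ⬝ᵥ z / m := by
  have := dotProduct_self_nonneg z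
  positivity

theorem tPow_pos (hm : 0 < m) (hb : 0 < b) (p : ℝ) (z : ι → ℝ) : 0 < tPow m b p z :=
  Real.rpow_pos_of_pos (tPow_base_pos hm hb z) _

theorem continuous_tPow (hm : 0 < m) (hb : 0 < b) (p : ℝ) :
    Continuous (tPow m b p : (ι → ℝ) → ℝ) := by
  refine Continuous.rpow_const ?_ fun z => Or.inl (tPow_base_pos hm hb z).ne'
  unfold dotProduct
  fun_prop

theorem integrable_tPow (hm : 0 < m) (hb : 0 < b) {p : ℝ} (hp : (Fintype.card ι : ℝ) < 2 * p) :
    Integrable (tPow m b p : (ι → ℝ) → ℝ) := by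
  have hp0 : 0 < p := by linarith [(Fintype.card ι).cast_nonneg (α := ℝ)]
  have hexp : -(2 * p) / 2 = -p := by ring
  have hc : 0 < min b m⁻¹ := lt_min hb (inv_pos.2 hm)
  have hint := integrable_rpow_neg_one_add_norm_sq (E := ι → ℝ) (μ := volume) (r := 2 * p)
    (by simpa using hp)
  refine (hint.const_mul ((min b m⁻¹) ^ (-p))).mono'
    (continuous_tPow hm hb p).aestronglyMeasurable (Filter.Eventually.of_forall fun z => ?_)
  rw [Real.norm_of_nonneg (tPow_pos hm hb p z).le, tPow, hexp,
    ← Real.mul_rpow hc.le (by positivity)]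
  refine Real.rpow_le_rpow_of_nonpos (by positivity) ?_ (by linarith)
  calc min b m⁻¹ * (1 + ‖z‖ ^ 2) = min b m⁻¹ + min b m⁻¹ * ‖z‖ ^ 2 := by ring
    _ ≤ b + m⁻¹ * (z ⬝ᵥ z) := by
      gcongr
      · exact min_le_left _ _
      · exact min_le_right _ _
      · exact norm_sq_le_dotProduct_self z
    _ = b + z ⬝ᵥ z / m := by ring

theorem abs_coord_mul_tPow_le (hm : 0 < m) (hb : 0 < b) (p : ℝ) (i : ι) (z : ι → ℝ) :
    |z i| * tPow m b p z ≤ √m * tPow m b (p - 1 / 2) z := by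
  have hcoord : |z i| ≤ √m * (b + z ⬝ᵥ z / m) ^ (1 / 2 : ℝ) := by
    rw [← Real.sqrt_eq_rpow, ← Real.sqrt_mul hm.le, mul_add, mul_div_cancel₀ _ hm.ne']
    refine Real.abs_le_sqrt ((sq_le_dotProduct_self z i).trans ?_)
    linarith [mul_pos hm hb]
  have hsplit : tPow m b (p - 1 / 2) z = (b + z ⬝ᵥ z / m) ^ (1 / 2 : ℝ) * tPow m b p z := by
    rw [tPow, tPow, ← Real.rpow_add (tPow_base_pos hm hb z)]
    congr 1
    ring
  rw [hsplit, ← mul_assoc]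
  exact mul_le_mul_of_nonneg_right hcoord (tPow_pos hm hb p z).le

theorem integrable_coord_mul_tPow (hm : 0 < m) (hb : 0 < b) {p : ℝ}
    (hp : (Fintype.card ι : ℝ) + 1 < 2 * p) (i : ι) :
    Integrable (fun z : ι → ℝ => z i * tPow m b p z) := by
  refine ((integrable_tPow hm hb (p := p - 1 / 2) (by linarith)).const_mul √m).mono'
    ((continuous_apply i).mul (continuous_tPow hm hb p)).aestronglyMeasurable
    (Filter.Eventually.of_forall fun z => ?_)
  rw [norm_mul, Real.norm_eq_abs, Real.norm_of_nonneg (tPow_pos hm hb p z).le]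
  exact abs_coord_mul_tPow_le hm hb p i z

theorem integrable_coord_mul_coord_mul_tPow (hm : 0 < m) (hb : 0 < b) {p : ℝ}
    (hp : (Fintype.card ι : ℝ) + 2 < 2 * p) (i j : ι) :
    Integrable (fun z : ι → ℝ => z i * z j * tPow m b p z) := by
  refine ((integrable_tPow hm hb (p := p - 1 / 2 - 1 / 2) (by linarith)).const_mul
    (√m * √m)).mono' (((continuous_apply i).mul (continuous_apply j)).mul
      (continuous_tPow hm hb p)).aestronglyMeasurable (Filter.Eventually.of_forall fun z => ?_)
  rw [norm_mul, norm_mul, Real.norm_eq_abs, Real.norm_eq_abs,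
    Real.norm_of_nonneg (tPow_pos hm hb p z).le]
  calc |z i| * |z j| * tPow m b p z = |z i| * (|z j| * tPow m b p z) := mul_assoc _ _ _
    _ ≤ |z i| * (√m * tPow m b (p - 1 / 2) z) :=
      mul_le_mul_of_nonneg_left (abs_coord_mul_tPow_le hm hb p j z) (abs_nonneg _)
    _ = √m * (|z i| * tPow m b (p - 1 / 2) z) := by ring
    _ ≤ √m * (√m * tPow m b (p - 1 / 2 - 1 / 2) z) :=
      mul_le_mul_of_nonneg_left (abs_coord_mul_tPow_le hm hb _ i z) (Real.sqrt_nonneg _)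
    _ = √m * √m * tPow m b (p - 1 / 2 - 1 / 2) z := by ring

end tPow

/-! ### Affine images and conditional moments of random vectors -/

section msqrt

variable {ι : Type*} [Fintype ι] [DecidableEq ι] {Sig : Matrix ι ι ℝ}

open scoped MatrixOrder in
theorem msqrt_mul_msqrt (hSig : Sig.PosDef) : msqrt Sig * msqrt Sig = Sig :=
  CFC.sqrt_mul_sqrt_self Sig hSig.posSemidef.nonneg

open scoped MatrixOrder in
theorem msqrt_transpose (Sig : Matrix ι ι ℝ) : (msqrt Sig)ᵀ = msqrt Sig := by
  have h := (CFC.sqrt_nonneg Sig).posSemidef.isHermitian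
  rwa [IsHermitian, conjTranspose_eq_transpose_of_trivial] at h

open scoped MatrixOrder in
theorem det_msqrt (hSig : Sig.PosDef) : (msqrt Sig).det = √Sig.det := by
  rw [msqrt, hSig.posSemidef.det_sqrt, RCLike.sqrt_of_nonneg hSig.posSemidef.det_nonneg,
    RCLike.re_to_real, RCLike.ofReal_real_eq_id, id]

theorem det_msqrt_pos (hSig : Sig.PosDef) : 0 < (msqrt Sig).det := by
  rw [det_msqrt hSig]
  exact Real.sqrt_pos.2 hSig.det_pos

open scoped MatrixOrder in
theorem msqrt_one : msqrt (1 : Matrix ι ι ℝ) = 1 := CFC.sqrt_one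

open scoped MatrixOrder in
theorem msqrt_of_isDiag (hSig : Sig.PosDef) (hdiag : Sig.IsDiag) :
    msqrt Sig = diagonal fun i => √(Sig i i) := by
  rw [msqrt, CFC.sqrt_eq_iff _ _ hSig.posSemidef.nonneg
    (PosSemidef.diagonal fun i => Real.sqrt_nonneg _).nonneg, diagonal_mul_diagonal]
  conv_rhs => rw [← hdiag.diagonal_diag]
  congr 1
  funext i
  exact Real.mul_self_sqrt hSig.diag_pos.le

theorem dotProduct_inv_mulVec_eq_standardize (hSig : Sig.PosDef) (μ y : ι → ℝ) :
    (y - μ) ⬝ᵥ (Sig⁻¹ *ᵥ (y - μ)) = standardize μ Sig y ⬝ᵥ standardize μ Sig y := by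
  have hinv : Sig⁻¹ = (msqrt Sig)⁻¹ * (msqrt Sig)⁻¹ := by
    rw [← Matrix.mul_inv_rev, msqrt_mul_msqrt hSig]
  rw [standardize, hinv, ← mulVec_mulVec, dotProduct_mulVec, ← mulVec_transpose,
    transpose_nonsing_inv, msqrt_transpose]

theorem add_msqrt_mulVec_standardize (hSig : Sig.PosDef) (μ y : ι → ℝ) :
    μ + msqrt Sig *ᵥ standardize μ Sig y = y := by
  rw [standardize, mulVec_mulVec, Matrix.mul_nonsing_inv _ (det_msqrt_pos hSig).ne'.isUnit,
    one_mulVec, add_sub_cancel]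

theorem standardize_lt_standardize_iff (hSig : Sig.PosDef) (hdiag : Sig.IsDiag) (μ x y : ι → ℝ)
    (i : ι) : standardize μ Sig x i < standardize μ Sig y i ↔ x i < y i := by
  have hcoord (x : ι → ℝ) : μ i + √(Sig i i) * standardize μ Sig x i = x i := by
    simpa [msqrt_of_isDiag hSig hdiag, mulVec_diagonal] using
      congrFun (add_msqrt_mulVec_standardize hSig μ x) i
  rw [← hcoord x, ← hcoord y, add_lt_add_iff_left,
    mul_lt_mul_iff_right₀ (Real.sqrt_pos.2 hSig.diag_pos)]

end msqrt

theorem measurableSet_orthant {ι : Type*} [Countable ι] (t : ι → ℝ) :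
    MeasurableSet (orthant t) := by
  have hpi : orthant t = Set.univ.pi fun i => Set.Ioi (t i) := by
    ext z
    simp [orthant]
  rw [hpi]
  exact MeasurableSet.univ_pi fun i => measurableSet_Ioi

section HasDensity

variable {S ι : Type*} [MeasurableSpace S] [Fintype ι] {P : Measure S} {Z : S → ι → ℝ}
  {f : (ι → ℝ) → ℝ}

theorem measurable_mulVec_sub (A : Matrix ι ι ℝ) (μ : ι → ℝ) :
    Measurable fun y : ι → ℝ => A *ᵥ (y - μ) :=
  (Continuous.matrix_mulVec continuous_const (continuous_id.sub continuous_const)).measurable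

theorem map_mulVec_sub_volume [DecidableEq ι] {A : Matrix ι ι ℝ} (hA : A.det ≠ 0) (μ : ι → ℝ) :
    (volume : Measure (ι → ℝ)).map (fun y => A *ᵥ (y - μ)) =
      ENNReal.ofReal |A.det⁻¹| • volume := by
  have hcomp : (fun y : ι → ℝ => A *ᵥ (y - μ)) = toLin' A ∘ fun y => y - μ := by
    funext y
    rw [Function.comp_apply, toLin'_apply]
  rw [hcomp, ← Measure.map_map (toLin' A).continuous_of_finiteDimensional.measurable
    (measurable_sub_const μ), (measurePreserving_sub_right volume μ).map_eq]
  exact Real.map_matrix_volume_pi_eq_smul_volume_pi hA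

theorem HasDensity.mulVec_sub [DecidableEq ι] {Y : S → ι → ℝ} {g : (ι → ℝ) → ℝ}
    (hY : HasDensity P Y f) {A : Matrix ι ι ℝ} (hA : A.det ≠ 0) (μ : ι → ℝ) (hg : Measurable g)
    (hfg : ∀ y, f y = |A.det| * g (A *ᵥ (y - μ))) :
    HasDensity P (fun s => A *ᵥ (Y s - μ)) g := by
  have hφ := measurable_mulVec_sub A μ
  have hgφ : Measurable fun y => g (A *ᵥ (y - μ)) := hg.comp hφ
  have hdet : 0 < |A.det| := abs_pos.2 hA
  refine ⟨hφ.comp hY.1, ?_⟩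
  have hcomp : (fun s => A *ᵥ (Y s - μ)) = (fun y => A *ᵥ (y - μ)) ∘ Y := rfl
  rw [hcomp, ← Measure.map_map hφ hY.1, hY.2]
  ext s hs
  rw [Measure.map_apply hφ hs, withDensity_apply _ (hφ hs), withDensity_apply _ hs]
  simp_rw [hfg, ENNReal.ofReal_mul hdet.le]
  rw [lintegral_const_mul _ hgφ.ennreal_ofReal,
    ← setLIntegral_map (g := fun y => A *ᵥ (y - μ)) (f := fun z => ENNReal.ofReal (g z)) hs
      hg.ennreal_ofReal hφ, map_mulVec_sub_volume hA, Measure.restrict_smul,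
    lintegral_smul_measure, smul_eq_mul, ← mul_assoc, ← ENNReal.ofReal_mul hdet.le, ← abs_mul,
    mul_inv_cancel₀ hA, abs_one, ENNReal.ofReal_one, one_mul]

theorem HasDensity.integrable_comp_iff (h : HasDensity P Z f) (hf : Measurable f)
    (hf0 : ∀ z, 0 ≤ f z) {φ : (ι → ℝ) → ℝ} (hφ : Measurable φ) :
    Integrable (fun s => φ (Z s)) P ↔ Integrable fun z => φ z * f z := by
  have hcomp := integrable_map_measure (μ := P) (f := Z) hφ.aestronglyMeasurable h.1.aemeasurable
  rw [Function.comp_def] at hcomp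
  rw [← hcomp, h.2, integrable_withDensity_iff hf.ennreal_ofReal
    (Filter.Eventually.of_forall fun _ => ENNReal.ofReal_lt_top)]
  simp_rw [ENNReal.toReal_ofReal (hf0 _)]

theorem HasDensity.setIntegral_comp (h : HasDensity P Z f) (hf : Measurable f)
    (hf0 : ∀ z, 0 ≤ f z) {φ : (ι → ℝ) → ℝ} (hφ : Measurable φ) {A : Set (ι → ℝ)}
    (hA : MeasurableSet A) : ∫ s in Z ⁻¹' A, φ (Z s) ∂P = ∫ z in A, φ z * f z := by
  rw [← setIntegral_map (f := φ) hA hφ.aestronglyMeasurable h.1.aemeasurable, h.2,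
    setIntegral_withDensity_eq_setIntegral_toReal_smul hf.ennreal_ofReal
      (Filter.Eventually.of_forall fun _ => ENNReal.ofReal_lt_top) _ hA]
  simp_rw [ENNReal.toReal_ofReal (hf0 _), smul_eq_mul, mul_comm]

theorem HasDensity.real_preimage_orthant (h : HasDensity P Z f) (hf : Measurable f)
    (hf0 : ∀ z, 0 ≤ f z) (t : ι → ℝ) : P.real {s | ∀ i, t i < Z s i} = tailFn f t := by
  have := h.setIntegral_comp hf hf0 (φ := fun _ => 1) measurable_const (measurableSet_orthant t)
  simpa [tailFn, orthant, Set.preimage] using this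

theorem HasDensity.measure_tail_ne_zero (h : HasDensity P Z f) (hf : Measurable f)
    (hf0 : ∀ z, 0 ≤ f z) {t : ι → ℝ} (ht : 0 < tailFn f t) : P {s | ∀ i, t i < Z s i} ≠ 0 := by
  intro hzero
  rw [← h.real_preimage_orthant hf hf0, Measure.real, hzero] at ht
  exact lt_irrefl _ ht

theorem HasDensity.integral_cond (h : HasDensity P Z f) (hf : Measurable f)
    (hf0 : ∀ z, 0 ≤ f z) (t : ι → ℝ) {φ : (ι → ℝ) → ℝ} (hφ : Measurable φ) :
    ∫ s, φ (Z s) ∂(P[|{s | ∀ i, t i < Z s i}]) = 1 / tailFn f t * ∫ z in orthant t, φ z * f z := by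
  rw [ProbabilityTheory.cond, integral_smul_measure, ENNReal.toReal_inv, smul_eq_mul,
    ← h.real_preimage_orthant hf hf0 t, one_div, Measure.real]
  congr 1
  exact h.setIntegral_comp hf hf0 hφ (measurableSet_orthant t)

end HasDensity

section conditional

variable {S ι : Type*} [MeasurableSpace S] {P : Measure S} {A : Set S} {Y Z : S → ι → ℝ}

theorem memLp_cond {X : S → ℝ} {p : ENNReal} (hX : MemLp X p P) (A : Set S) :
    MemLp X p (P[|A]) := by
  by_cases hA : P A = 0
  · rw [cond_eq_zero_of_meas_eq_zero hA]
    exact memLp_measure_zero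
  · exact (hX.restrict A).smul_measure (ENNReal.inv_ne_top.2 hA)

theorem condCov_apply_eq_covariance (i j : ι) :
    condCov P Z A i j = cov[fun s => Z s i, fun s => Z s j; P[|A]] := rfl

theorem condCov_apply_eq_sub [IsFiniteMeasure P] (hA : P A ≠ 0)
    (hZ : ∀ i, MemLp (fun s => Z s i) 2 P) (i j : ι) :
    condCov P Z A i j = ∫ s, Z s i * Z s j ∂(P[|A]) - condMean P Z A i * condMean P Z A j := by
  have := cond_isProbabilityMeasure hA
  rw [condCov_apply_eq_covariance,
    covariance_eq_sub (memLp_cond (hZ i) A) (memLp_cond (hZ j) A)]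
  rfl

variable [Fintype ι]

theorem memLp_add_mulVec [IsFiniteMeasure P] {p : ENNReal} {μ : ι → ℝ} {M : Matrix ι ι ℝ}
    (hYZ : ∀ s, Y s = μ + M *ᵥ Z s) (hZ : ∀ i, MemLp (fun s => Z s i) p P) (i : ι) :
    MemLp (fun s => Y s i) p P := by
  simp only [hYZ, Pi.add_apply, mulVec, dotProduct]
  exact (memLp_const (μ i)).add (memLp_finsetSum _ fun j _ => (hZ j).const_mul (M i j))

theorem condMean_add_mulVec [IsFiniteMeasure P] (hA : P A ≠ 0) {μ : ι → ℝ} {M : Matrix ι ι ℝ}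
    (hYZ : ∀ s, Y s = μ + M *ᵥ Z s) (hZ : ∀ i, Integrable (fun s => Z s i) P) :
    condMean P Y A = μ + M *ᵥ condMean P Z A := by
  have := cond_isProbabilityMeasure hA
  have hint (i : ι) : Integrable (fun s => Z s i) (P[|A]) :=
    memLp_one_iff_integrable.1 (memLp_cond (memLp_one_iff_integrable.2 (hZ i)) A)
  funext i
  simp only [condMean, hYZ, Pi.add_apply, mulVec, dotProduct]
  rw [integral_add (integrable_const _) (integrable_finsetSum _ fun j _ => (hint j).const_mul _),
    integral_finsetSum _ fun j _ => (hint j).const_mul _, integral_const, probReal_univ, one_smul]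
  simp_rw [integral_const_mul]

theorem condCov_add_mulVec [IsFiniteMeasure P] (hA : P A ≠ 0) {μ : ι → ℝ} {M : Matrix ι ι ℝ}
    (hYZ : ∀ s, Y s = μ + M *ᵥ Z s) (hZ : ∀ i, MemLp (fun s => Z s i) 2 P) :
    condCov P Y A = M * condCov P Z A * Mᵀ := by
  have := cond_isProbabilityMeasure hA
  have hmem (i : ι) : MemLp (fun s => Z s i) 2 (P[|A]) := memLp_cond (hZ i) A
  have hsum (i : ι) : Integrable (fun s => ∑ k, M i k * Z s k) (P[|A]) :=
    integrable_finsetSum _ fun j _ => ((hmem j).integrable one_le_two).const_mul _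
  ext i j
  rw [condCov_apply_eq_covariance]
  simp only [hYZ, Pi.add_apply, mulVec, dotProduct]
  rw [covariance_const_add_left (hsum i), covariance_const_add_right (hsum j),
    covariance_fun_sum_fun_sum (fun k => (hmem k).const_mul _) (fun k => (hmem k).const_mul _)]
  simp_rw [covariance_const_mul_left, covariance_const_mul_right, mul_apply, Finset.sum_mul,
    transpose_apply, condCov_apply_eq_covariance]
  rw [Finset.sum_comm]
  refine Finset.sum_congr rfl fun l _ => Finset.sum_congr rfl fun k _ => ?_
  ring

end conditional

/-! ### Standardization -/

theorem c0_pos {n : ℕ} {m : ℝ} (hm : 0 < m) : 0 < c0 n m := by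
  rw [c0_eq hm]
  have := Real.Gamma_pos_of_pos (half_pos hm)
  have := Real.Gamma_pos_of_pos (half_pos (by positivity : 0 < m + n))
  positivity

theorem gsstPDF_eq_gsePDF {n : ℕ} {m : ℝ} (hm : 0 < m) (μ γ : Fin n → ℝ)
    {Sig : Matrix (Fin n) (Fin n) ℝ} (hSig : Sig.PosDef) (H : ℝ → ℝ) :
    gsstPDF μ Sig γ m H = gsePDF μ Sig (stGen n m) (fun z => H (γ ⬝ᵥ z)) := by
  have hΓ := Real.Gamma_pos_of_pos (by positivity : 0 < (m + n) / 2)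
  have hell : ellPDF μ Sig (stGen n m) = stPDF μ Sig m := by
    rw [(isPowerGen_stGen hm).ellPDF_eq_stPDF hm (inv_pos.2 hΓ).ne' hm
      (by rw [Fintype.card_fin]; ring) μ hSig, div_self hm.ne', one_smul]
  funext y
  rw [gsstPDF, gsePDF, hell]

section standardization

variable {S ι : Type*} [MeasurableSpace S] {P : Measure S} [Fintype ι] [DecidableEq ι] {n : ℕ}
  {m : ℝ} {μ γ : ι → ℝ} {Sig : Matrix ι ι ℝ} {H : ℝ → ℝ}

theorem stPDF_zero_one (hn : Fintype.card ι = n) (hm : 0 < m) (z : ι → ℝ) :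
    stPDF 0 1 m z = c0 n m * tPow m 1 ((m + n) / 2) z := by
  rw [stPDF, sub_zero, inv_one, one_mulVec, det_one, Real.sqrt_one, mul_one, c0_eq hm, hn, tPow,
    neg_div]

theorem gsstPDF_zero_one (z : ι → ℝ) :
    gsstPDF 0 1 γ m H z = 2 * stPDF 0 1 m z * H (γ ⬝ᵥ z) := by
  rw [gsstPDF, msqrt_one, inv_one, one_mulVec, sub_zero]

theorem stPDF_zero_one_pos (hm : 0 < m) (z : ι → ℝ) : 0 < stPDF 0 1 m z := by
  rw [stPDF_zero_one rfl hm]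
  exact mul_pos (c0_pos hm) (tPow_pos hm one_pos _ z)

theorem continuous_stPDF_zero_one (hm : 0 < m) : Continuous (stPDF (0 : ι → ℝ) 1 m) := by
  rw [funext (stPDF_zero_one rfl hm)]
  exact (continuous_tPow hm one_pos _).const_mul _

theorem measurable_gsstPDF_zero_one (hm : 0 < m) (hH : Measurable H) :
    Measurable (gsstPDF (0 : ι → ℝ) 1 γ m H) := by
  rw [funext gsstPDF_zero_one]
  exact ((continuous_stPDF_zero_one hm).measurable.const_mul 2).mul
    (hH.comp (continuous_const_dotProduct γ).measurable)

theorem gsstPDF_zero_one_nonneg (hm : 0 < m) (hH : ∀ x, 0 ≤ H x) (z : ι → ℝ) :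
    0 ≤ gsstPDF (0 : ι → ℝ) 1 γ m H z := by
  rw [gsstPDF_zero_one]
  have := stPDF_zero_one_pos hm z
  have := hH (γ ⬝ᵥ z)
  positivity

theorem gsstPDF_eq_mul_standardize (hSig : Sig.PosDef) (y : ι → ℝ) :
    gsstPDF μ Sig γ m H y =
      |(msqrt Sig)⁻¹.det| * gsstPDF 0 1 γ m H (standardize μ Sig y) := by
  have hdet := det_msqrt_pos hSig
  rw [gsstPDF_zero_one, gsstPDF, stPDF, stPDF, dotProduct_inv_mulVec_eq_standardize hSig, inv_one,
    one_mulVec, sub_zero, det_one, Real.sqrt_one, mul_one, ← standardize, det_nonsing_inv,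
    Ring.inverse_eq_inv', abs_of_pos (inv_pos.2 hdet), det_msqrt hSig, ← div_div]
  ring

theorem hasDensity_standardize (hSig : Sig.PosDef) (hm : 0 < m) (hH : Measurable H)
    {Y : S → ι → ℝ} (hY : HasDensity P Y (gsstPDF μ Sig γ m H)) :
    HasDensity P (fun s => standardize μ Sig (Y s)) (gsstPDF 0 1 γ m H) := by
  refine hY.mulVec_sub ?_ μ (measurable_gsstPDF_zero_one hm hH) (gsstPDF_eq_mul_standardize hSig)
  rw [det_nonsing_inv, Ring.inverse_eq_inv']
  exact inv_ne_zero (det_msqrt_pos hSig).ne'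

theorem memLp_two_of_hasDensity {Z : S → ι → ℝ} {B : ℝ} (hm : 2 < m) (hH : Measurable H)
    (hH0 : ∀ x, 0 ≤ H x) (hHB : ∀ x, H x ≤ B)
    (hZ : HasDensity P Z (gsstPDF 0 1 γ m H)) (i : ι) : MemLp (fun s => Z s i) 2 P := by
  have hm0 : 0 < m := by linarith
  have hmeas : Measurable fun s => Z s i := (measurable_pi_apply i).comp hZ.1
  have hsq : Integrable fun z : ι → ℝ => z i * z i * tPow m 1 ((m + Fintype.card ι) / 2) z :=
    integrable_coord_mul_coord_mul_tPow hm0 one_pos (by linarith) i i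
  have hbdd : Integrable fun z : ι → ℝ =>
      z i * z i * tPow m 1 ((m + Fintype.card ι) / 2) z * H (γ ⬝ᵥ z) :=
    hsq.mul_bdd (hH.comp (continuous_const_dotProduct γ).measurable).aestronglyMeasurable
      (Filter.Eventually.of_forall fun z => by
        rw [Real.norm_of_nonneg (hH0 _)]
        exact hHB _)
  rw [memLp_two_iff_integrable_sq hmeas.aestronglyMeasurable,
    hZ.integrable_comp_iff (measurable_gsstPDF_zero_one hm0 hH) (gsstPDF_zero_one_nonneg hm0 hH0)
      (φ := fun z => z i ^ 2) (by fun_prop)]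
  refine (hbdd.const_mul (2 * c0 (Fintype.card ι) m)).congr
    (Filter.Eventually.of_forall fun z => ?_)
  simp only [gsstPDF_zero_one, stPDF_zero_one rfl hm0]
  ring

theorem IsSkewing.nonneg (hH : IsSkewing H) (x : ℝ) : 0 ≤ H x := (hH.2.2 x).1

theorem IsSkewing.le_one (hH : IsSkewing H) (x : ℝ) : H x ≤ 1 := (hH.2.2 x).2

variable {Y : S → ι → ℝ}

theorem MTCE_eq_of_isDiag (hSig : Sig.PosDef) (hdiag : Sig.IsDiag) (y : ι → ℝ) :
    MTCE P Y y = condMean P Y {s | ∀ i, standardize μ Sig y i < standardize μ Sig (Y s) i} := by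
  simp only [MTCE, standardize_lt_standardize_iff hSig hdiag]

theorem MTCov_eq_of_isDiag (hSig : Sig.PosDef) (hdiag : Sig.IsDiag) (y : ι → ℝ) :
    MTCov P Y y = condCov P Y {s | ∀ i, standardize μ Sig y i < standardize μ Sig (Y s) i} := by
  simp only [MTCov, standardize_lt_standardize_iff hSig hdiag]

section

variable (hSig : Sig.PosDef) (hm : 2 < m) (hH : IsSkewing H)
  (hY : HasDensity P Y (gsstPDF μ Sig γ m H))

include hSig hm hH hY

theorem memLp_two_standardize (i : ι) : MemLp (fun s => standardize μ Sig (Y s) i) 2 P :=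
  memLp_two_of_hasDensity hm hH.1 hH.nonneg hH.le_one
    (hasDensity_standardize hSig (by linarith) hH.1 hY) i

variable [IsFiniteMeasure P]

theorem memLp_two_of_hasDensity_gsstPDF (i : ι) : MemLp (fun s => Y s i) 2 P :=
  memLp_add_mulVec (fun s => (add_msqrt_mulVec_standardize hSig μ (Y s)).symm)
    (memLp_two_standardize hSig hm hH hY) i

theorem condMean_standardize_tail {lam : ι → ℝ} (hpos : 0 < tailFn (gsstPDF 0 1 γ m H) lam) :
    condMean P Y {s | ∀ i, lam i < standardize μ Sig (Y s) i} =
      μ + msqrt Sig *ᵥ MTCE P (fun s => standardize μ Sig (Y s)) lam := by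
  have hm0 : 0 < m := by linarith
  refine condMean_add_mulVec ?_ (fun s => (add_msqrt_mulVec_standardize hSig μ (Y s)).symm)
    fun i => (memLp_two_standardize hSig hm hH hY i).integrable one_le_two
  exact (hasDensity_standardize hSig hm0 hH.1 hY).measure_tail_ne_zero
    (measurable_gsstPDF_zero_one hm0 hH.1)
    (gsstPDF_zero_one_nonneg hm0 hH.nonneg) hpos

theorem condCov_standardize_tail {lam : ι → ℝ} (hpos : 0 < tailFn (gsstPDF 0 1 γ m H) lam) :
    condCov P Y {s | ∀ i, lam i < standardize μ Sig (Y s) i} =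
      msqrt Sig * MTCov P (fun s => standardize μ Sig (Y s)) lam * msqrt Sig := by
  have hm0 : 0 < m := by linarith
  refine (condCov_add_mulVec ?_ (fun s => (add_msqrt_mulVec_standardize hSig μ (Y s)).symm)
    (memLp_two_standardize hSig hm hH hY)).trans (by rw [msqrt_transpose, MTCov])
  exact (hasDensity_standardize hSig hm0 hH.1 hY).measure_tail_ne_zero
    (measurable_gsstPDF_zero_one hm0 hH.1)
    (gsstPDF_zero_one_nonneg hm0 hH.nonneg) hpos

end

end standardization

open Filter Topology

/-! ### Integration by parts on orthants -/

section splitting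

variable {ι : Type*} [DecidableEq ι]

/-- The vector with coordinate `t` in the place `k` and `w_l` elsewhere. -/
def ins (k : ι) (w : {l : ι // l ≠ k} → ℝ) (t : ℝ) : ι → ℝ :=
  fun l => if h : l ≠ k then w ⟨l, h⟩ else t

/-- Deletion of the coordinate `k`. -/
def del (k : ι) (z : ι → ℝ) : {l : ι // l ≠ k} → ℝ := fun l => z l

@[simp] theorem ins_self (k : ι) (w : {l : ι // l ≠ k} → ℝ) (t : ℝ) : ins k w t k = t := by
  simp [ins]

theorem ins_of_ne {k l : ι} (h : l ≠ k) (w : {l : ι // l ≠ k} → ℝ) (t : ℝ) :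
    ins k w t l = w ⟨l, h⟩ := by
  simp [ins, h]

theorem continuous_ins (k : ι) (w : {l : ι // l ≠ k} → ℝ) : Continuous (ins k w) := by
  refine continuous_pi fun l => ?_
  by_cases h : l = k
  · subst h; simpa using continuous_id'
  · simpa [ins_of_ne h] using continuous_const

theorem continuous_ins_const (k : ι) (t : ℝ) : Continuous fun w => ins k w t := by
  refine continuous_pi fun l => ?_
  by_cases h : l = k
  · subst h; simpa using continuous_const
  · simpa [ins_of_ne h] using continuous_apply _

/-- The splitting of a vector into the coordinates other than `k` and the coordinate `k`. -/
def splitAt (k : ι) : (ι → ℝ) ≃ᵐ ({l : ι // l ≠ k} → ℝ) × ℝ :=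
  haveI : Unique {l : ι // ¬ l ≠ k} := ⟨⟨⟨k, by simp⟩⟩, fun l => Subtype.ext (not_not.1 l.2)⟩
  (MeasurableEquiv.piEquivPiSubtypeProd (fun _ : ι => ℝ) (· ≠ k)).trans
    ((MeasurableEquiv.refl _).prodCongr (MeasurableEquiv.funUnique {l : ι // ¬ l ≠ k} ℝ))

theorem splitAt_apply (k : ι) (z : ι → ℝ) : splitAt k z = (del k z, z k) := rfl

theorem splitAt_ins (k : ι) (w : {l : ι // l ≠ k} → ℝ) (t : ℝ) :
    splitAt k (ins k w t) = (w, t) := by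
  rw [splitAt_apply, ins_self]
  congr 1
  funext l
  exact ins_of_ne l.2 w t

theorem splitAt_symm_apply (k : ι) (p : ({l : ι // l ≠ k} → ℝ) × ℝ) :
    (splitAt k).symm p = ins k p.1 p.2 := by
  rw [MeasurableEquiv.symm_apply_eq, splitAt_ins]

theorem splitAt_preimage (k : ι) (lam : ι → ℝ) :
    splitAt k ⁻¹' (orthant (del k lam) ×ˢ Set.Ioi (lam k)) = orthant lam := by
  ext z
  simp only [Set.mem_preimage, splitAt_apply, Set.mem_prod, orthant, Set.mem_ofPred_eq, Set.mem_Ioi,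
    del]
  constructor
  · rintro ⟨hdel, hk⟩ i
    by_cases hi : i = k
    · rw [hi]; exact hk
    · exact hdel ⟨i, hi⟩
  · exact fun h => ⟨fun l => h l, h k⟩

variable [Fintype ι]

theorem dotProduct_ins (γ : ι → ℝ) (k : ι) (w : {l : ι // l ≠ k} → ℝ) (t : ℝ) :
    γ ⬝ᵥ ins k w t = del k γ ⬝ᵥ w + γ k * t := by
  rw [dotProduct, dotProduct, ← Fintype.sum_subtype_add_sum_subtype (· ≠ k)]
  congr 1
  · refine Finset.sum_congr rfl fun l _ => ?_
    rw [ins_of_ne l.2]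
    rfl
  · have : ∀ l : {l : ι // ¬ l ≠ k}, γ l * ins k w t l = γ k * t := by
      rintro ⟨l, hl⟩
      obtain rfl : l = k := not_not.1 hl
      simp
    rw [Finset.sum_congr rfl fun l _ => this l]
    simp [Finset.card_univ]

theorem ins_dotProduct_ins (k : ι) (w : {l : ι // l ≠ k} → ℝ) (t : ℝ) :
    ins k w t ⬝ᵥ ins k w t = w ⬝ᵥ w + t ^ 2 := by
  rw [dotProduct_ins, ins_self, sq]
  congr 2
  funext l
  exact ins_of_ne l.2 w t

theorem measurePreserving_splitAt (k : ι) :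
    MeasurePreserving (splitAt k) volume (volume.prod volume) := by
  let _ : Unique {l : ι // ¬ l ≠ k} := ⟨⟨⟨k, by simp⟩⟩, fun l => Subtype.ext (not_not.1 l.2)⟩
  have hsplit : MeasurePreserving _ volume (volume.prod volume) :=
    volume_preserving_piEquivPiSubtypeProd (fun _ : ι => ℝ) (· ≠ k)
  have hunique : MeasurePreserving (MeasurableEquiv.funUnique {l : ι // ¬ l ≠ k} ℝ)
      (@volume _ (@MeasureSpace.pi _ (Subtype.fintype _) _ _)) volume := by
    convert! volume_preserving_funUnique {l : ι // ¬ l ≠ k} ℝ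
  exact ((MeasurePreserving.id volume).prod hunique).comp hsplit

theorem integrableOn_orthant_iff (k : ι) (lam : ι → ℝ) (F : (ι → ℝ) → ℝ) :
    IntegrableOn F (orthant lam) ↔
      Integrable (fun p : ({l : ι // l ≠ k} → ℝ) × ℝ => F (ins k p.1 p.2))
        ((volume.restrict (orthant (del k lam))).prod (volume.restrict (Set.Ioi (lam k)))) := by
  rw [Measure.prod_restrict, ← splitAt_preimage k lam]
  have h := (measurePreserving_splitAt k).integrableOn_comp_preimage
    (splitAt k).measurableEmbedding (f := F ∘ (splitAt k).symm)
    (s := orthant (del k lam) ×ˢ Set.Ioi (lam k))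
  have hcancel : (F ∘ (splitAt k).symm) ∘ splitAt k = F := by
    funext z; simp
  have hcurry : F ∘ (splitAt k).symm = fun p => F (ins k p.1 p.2) := by
    funext p; rw [Function.comp_apply, splitAt_symm_apply]
  rw [hcancel, hcurry] at h
  exact h

theorem setIntegral_orthant_eq (k : ι) (lam : ι → ℝ) {F : (ι → ℝ) → ℝ}
    (hF : IntegrableOn F (orthant lam)) :
    ∫ z in orthant lam, F z =
      ∫ w in orthant (del k lam), ∫ t in Set.Ioi (lam k), F (ins k w t) := by
  have h := (measurePreserving_splitAt k).setIntegral_preimage_emb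
    (splitAt k).measurableEmbedding (F ∘ (splitAt k).symm)
    (orthant (del k lam) ×ˢ Set.Ioi (lam k))
  have hcurry : F ∘ (splitAt k).symm = fun p => F (ins k p.1 p.2) := by
    funext p; rw [Function.comp_apply, splitAt_symm_apply]
  have hround : ∀ z, (F ∘ (splitAt k).symm) (splitAt k z) = F z := fun z => by simp
  simp_rw [hround] at h
  rw [splitAt_preimage, hcurry, ← Measure.prod_restrict] at h
  rw [h, integral_prod _ ((integrableOn_orthant_iff k lam F).1 hF)]

theorem tendsto_zero_of_subseq {f f' : ℝ → ℝ} {a : ℝ} (hf : ∀ x, HasDerivAt f (f' x) x)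
    (hint : IntegrableOn f' (Set.Ioi a)) {u : ℕ → ℝ} (hu : Tendsto u atTop atTop)
    (hlim : Tendsto (fun n => f (u n)) atTop (𝓝 0)) :
    Tendsto f atTop (𝓝 0) := by
  have h := tendsto_limUnder_of_hasDerivAt_of_integrableOn_Ioi (fun x _ => hf x) hint
  rwa [tendsto_nhds_unique (h.comp hu) hlim] at h

theorem setIntegral_orthant_deriv (k : ι) (lam : ι → ℝ) {F F' : (ι → ℝ) → ℝ}
    (hder : ∀ w t, HasDerivAt (fun t => F (ins k w t)) (F' (ins k w t)) t)
    (hint : IntegrableOn F' (orthant lam))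
    (hlim : ∀ w, ∃ u : ℕ → ℝ, Tendsto u atTop atTop ∧
      Tendsto (fun n => F (ins k w (u n))) atTop (𝓝 0)) :
    ∫ z in orthant lam, F' z = -∫ w in orthant (del k lam), F (ins k w (lam k)) := by
  rw [setIntegral_orthant_eq k lam hint, ← integral_neg]
  refine integral_congr_ae ?_
  filter_upwards [((integrableOn_orthant_iff k lam F').1 hint).prod_right_ae] with w hw
  obtain ⟨u, hu, hu0⟩ := hlim w
  have := integral_Ioi_of_hasDerivAt_of_tendsto' (fun t _ => hder w t) hw
    (tendsto_zero_of_subseq (hder w) hw hu hu0)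
  rw [this, zero_sub]

theorem intervalIntegral_norm_le_of_hasDerivAt_sub {u φ ψ : ℝ → ℝ} {a b : ℝ} (hab : a ≤ b)
    (hu : ∀ x, HasDerivAt u (ψ x - φ x) x) (hu0 : ∀ x, 0 ≤ u x)
    (hφ0 : ∀ x, a < x → 0 ≤ φ x) (hφc : Continuous φ) (hψc : Continuous ψ)
    (hψ : IntegrableOn ψ (Set.Ioi a)) :
    ∫ x in a..b, ‖φ x‖ ≤ u a + ∫ x in Set.Ioi a, ‖ψ x‖ := by
  have hnorm : ∫ x in a..b, ‖φ x‖ = ∫ x in a..b, φ x :=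
    intervalIntegral.integral_congr_ae (Eventually.of_forall fun x hx => by
      rw [Set.uIoc_of_le hab] at hx
      exact Real.norm_of_nonneg (hφ0 x hx.1))
  have hftc := intervalIntegral.integral_eq_sub_of_hasDerivAt (a := a) (b := b)
    (fun x _ => hu x) ((hψc.sub hφc).intervalIntegrable a b)
  rw [intervalIntegral.integral_sub (hψc.intervalIntegrable a b) (hφc.intervalIntegrable a b)]
    at hftc
  have hle : ∫ x in a..b, ψ x ≤ ∫ x in Set.Ioi a, ‖ψ x‖ := by
    calc ∫ x in a..b, ψ x ≤ ∫ x in a..b, ‖ψ x‖ :=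
          intervalIntegral.integral_mono_on hab (hψc.intervalIntegrable a b)
            (hψc.norm.intervalIntegrable a b) fun x _ => le_abs_self _
      _ = ∫ x in Set.Ioc a b, ‖ψ x‖ := intervalIntegral.integral_of_le hab
      _ ≤ ∫ x in Set.Ioi a, ‖ψ x‖ :=
          setIntegral_mono_set hψ.norm (Eventually.of_forall fun x => norm_nonneg _)
            (Eventually.of_forall fun x hx => hx.1)
  linarith [hu0 b]

theorem integrableOn_Ioi_of_hasDerivAt_sub {u φ ψ : ℝ → ℝ} {a : ℝ}
    (hu : ∀ x, HasDerivAt u (ψ x - φ x) x) (hu0 : ∀ x, 0 ≤ u x)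
    (hφ0 : ∀ x, a < x → 0 ≤ φ x) (hφc : Continuous φ) (hψc : Continuous ψ)
    (hψ : IntegrableOn ψ (Set.Ioi a)) :
    IntegrableOn φ (Set.Ioi a) ∧
      ∫ x in Set.Ioi a, ‖φ x‖ ≤ u a + ∫ x in Set.Ioi a, ‖ψ x‖ := by
  have hbound : ∀ᶠ b in atTop, ∫ x in a..b, ‖φ x‖ ≤ u a + ∫ x in Set.Ioi a, ‖ψ x‖ := by
    filter_upwards [eventually_ge_atTop a] with b hb
    exact intervalIntegral_norm_le_of_hasDerivAt_sub hb hu hu0 hφ0 hφc hψc hψ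
  have hI : IntegrableOn φ (Set.Ioi a) :=
    integrableOn_Ioi_of_intervalIntegral_norm_bounded _ a (b := id)
      (fun b => hφc.integrableOn_Icc.mono_set Set.Ioc_subset_Icc_self) tendsto_id hbound
  exact ⟨hI, le_of_tendsto (intervalIntegral_tendsto_integral_Ioi a hI.norm tendsto_id) hbound⟩

theorem integrableOn_orthant_of_hasDerivAt_sub (k : ι) (lam : ι → ℝ) {u φ ψ : (ι → ℝ) → ℝ}
    (hu : ∀ w t, HasDerivAt (fun t => u (ins k w t)) (ψ (ins k w t) - φ (ins k w t)) t)
    (hu0 : ∀ z, 0 ≤ u z) (hφ0 : ∀ z, lam k < z k → 0 ≤ φ z) (hφc : Continuous φ)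
    (hψc : Continuous ψ) (hψ : IntegrableOn ψ (orthant lam))
    (hbd : IntegrableOn (fun w => u (ins k w (lam k))) (orthant (del k lam))) :
    IntegrableOn φ (orthant lam) := by
  have hψ' := (integrableOn_orthant_iff k lam ψ).1 hψ
  have hae : ∀ᵐ w ∂volume.restrict (orthant (del k lam)),
      IntegrableOn (fun t => φ (ins k w t)) (Set.Ioi (lam k)) ∧
      ∫ t in Set.Ioi (lam k), ‖φ (ins k w t)‖ ≤
        u (ins k w (lam k)) + ∫ t in Set.Ioi (lam k), ‖ψ (ins k w t)‖ := by
    filter_upwards [hψ'.prod_right_ae] with w hw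
    exact integrableOn_Ioi_of_hasDerivAt_sub (hu w) (fun t => hu0 _)
      (fun t ht => hφ0 _ (by simpa using ht)) (hφc.comp (continuous_ins k w))
      (hψc.comp (continuous_ins k w)) hw
  have hmeas : Measurable fun p : ({l : ι // l ≠ k} → ℝ) × ℝ => φ (ins k p.1 p.2) := by
    have : (fun p : ({l : ι // l ≠ k} → ℝ) × ℝ => φ (ins k p.1 p.2)) =
        φ ∘ (splitAt k).symm := by
      funext p; rw [Function.comp_apply, splitAt_symm_apply]
    rw [this]
    exact hφc.measurable.comp (splitAt k).symm.measurable
  rw [integrableOn_orthant_iff k, integrable_prod_iff hmeas.aestronglyMeasurable]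
  refine ⟨hae.mono fun w hw => hw.1, ?_⟩
  refine (hbd.add hψ'.norm.integral_prod_left).mono'
    hmeas.norm.aestronglyMeasurable.integral_prod_right' ?_
  filter_upwards [hae] with w hw
  rw [Real.norm_of_nonneg (integral_nonneg fun _ => norm_nonneg _)]
  exact hw.2

end splitting

/-! ### Partial integration against powers of `b + |z|² / m` -/

/-- `K` stays bounded along some sequence tending to infinity on every line `t ↦ c + a * t`. This is
all that the boundary terms at infinity need: it holds for the derivative of a bounded function,
which may itself be unbounded. -/
def SeqBounded (K : ℝ → ℝ) : Prop :=
  ∀ a c : ℝ, ∃ (B : ℝ) (u : ℕ → ℝ), Tendsto u atTop atTop ∧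
    ∀ n, |K (c + a * u n)| ≤ B

theorem SeqBounded.of_bounded {K : ℝ → ℝ} {B : ℝ} (h : ∀ x, |K x| ≤ B) : SeqBounded K :=
  fun _ _ => ⟨B, fun n => n, tendsto_natCast_atTop_atTop, fun _ => h _⟩

theorem SeqBounded.deriv {K K' : ℝ → ℝ} {B : ℝ} (h : ∀ x, |K x| ≤ B)
    (hK : ∀ x, HasDerivAt K (K' x) x) : SeqBounded K' := by
  intro a c
  by_cases ha : a = 0
  · exact ⟨|K' c|, fun n => n, tendsto_natCast_atTop_atTop, fun n => by simp [ha]⟩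
  have hder : ∀ t, HasDerivAt (fun t => K (c + a * t)) (K' (c + a * t) * a) t := by
    intro t
    have hline : HasDerivAt (fun t => c + a * t) a t := by
      simpa using ((hasDerivAt_id t).const_mul a).const_add c
    exact (hK _).comp t hline
  have hex : ∀ n : ℕ, ∃ t ∈ Set.Ioo (n : ℝ) (n + 1), |K' (c + a * t)| ≤ 2 * B / |a| := by
    intro n
    obtain ⟨t, ht, hslope⟩ := exists_hasDerivAt_eq_slope (fun t => K (c + a * t))
      (fun t => K' (c + a * t) * a) (by linarith : (n : ℝ) < n + 1)
      (fun t _ => (hder t).continuousAt.continuousWithinAt) (fun t _ => hder t)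
    refine ⟨t, ht, ?_⟩
    rw [add_sub_cancel_left, div_one] at hslope
    rw [le_div_iff₀ (abs_pos.2 ha), ← abs_mul, hslope]
    refine (abs_sub _ _).trans ?_
    linarith [h (c + a * (n + 1)), h (c + a * n)]
  choose u hu hbound using hex
  exact ⟨2 * B / |a|, u, tendsto_atTop_mono (fun n => (hu n).1.le)
    tendsto_natCast_atTop_atTop, hbound⟩

theorem integrable_mul_comp_dotProduct {ι : Type*} [Fintype ι] {K : ℝ → ℝ} {B : ℝ}
    (hK : Continuous K) (hB : ∀ x, |K x| ≤ B) (γ : ι → ℝ) (c : ℝ)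
    {f : (ι → ℝ) → ℝ} (hf : Integrable f) :
    Integrable fun z => f z * K (c + γ ⬝ᵥ z) :=
  hf.mul_bdd (c := B)
    (hK.comp (continuous_const.add (continuous_const_dotProduct γ))).aestronglyMeasurable
    (Eventually.of_forall fun _ => hB _)

section parts

variable {ι : Type*} [Fintype ι] [DecidableEq ι] {m b : ℝ}

theorem tPow_ins (p : ℝ) (k : ι) (w : {l : ι // l ≠ k} → ℝ) (t : ℝ) :
    tPow m b p (ins k w t) = tPow m (b + t ^ 2 / m) p w := by
  rw [tPow, tPow, ins_dotProduct_ins]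
  congr 1
  ring

theorem hasDerivAt_tPow_ins (hm : 0 < m) (hb : 0 < b) (p : ℝ) (k : ι)
    (w : {l : ι // l ≠ k} → ℝ) (t : ℝ) :
    HasDerivAt (fun t => tPow m b p (ins k w t))
      (-(2 * p / m) * (t * tPow m b (p + 1) (ins k w t))) t := by
  simp only [tPow, ins_dotProduct_ins]
  have hbase : HasDerivAt (fun t : ℝ => b + (w ⬝ᵥ w + t ^ 2) / m) (2 * t / m) t := by
    simpa using ((((hasDerivAt_id t).pow 2).const_add (w ⬝ᵥ w)).div_const m).const_add b
  have hpos : 0 < b + (w ⬝ᵥ w + t ^ 2) / m := by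
    have := dotProduct_self_nonneg w
    positivity
  refine (hbase.rpow_const (p := -p) (Or.inl hpos.ne')).congr_deriv ?_
  rw [show -p - 1 = -(p + 1) by ring]
  ring

theorem tendsto_tPow_ins (hm : 0 < m) {p : ℝ} (hp : 0 < p) (k : ι)
    (w : {l : ι // l ≠ k} → ℝ) :
    Tendsto (fun t => tPow m b p (ins k w t)) atTop (𝓝 0) := by
  simp only [tPow, ins_dotProduct_ins]
  refine (tendsto_rpow_neg_atTop hp).comp ?_
  refine tendsto_atTop_add_const_left _ _ (Tendsto.atTop_div_const hm ?_)
  exact tendsto_atTop_add_const_left _ _ (tendsto_pow_atTop two_ne_zero)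

theorem tendsto_mul_tPow_ins (hm : 0 < m) (hb : 0 < b) {p : ℝ} (hp : 1 / 2 < p) (k : ι)
    (w : {l : ι // l ≠ k} → ℝ) :
    Tendsto (fun t => t * tPow m b p (ins k w t)) atTop (𝓝 0) := by
  have h := (tendsto_tPow_ins (b := b) hm (by linarith : 0 < p - 1 / 2) k w).const_mul (√m)
  rw [mul_zero] at h
  refine squeeze_zero_norm (fun t => ?_) h
  rw [norm_mul, Real.norm_eq_abs, Real.norm_of_nonneg (tPow_pos hm hb p _).le]
  simpa using abs_coord_mul_tPow_le hm hb p k (ins k w t)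

theorem hasDerivAt_comp_dotProduct_ins {K K' : ℝ → ℝ} (hK : ∀ x, HasDerivAt K (K' x) x)
    (γ : ι → ℝ) (c : ℝ) (k : ι) (w : {l : ι // l ≠ k} → ℝ) (t : ℝ) :
    HasDerivAt (fun t => K (c + γ ⬝ᵥ ins k w t)) (γ k * K' (c + γ ⬝ᵥ ins k w t)) t := by
  have hline : HasDerivAt (fun t => c + γ ⬝ᵥ ins k w t) (γ k) t := by
    simp only [dotProduct_ins]
    simpa using (((hasDerivAt_id t).const_mul (γ k)).const_add (del k γ ⬝ᵥ w)).const_add c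
  exact ((hK _).comp t hline).congr_deriv (mul_comm _ _)

theorem SeqBounded.exists_tendsto {K : ℝ → ℝ} (hK : SeqBounded K) (γ : ι → ℝ) (c : ℝ) (k : ι)
    (w : {l : ι // l ≠ k} → ℝ) {f : ℝ → ℝ} (hf : Tendsto f atTop (𝓝 0)) :
    ∃ u : ℕ → ℝ, Tendsto u atTop atTop ∧
      Tendsto (fun n => f (u n) * K (c + γ ⬝ᵥ ins k w (u n))) atTop (𝓝 0) := by
  obtain ⟨B, u, hu, hB⟩ := hK (γ k) (c + del k γ ⬝ᵥ w)
  refine ⟨u, hu, ?_⟩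
  have h := ((hf.comp hu).norm).mul_const B
  rw [norm_zero, zero_mul] at h
  refine squeeze_zero_norm (fun n => ?_) h
  rw [norm_mul, dotProduct_ins, ← add_assoc]
  exact mul_le_mul_of_nonneg_left (hB n) (norm_nonneg _)

theorem setIntegral_orthant_mul_coord_mul_tPow (hm : 0 < m) (hb : 0 < b) {p : ℝ}
    {K K' : ℝ → ℝ} (hK : ∀ x, HasDerivAt K (K' x) x) (hKb : SeqBounded K) (γ : ι → ℝ) (c : ℝ)
    (k : ι) (lam : ι → ℝ) {q q' : (ι → ℝ) → ℝ}
    (hq : ∀ w t, HasDerivAt (fun t => q (ins k w t)) (q' (ins k w t)) t)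
    (hlim : ∀ w, Tendsto (fun t => q (ins k w t) * tPow m b p (ins k w t)) atTop (𝓝 0))
    (hint : IntegrableOn (fun z => q z * z k * tPow m b (p + 1) z * K (c + γ ⬝ᵥ z)) (orthant lam))
    (hint_q : IntegrableOn (fun z => q' z * tPow m b p z * K (c + γ ⬝ᵥ z)) (orthant lam))
    (hint_K : IntegrableOn (fun z => q z * tPow m b p z * K' (c + γ ⬝ᵥ z)) (orthant lam)) :
    2 * p / m * ∫ z in orthant lam, q z * z k * tPow m b (p + 1) z * K (c + γ ⬝ᵥ z) =
      (∫ w in orthant (del k lam), q (ins k w (lam k)) * tPow m b p (ins k w (lam k)) *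
        K (c + γ ⬝ᵥ ins k w (lam k))) +
      (∫ z in orthant lam, q' z * tPow m b p z * K (c + γ ⬝ᵥ z)) +
      γ k * ∫ z in orthant lam, q z * tPow m b p z * K' (c + γ ⬝ᵥ z) := by
  have hder : ∀ w t, HasDerivAt
      (fun t => q (ins k w t) * tPow m b p (ins k w t) * K (c + γ ⬝ᵥ ins k w t))
      (q' (ins k w t) * tPow m b p (ins k w t) * K (c + γ ⬝ᵥ ins k w t) +
        γ k * (q (ins k w t) * tPow m b p (ins k w t) * K' (c + γ ⬝ᵥ ins k w t)) -
        2 * p / m * (q (ins k w t) * ins k w t k * tPow m b (p + 1) (ins k w t) *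
          K (c + γ ⬝ᵥ ins k w t))) t := by
    intro w t
    refine (((hq w t).mul (hasDerivAt_tPow_ins hm hb p k w t)).mul
      (hasDerivAt_comp_dotProduct_ins hK γ c k w t)).congr_deriv ?_
    simp only [ins_self, Pi.mul_apply]
    ring
  have hsum := hint_q.add (hint_K.const_mul (γ k))
  have hint' := hint.const_mul (2 * p / m)
  have h := setIntegral_orthant_deriv (F := fun z => q z * tPow m b p z * K (c + γ ⬝ᵥ z)) k lam hder
    (hsum.sub hint') fun w => hKb.exists_tendsto γ c k w (hlim w)
  have hsub := integral_sub hsum hint'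
  have hadd := integral_add hint_q (hint_K.const_mul (γ k))
  simp only [Pi.add_apply] at hsub
  simp only [Pi.sub_apply, Pi.add_apply] at h
  rw [hsub, hadd, integral_const_mul, integral_const_mul] at h
  linarith

theorem setIntegral_orthant_coord_mul_tPow (hm : 0 < m) (hb : 0 < b) {p : ℝ} (hp : 0 < p)
    {K K' : ℝ → ℝ} (hK : ∀ x, HasDerivAt K (K' x) x) (hKb : SeqBounded K) (γ : ι → ℝ) (c : ℝ)
    (k : ι) (lam : ι → ℝ)
    (hint : IntegrableOn (fun z => z k * tPow m b (p + 1) z * K (c + γ ⬝ᵥ z)) (orthant lam))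
    (hint_K : IntegrableOn (fun z => tPow m b p z * K' (c + γ ⬝ᵥ z)) (orthant lam)) :
    2 * p / m * ∫ z in orthant lam, z k * tPow m b (p + 1) z * K (c + γ ⬝ᵥ z) =
      (∫ w in orthant (del k lam), tPow m b p (ins k w (lam k)) *
        K (c + γ ⬝ᵥ ins k w (lam k))) +
      γ k * ∫ z in orthant lam, tPow m b p z * K' (c + γ ⬝ᵥ z) := by
  simpa using setIntegral_orthant_mul_coord_mul_tPow hm hb hK hKb γ c k lam
    (q := fun _ => 1) (q' := fun _ => 0) (fun _ t => hasDerivAt_const t 1)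
    (fun w => by simpa using tendsto_tPow_ins hm hp k w) (by simpa using hint) (by simp)
    (by simpa using hint_K)

theorem hasDerivAt_sqrt_one_add_sq {K : ℝ → ℝ} {K' x : ℝ} (hK : HasDerivAt K K' x) :
    HasDerivAt (fun x => √(1 + K x ^ 2)) (K x * K' / √(1 + K x ^ 2)) x := by
  have hpos : 1 + K x ^ 2 ≠ 0 := by positivity
  refine (((hK.pow 2).const_add 1).sqrt hpos).congr_deriv ?_
  simp only [Nat.cast_ofNat, Nat.add_one_sub_one, pow_one, Pi.pow_apply]
  rw [mul_assoc, mul_div_mul_left _ _ two_ne_zero]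

theorem sqrt_one_add_sq_le (x : ℝ) : √(1 + x ^ 2) ≤ 1 + |x| := by
  refine Real.sqrt_le_iff.2 ⟨by positivity, ?_⟩
  nlinarith [abs_nonneg x, sq_abs x]

theorem abs_le_sqrt_one_add_sq (x : ℝ) : |x| ≤ √(1 + x ^ 2) :=
  Real.abs_le_sqrt (by linarith)

theorem abs_mul_div_sqrt_one_add_sq_le (x y : ℝ) : |x * y / √(1 + x ^ 2)| ≤ |y| := by
  have hpos : 0 < √(1 + x ^ 2) := Real.sqrt_pos.2 (by positivity)
  rw [abs_div, abs_mul, abs_of_pos hpos, div_le_iff₀ hpos, mul_comm]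
  exact mul_le_mul_of_nonneg_left (abs_le_sqrt_one_add_sq x) (abs_nonneg y)

theorem integrable_mul_sqrt_one_add_sq {α : Type*} [MeasurableSpace α] {μ : Measure α}
    {f K : α → ℝ} (hf : Integrable f μ) (hfK : Integrable (fun x => f x * K x) μ)
    (hK : AEStronglyMeasurable K μ) : Integrable (fun x => f x * √(1 + K x ^ 2)) μ := by
  refine (hf.norm.add hfK.norm).mono' (hf.aestronglyMeasurable.mul
    (Real.continuous_sqrt.comp_aestronglyMeasurable
      (aestronglyMeasurable_const.add (hK.pow 2)))) (Eventually.of_forall fun x => ?_)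
  calc ‖f x * √(1 + K x ^ 2)‖ = ‖f x‖ * √(1 + K x ^ 2) := by
        rw [norm_mul, Real.norm_of_nonneg (Real.sqrt_nonneg _)]
    _ ≤ ‖f x‖ * (1 + |K x|) := by gcongr; exact sqrt_one_add_sq_le _
    _ = ‖f x‖ + ‖f x * K x‖ := by rw [norm_mul, Real.norm_eq_abs (K x)]; ring

theorem integrableOn_coord_mul_tPow_mul_of_nonneg (hm : 0 < m) (hb : 0 < b) {p : ℝ} (hp : 0 < p)
    {N N' : ℝ → ℝ} (hN : ∀ x, HasDerivAt N (N' x) x) (hN0 : ∀ x, 0 ≤ N x) (hN' : Continuous N')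
    (γ : ι → ℝ) (c : ℝ) (k : ι) (lam : ι → ℝ)
    (hint : IntegrableOn (fun z => tPow m b (p + 1) z * N (c + γ ⬝ᵥ z)) (orthant lam))
    (hint' : IntegrableOn (fun z => tPow m b p z * N' (c + γ ⬝ᵥ z)) (orthant lam))
    (hface : IntegrableOn (fun w => tPow m b p (ins k w (lam k)) * N (c + γ ⬝ᵥ ins k w (lam k)))
      (orthant (del k lam))) :
    IntegrableOn (fun z => z k * tPow m b (p + 1) z * N (c + γ ⬝ᵥ z)) (orthant lam) := by
  have hNc : Continuous N := continuous_iff_continuousAt.2 fun x => (hN x).continuousAt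
  have hdot : Continuous fun z : ι → ℝ => c + γ ⬝ᵥ z :=
    continuous_const.add (continuous_const_dotProduct γ)
  have hf := (continuous_tPow hm hb (p + 1)).mul (hNc.comp hdot)
  have hf' := (continuous_tPow hm hb p).mul (hN'.comp hdot)
  have hshift := integrableOn_orthant_of_hasDerivAt_sub k lam
    (u := fun z => tPow m b p z * N (c + γ ⬝ᵥ z))
    (φ := fun z => 2 * p / m * ((z k + |lam k|) * (tPow m b (p + 1) z * N (c + γ ⬝ᵥ z))))
    (ψ := fun z => 2 * p / m * |lam k| * (tPow m b (p + 1) z * N (c + γ ⬝ᵥ z)) +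
      γ k * (tPow m b p z * N' (c + γ ⬝ᵥ z)))
    (fun w t => by
      refine ((hasDerivAt_tPow_ins hm hb p k w t).mul
        (hasDerivAt_comp_dotProduct_ins hN γ c k w t)).congr_deriv ?_
      simp only [ins_self]
      ring)
    (fun z => mul_nonneg (tPow_pos hm hb _ z).le (hN0 _))
    (fun z hz => by
      have hz' : 0 ≤ z k + |lam k| := by linarith [neg_abs_le (lam k)]
      have := mul_nonneg (tPow_pos hm hb (p + 1) z).le (hN0 (c + γ ⬝ᵥ z))
      positivity)
    (continuous_const.mul (((continuous_apply k).add continuous_const).mul hf))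
    ((continuous_const.mul hf).add (continuous_const.mul hf'))
    ((hint.const_mul _).add (hint'.const_mul _)) hface
  refine ((hshift.const_mul (m / (2 * p))).sub (hint.const_mul |lam k|)).congr
    (Eventually.of_forall fun z => ?_)
  simp only [Pi.sub_apply]
  field_simp
  ring

/-- No decay of `K` is assumed, so the factor `z k` cannot be bounded away; it is controlled by the
derivative of `tPow m b p z * √(1 + K²)`, whose second factor is a smooth substitute for `|K|`. -/
theorem integrableOn_coord_mul_tPow_mul (hm : 0 < m) (hb : 0 < b) {p : ℝ} (hp : 0 < p)
    {K K' : ℝ → ℝ} (hK : ∀ x, HasDerivAt K (K' x) x) (hK' : Continuous K') (γ : ι → ℝ) (c : ℝ)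
    (k : ι) (lam : ι → ℝ) (h0 : IntegrableOn (tPow m b (p + 1)) (orthant lam))
    (hint : IntegrableOn (fun z => tPow m b (p + 1) z * K (c + γ ⬝ᵥ z)) (orthant lam))
    (hint' : IntegrableOn (fun z => tPow m b p z * K' (c + γ ⬝ᵥ z)) (orthant lam))
    (hface0 : IntegrableOn (fun w => tPow m b p (ins k w (lam k))) (orthant (del k lam)))
    (hface : IntegrableOn (fun w => tPow m b p (ins k w (lam k)) * K (c + γ ⬝ᵥ ins k w (lam k)))
      (orthant (del k lam))) :
    IntegrableOn (fun z => z k * tPow m b (p + 1) z * K (c + γ ⬝ᵥ z)) (orthant lam) := by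
  have hKc : Continuous K := continuous_iff_continuousAt.2 fun x => (hK x).continuousAt
  have hdot : Continuous fun z : ι → ℝ => c + γ ⬝ᵥ z :=
    continuous_const.add (continuous_const_dotProduct γ)
  have hN' : Continuous fun x => K x * K' x / √(1 + K x ^ 2) :=
    (hKc.mul hK').div (by fun_prop) fun x => (Real.sqrt_pos.2 (by positivity)).ne'
  have hmajorant := integrableOn_coord_mul_tPow_mul_of_nonneg hm hb hp
    (fun x => hasDerivAt_sqrt_one_add_sq (hK x)) (fun x => Real.sqrt_nonneg _) hN' γ c k lam
    (integrable_mul_sqrt_one_add_sq h0 hint (hKc.comp hdot).aestronglyMeasurable)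
    (Integrable.mono hint' ((continuous_tPow hm hb p).mul (hN'.comp hdot)).aestronglyMeasurable
      (Eventually.of_forall fun z => by
        rw [norm_mul, norm_mul]
        exact mul_le_mul_of_nonneg_left (abs_mul_div_sqrt_one_add_sq_le _ _) (norm_nonneg _)))
    (integrable_mul_sqrt_one_add_sq hface0 hface
      ((hKc.comp hdot).comp (continuous_ins_const k (lam k))).aestronglyMeasurable)
  refine Integrable.mono hmajorant (((continuous_apply k).mul (continuous_tPow hm hb _)).mul
    (hKc.comp hdot)).aestronglyMeasurable (Eventually.of_forall fun z => ?_)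
  rw [norm_mul, norm_mul _ (√_), Real.norm_of_nonneg (Real.sqrt_nonneg _)]
  exact mul_le_mul_of_nonneg_left (abs_le_sqrt_one_add_sq _) (norm_nonneg _)

end parts

/-! ### First and second tail moments -/

section reindex

theorem setIntegral_orthant_reindex {α β : Type*} [Fintype α] [Fintype β] (e : α ≃ β)
    (t : β → ℝ) (f : (β → ℝ) → ℝ) :
    ∫ y in orthant t, f y = ∫ x in orthant fun a => t (e a), f fun b => x (e.symm b) := by
  have happ : ∀ x : α → ℝ, MeasurableEquiv.piCongrLeft (fun _ : β => ℝ) e x =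
      fun b => x (e.symm b) := by
    intro x
    funext b
    obtain ⟨a, rfl⟩ := e.surjective b
    rw [MeasurableEquiv.piCongrLeft_apply_apply, e.symm_apply_apply]
  have hpre : MeasurableEquiv.piCongrLeft (fun _ : β => ℝ) e ⁻¹' orthant t =
      orthant fun a => t (e a) := by
    ext x
    rw [Set.mem_preimage, happ]
    exact ⟨fun h a => by simpa using h (e a), fun h b => by simpa using h (e.symm b)⟩
  have h := (volume_measurePreserving_piCongrLeft (fun _ : β => ℝ) e).setIntegral_preimage_emb
    (MeasurableEquiv.measurableEmbedding _) f (orthant t)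
  rw [hpre] at h
  simp_rw [happ] at h
  exact h.symm

variable {n : ℕ}

/-- Deleting `i` and then `j` is deleting both; this makes an edge of an orthant a face of a
face. -/
def dropDrop {i j : Fin n} (hij : j ≠ i) :
    {l : {l : Fin n // l ≠ i} // l ≠ ⟨j, hij⟩} ≃ Drop2 i j where
  toFun l := ⟨l.1.1, l.1.2, fun h => l.2 (Subtype.ext h)⟩
  invFun l := ⟨⟨l.1, l.2.1⟩, fun h => l.2.2 (congrArg Subtype.val h)⟩
  left_inv _ := rfl
  right_inv _ := rfl

theorem insert1_eq_ins (k : Fin n) (lam : Fin n → ℝ) (w : Drop1 k → ℝ) :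
    insert1 k lam w = ins k w (lam k) := by
  funext l
  by_cases h : l = k
  · subst h; simp [insert1]
  · simp [insert1, ins_of_ne h, h]

theorem insert2_dropDrop {i j : Fin n} (hij : j ≠ i) (lam : Fin n → ℝ)
    (x : {l : {l : Fin n // l ≠ i} // l ≠ ⟨j, hij⟩} → ℝ) :
    insert2 i j lam (fun b => x ((dropDrop hij).symm b)) =
      ins i (ins ⟨j, hij⟩ x (lam j)) (lam i) := by
  funext l
  by_cases hi : l = i
  · subst hi; simp [insert2]
  · rw [ins_of_ne hi]
    by_cases hj : l = j
    · subst hj; simp [insert2]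
    · rw [ins_of_ne fun h => hj (congrArg Subtype.val h)]
      simp [insert2, hi, hj, dropDrop]

theorem insert1_dotProduct_insert1 (k : Fin n) (lam : Fin n → ℝ) (w : Drop1 k → ℝ) :
    insert1 k lam w ⬝ᵥ insert1 k lam w = w ⬝ᵥ w + lam k ^ 2 := by
  rw [insert1_eq_ins, ins_dotProduct_ins]

theorem insert2_dotProduct_insert2 {i j : Fin n} (hij : i ≠ j) (lam : Fin n → ℝ)
    (u : Drop2 i j → ℝ) :
    insert2 i j lam u ⬝ᵥ insert2 i j lam u = u ⬝ᵥ u + lam i ^ 2 + lam j ^ 2 := by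
  have h := insert2_dropDrop hij.symm lam fun a => u (dropDrop hij.symm a)
  simp only [Equiv.apply_symm_apply] at h
  have hsum : (fun a => u (dropDrop hij.symm a)) ⬝ᵥ (fun a => u (dropDrop hij.symm a)) = u ⬝ᵥ u :=
    Equiv.sum_comp (dropDrop hij.symm) fun b => u b * u b
  rw [h, ins_dotProduct_ins, ins_dotProduct_ins, hsum]
  ring

end reindex

section moments

variable {n : ℕ}

/-- The integral of `(1 + |z|² / m)^{-p} K(γᵀz)` over the orthant above `lam`. -/
def tailInt (m p : ℝ) (γ lam : Fin n → ℝ) (K : ℝ → ℝ) : ℝ :=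
  ∫ z in orthant lam, tPow m 1 p z * K (γ ⬝ᵥ z)

/-- The integral of `(1 + |z|² / m)^{-p} K(γᵀz)` over the face `z_k = lam_k` of the orthant. -/
def faceInt (m p : ℝ) (γ lam : Fin n → ℝ) (k : Fin n) (K : ℝ → ℝ) : ℝ :=
  ∫ w in orthant (drop1 k lam), tPow m 1 p (insert1 k lam w) * K (γ ⬝ᵥ insert1 k lam w)

/-- The integral of `(1 + |z|² / m)^{-p} K(γᵀz)` over the edge `z_i = lam_i`, `z_j = lam_j`. -/
def edgeInt (m p : ℝ) (γ lam : Fin n → ℝ) (i j : Fin n) (K : ℝ → ℝ) : ℝ :=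
  ∫ u in orthant (drop2 i j lam), tPow m 1 p (insert2 i j lam u) * K (γ ⬝ᵥ insert2 i j lam u)

variable {m p : ℝ} {γ lam : Fin n → ℝ} {K K' : ℝ → ℝ}

theorem faceInt_eq_ins (m p : ℝ) (γ lam : Fin n → ℝ) (k : Fin n) (K : ℝ → ℝ) :
    faceInt m p γ lam k K = ∫ w in orthant (del k lam),
      tPow m 1 p (ins k w (lam k)) * K (γ ⬝ᵥ ins k w (lam k)) := by
  rw [faceInt]
  simp only [insert1_eq_ins]
  rfl

theorem edgeInt_eq_ins_ins (m p : ℝ) (γ lam : Fin n → ℝ) {i j : Fin n} (hij : j ≠ i)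
    (K : ℝ → ℝ) :
    edgeInt m p γ lam i j K = ∫ x in orthant (del (⟨j, hij⟩ : {l // l ≠ i}) (del i lam)),
      tPow m 1 p (ins i (ins ⟨j, hij⟩ x (lam j)) (lam i)) *
        K (γ ⬝ᵥ ins i (ins ⟨j, hij⟩ x (lam j)) (lam i)) := by
  rw [edgeInt, setIntegral_orthant_reindex (dropDrop hij)]
  simp only [insert2_dropDrop]
  rfl

theorem tailInt_coord (hm : 0 < m) (hp : 0 < p) (hK : ∀ x, HasDerivAt K (K' x) x)
    (hKb : SeqBounded K) (k : Fin n)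
    (hint : IntegrableOn (fun z => z k * tPow m 1 (p + 1) z * K (γ ⬝ᵥ z)) (orthant lam))
    (hint' : IntegrableOn (fun z => tPow m 1 p z * K' (γ ⬝ᵥ z)) (orthant lam)) :
    2 * p / m * ∫ z in orthant lam, z k * tPow m 1 (p + 1) z * K (γ ⬝ᵥ z) =
      faceInt m p γ lam k K + γ k * tailInt m p γ lam K' := by
  rw [faceInt_eq_ins, tailInt]
  simpa using setIntegral_orthant_coord_mul_tPow hm one_pos hp hK hKb γ 0 k lam
    (by simpa using hint) (by simpa using hint')

theorem faceInt_coord (hm : 0 < m) (hp : 0 < p) (hK : ∀ x, HasDerivAt K (K' x) x)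
    (hKb : SeqBounded K) {i j : Fin n} (hij : j ≠ i)
    (hint : IntegrableOn (fun w => w ⟨j, hij⟩ * tPow m 1 (p + 1) (ins i w (lam i)) *
      K (γ ⬝ᵥ ins i w (lam i))) (orthant (del i lam)))
    (hint' : IntegrableOn (fun w => tPow m 1 p (ins i w (lam i)) * K' (γ ⬝ᵥ ins i w (lam i)))
      (orthant (del i lam))) :
    2 * p / m * ∫ w in orthant (del i lam), w ⟨j, hij⟩ * tPow m 1 (p + 1) (ins i w (lam i)) *
        K (γ ⬝ᵥ ins i w (lam i)) =
      edgeInt m p γ lam i j K + γ j * faceInt m p γ lam i K' := by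
  have hdot : ∀ w, γ ⬝ᵥ ins i w (lam i) = γ i * lam i + del i γ ⬝ᵥ w := fun w => by
    rw [dotProduct_ins, add_comm]
  rw [edgeInt_eq_ins_ins _ _ _ _ hij, faceInt_eq_ins]
  simp only [tPow_ins _ i, hdot] at hint hint' ⊢
  exact setIntegral_orthant_coord_mul_tPow hm (by positivity) hp hK hKb (del i γ) _ ⟨j, hij⟩
    (del i lam) hint hint'

/-- A bounded `C²` function together with its first two derivatives. -/
structure BddTwiceDiff (H H' H'' : ℝ → ℝ) (B : ℝ) : Prop where
  bdd : ∀ x, |H x| ≤ B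
  deriv : ∀ x, HasDerivAt H (H' x) x
  deriv' : ∀ x, HasDerivAt H' (H'' x) x
  cont : Continuous H''

/-- Integrability of the terms containing `H'` or `H''` that the first two moments of
`(1 + |z|² / m)^{-ρ} H(γᵀz)` produce on the orthant above `lam` and on its faces. -/
structure TailIntegrable (m ρ : ℝ) (γ lam : Fin n → ℝ) (H' H'' : ℝ → ℝ) : Prop where
  first : IntegrableOn (fun z => tPow m 1 (ρ - 1) z * H' (γ ⬝ᵥ z)) (orthant lam)
  face : ∀ k, IntegrableOn (fun w => tPow m 1 (ρ - 2) (insert1 k lam w) *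
    H' (γ ⬝ᵥ insert1 k lam w)) (orthant (drop1 k lam))
  second : IntegrableOn (fun z => tPow m 1 (ρ - 2) z * H'' (γ ⬝ᵥ z)) (orthant lam)
  coord : ∀ k, IntegrableOn (fun z => z k * tPow m 1 (ρ - 1) z * H' (γ ⬝ᵥ z)) (orthant lam)

variable {ρ B : ℝ} {H H' H'' : ℝ → ℝ}

theorem BddTwiceDiff.continuous (hH : BddTwiceDiff H H' H'' B) : Continuous H :=
  continuous_iff_continuousAt.2 fun x => (hH.deriv x).continuousAt

theorem BddTwiceDiff.continuous' (hH : BddTwiceDiff H H' H'' B) : Continuous H' :=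
  continuous_iff_continuousAt.2 fun x => (hH.deriv' x).continuousAt

theorem BddTwiceDiff.seqBounded (hH : BddTwiceDiff H H' H'' B) : SeqBounded H :=
  SeqBounded.of_bounded hH.bdd

theorem tailInt_coord_deriv (hm : 0 < m) (hρ : 2 < ρ) (hH : BddTwiceDiff H H' H'' B)
    (hI : TailIntegrable m ρ γ lam H' H'') (k : Fin n) :
    2 * (ρ - 2) / m * ∫ z in orthant lam, z k * tPow m 1 (ρ - 1) z * H' (γ ⬝ᵥ z) =
      faceInt m (ρ - 2) γ lam k H' + γ k * tailInt m (ρ - 2) γ lam H'' := by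
  have e : ρ - 2 + 1 = ρ - 1 := by ring
  have h := tailInt_coord (p := ρ - 2) hm (by linarith) hH.deriv'
    (SeqBounded.deriv hH.bdd hH.deriv) k (by rw [e]; exact hI.coord k) hI.second
  rwa [e] at h

theorem integrable_coord_mul_tPow_ins (hm : 0 < m) (hp : (n : ℝ) < 2 * p)
    (hK : Continuous K) (hB : ∀ x, |K x| ≤ B) (γ : Fin n → ℝ) (i : Fin n) (t : ℝ)
    (j : {l : Fin n // l ≠ i}) :
    Integrable fun w => w j * tPow m 1 p (ins i w t) * K (γ ⬝ᵥ ins i w t) := by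
  have hcard : (Fintype.card {l : Fin n // l ≠ i} : ℝ) + 1 < 2 * p := by
    rw [cast_card_drop1]
    linarith
  have h := integrable_mul_comp_dotProduct hK hB (del i γ) (γ i * t)
    (integrable_coord_mul_tPow hm (by positivity : 0 < 1 + t ^ 2 / m) hcard j)
  simpa only [tPow_ins _ i, dotProduct_ins, add_comm] using h

theorem integrable_coord_mul_coord_mul_tPow_mul (hm : 0 < m) (hp : (n : ℝ) + 2 < 2 * p)
    (hK : Continuous K) (hB : ∀ x, |K x| ≤ B) (γ : Fin n → ℝ) (i j : Fin n) :
    Integrable fun z => z i * z j * tPow m 1 p z * K (γ ⬝ᵥ z) := by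
  simpa using integrable_mul_comp_dotProduct hK hB γ 0
    (integrable_coord_mul_coord_mul_tPow hm one_pos (by rwa [Fintype.card_fin]) i j)

theorem tailInt_coord_mul_coord (hm : 0 < m) (hρ : (n : ℝ) + 2 < 2 * ρ)
    (hH : BddTwiceDiff H H' H'' B) (hI : TailIntegrable m ρ γ lam H' H'') {i j : Fin n}
    (hij : i ≠ j) :
    2 * (ρ - 1) / m * (2 * (ρ - 2) / m) *
        ∫ z in orthant lam, z i * z j * tPow m 1 ρ z * H (γ ⬝ᵥ z) =
      edgeInt m (ρ - 2) γ lam i j H + γ j * faceInt m (ρ - 2) γ lam i H' +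
        γ i * faceInt m (ρ - 2) γ lam j H' + γ i * γ j * tailInt m (ρ - 2) γ lam H'' := by
  have hn' : (2 : ℝ) ≤ n := by exact_mod_cast two_le_of_fin_ne hij
  have hsucc : ρ - 1 + 1 = ρ := by ring
  have hsucc_pred : ρ - 2 + 1 = ρ - 1 := by ring
  have hcomm : ∀ z : Fin n → ℝ, z i * z j = z j * z i := fun z => mul_comm _ _
  have hins : ∀ w t, ins i w t j = w ⟨j, hij.symm⟩ := ins_of_ne hij.symm
  have hint := integrable_coord_mul_coord_mul_tPow_mul hm hρ hH.continuous hH.bdd γ j i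
  have hparts := setIntegral_orthant_mul_coord_mul_tPow (p := ρ - 1) hm one_pos hH.deriv
    hH.seqBounded γ 0 i lam (q := fun z => z j) (q' := fun _ => 0)
    (fun w t => by simpa only [hins] using hasDerivAt_const t _)
    (fun w => by
      simpa only [hins, mul_zero] using (tendsto_tPow_ins hm (by linarith) i w).const_mul _)
    (by simpa [hsucc] using hint.integrableOn) (by simp) (by simpa using hI.coord j)
  simp only [zero_add, zero_mul, integral_zero, add_zero, hins, hsucc] at hparts
  have htail := tailInt_coord_deriv hm (by linarith) hH hI j
  have hface_i := hI.face i
  simp only [insert1_eq_ins] at hface_i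
  have hface := faceInt_coord (p := ρ - 2) (lam := lam) hm (by linarith) hH.deriv hH.seqBounded
    hij.symm (by
      rw [hsucc_pred]
      exact (integrable_coord_mul_tPow_ins hm (by linarith) hH.continuous hH.bdd γ i _ _
        ).integrableOn) hface_i
  rw [hsucc_pred] at hface
  calc _ = 2 * (ρ - 2) / m * (2 * (ρ - 1) / m *
        ∫ z in orthant lam, z j * z i * tPow m 1 ρ z * H (γ ⬝ᵥ z)) := by
        simp only [hcomm]
        ring
    _ = _ := by
        rw [hparts, mul_add, hface, mul_left_comm _ (γ i), htail]
        ring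

theorem tailInt_coord_sq (hm : 0 < m) (hρ : (n : ℝ) + 2 < 2 * ρ) (hn : 2 ≤ n)
    (hH : BddTwiceDiff H H' H'' B) (hI : TailIntegrable m ρ γ lam H' H'') (i : Fin n) :
    2 * (ρ - 1) / m * (2 * (ρ - 2) / m) *
        ∫ z in orthant lam, z i * z i * tPow m 1 ρ z * H (γ ⬝ᵥ z) =
      2 * (ρ - 2) / m * (lam i * faceInt m (ρ - 1) γ lam i H + tailInt m (ρ - 1) γ lam H) +
        γ i * faceInt m (ρ - 2) γ lam i H' + γ i ^ 2 * tailInt m (ρ - 2) γ lam H'' := by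
  have hn' : (2 : ℝ) ≤ n := by exact_mod_cast hn
  have hsucc : ρ - 1 + 1 = ρ := by ring
  have hint := integrable_coord_mul_coord_mul_tPow_mul hm hρ hH.continuous hH.bdd γ i i
  have hint0 : Integrable fun z => tPow m 1 (ρ - 1) z * H (γ ⬝ᵥ z) := by
    simpa using integrable_mul_comp_dotProduct hH.continuous hH.bdd γ 0
      (integrable_tPow (ι := Fin n) hm one_pos (p := ρ - 1) (by rw [Fintype.card_fin]; linarith))
  have hparts := setIntegral_orthant_mul_coord_mul_tPow (p := ρ - 1) hm one_pos hH.deriv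
    hH.seqBounded γ 0 i lam (q := fun z => z i) (q' := fun _ => 1)
    (fun w t => by simpa only [ins_self] using hasDerivAt_id' t)
    (fun w => by simpa only [ins_self] using tendsto_mul_tPow_ins hm one_pos (by linarith) i w)
    (by simpa [hsucc] using hint.integrableOn) (by simpa using hint0.integrableOn)
    (by simpa using hI.coord i)
  simp only [zero_add, one_mul, ins_self, mul_assoc (lam i), integral_const_mul, hsucc] at hparts
  rw [← faceInt_eq_ins] at hparts
  have htail := tailInt_coord_deriv hm (by linarith) hH hI i
  calc _ = 2 * (ρ - 2) / m * (2 * (ρ - 1) / m *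
        ∫ z in orthant lam, z i * z i * tPow m 1 ρ z * H (γ ⬝ᵥ z)) := by ring
    _ = _ := by
        rw [hparts, mul_add, mul_left_comm _ (γ i), htail, tailInt.eq_def m (ρ - 1)]
        ring

theorem tailIntegrable_of_integrableOn (hm : 0 < m) (hρ : (n : ℝ) + 3 < 2 * ρ) (hn : 2 ≤ n)
    (hH : BddTwiceDiff H H' H'' B)
    (hfirst : IntegrableOn (fun z => tPow m 1 (ρ - 1) z * H' (γ ⬝ᵥ z)) (orthant lam))
    (hface : ∀ k, IntegrableOn (fun w => tPow m 1 (ρ - 2) (insert1 k lam w) *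
      H' (γ ⬝ᵥ insert1 k lam w)) (orthant (drop1 k lam)))
    (hsecond : IntegrableOn (fun z => tPow m 1 (ρ - 2) z * H'' (γ ⬝ᵥ z)) (orthant lam)) :
    TailIntegrable m ρ γ lam H' H'' := by
  refine ⟨hfirst, hface, hsecond, fun k => ?_⟩
  have hn' : (2 : ℝ) ≤ n := by exact_mod_cast hn
  have hsucc : ρ - 2 + 1 = ρ - 1 := by ring
  have hface0 : Integrable fun w => tPow m 1 (ρ - 2) (ins k w (lam k)) := by
    simp only [tPow_ins]
    exact integrable_tPow hm (by positivity) (by rw [cast_card_drop1]; linarith)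
  have hfirst0 : Integrable (tPow (ι := Fin n) m 1 (ρ - 1)) :=
    integrable_tPow hm one_pos (by rw [Fintype.card_fin]; linarith)
  have hface_k := hface k
  simp only [insert1_eq_ins] at hface_k
  have h := integrableOn_coord_mul_tPow_mul hm one_pos (p := ρ - 2) (by linarith) hH.deriv'
    hH.cont γ 0 k lam (by rw [hsucc]; exact hfirst0.integrableOn)
    (by simpa only [zero_add, hsucc] using hfirst) (by simpa only [zero_add] using hsecond)
    hface0.integrableOn (by simp only [zero_add]; exact hface_k)
  simpa only [zero_add, hsucc] using h

end moments

/-! ### The moment integrals as Student tail expectations -/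

section translate

variable {n : ℕ} {m : ℝ} {γ lam : Fin n → ℝ}

theorem G1_half_dotProduct {ι : Type*} [Fintype ι] (hm : 0 < m) (h : 2 < m + n) (z : ι → ℝ) :
    G1 n m (1 / 2 * (z ⬝ᵥ z)) = m / (m + n - 2) * tPow m 1 ((m + n) / 2 - 1) z := by
  have hz := dotProduct_self_nonneg z
  rw [G1_eq hm h (by positivity), tPow, show -(m + n - 2) / 2 = -((m + n) / 2 - 1) by ring]
  congr 3
  ring

theorem G2_half_dotProduct {ι : Type*} [Fintype ι] (hm : 0 < m) (h : 4 < m + n) (z : ι → ℝ) :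
    G2 n m (1 / 2 * (z ⬝ᵥ z)) =
      m / (m + n - 2) * (m / (m + n - 4)) * tPow m 1 ((m + n) / 2 - 2) z := by
  have hz := dotProduct_self_nonneg z
  rw [G2_eq hm h (by positivity), tPow, show -(m + n - 4) / 2 = -((m + n) / 2 - 2) by ring]
  congr 3
  ring

theorem cW_pos (hn : 1 ≤ n) (hm : 1 < m) (a : ℝ) : 0 < cW n m a := by
  have hn' : (1 : ℝ) ≤ n := by exact_mod_cast hn
  have : 0 < m := by linarith
  have h2 : 0 < m + n - 2 := by linarith
  have := Real.Gamma_pos_of_pos (half_pos h2)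
  have := Real.Gamma_pos_of_pos (half_pos (by linarith : 0 < m - 1))
  have := Real.pi_pos
  rw [cW_eq hn hm]
  positivity

theorem cV_pos (hn : 1 ≤ n) (hm : 3 < m) (a : ℝ) : 0 < cV n m a := by
  have hn' : (1 : ℝ) ≤ n := by exact_mod_cast hn
  have : 0 < m := by linarith
  have h2 : 0 < m + n - 2 := by linarith
  have h4 : 0 < m + n - 4 := by linarith
  have := Real.Gamma_pos_of_pos (half_pos h4)
  have := Real.Gamma_pos_of_pos (half_pos (by linarith : 0 < m - 3))
  have := Real.pi_pos
  rw [cV_eq hn hm]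
  positivity

theorem cU_pos (hn : 2 ≤ n) (hm : 2 < m) (a b : ℝ) : 0 < cU n m a b := by
  have hn' : (2 : ℝ) ≤ n := by exact_mod_cast hn
  have : 0 < m := by linarith
  have h2 : 0 < m + n - 2 := by linarith
  have h4 : 0 < m + n - 4 := by linarith
  have := Real.Gamma_pos_of_pos (half_pos h4)
  have := Real.Gamma_pos_of_pos (half_pos (by linarith : 0 < m - 2))
  have := Real.pi_pos
  rw [cU_eq hn hm]
  positivity

theorem c1_ne_zero (hm : 2 < m) : c1 n m ≠ 0 := by
  intro h
  have hdiv := c0_div_c1 (n := n) hm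
  rw [h, div_zero] at hdiv
  exact (div_pos (by linarith : 0 < m) (by linarith : 0 < m - 2)).ne hdiv

theorem c2_ne_zero (hm : 4 < m) : c2 n m ≠ 0 := by
  intro h
  have hdiv := c0_div_c2 (n := n) hm
  have h2 : 0 < m - 2 := by linarith
  have h4 : 0 < m - 4 := by linarith
  rw [h, div_zero] at hdiv
  exact (by positivity : 0 < m ^ 2 / ((m - 2) * (m - 4))).ne hdiv

theorem stW_eq_tPow (hm : 1 < m) (k : Fin n) (w : Drop1 k → ℝ) :
    stW m lam k w = cW n m (lam k) * (m / (m + n - 2) *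
      tPow m 1 ((m + n) / 2 - 1) (insert1 k lam w)) := by
  have hn : (1 : ℝ) ≤ n := by exact_mod_cast k.pos
  rw [← fW_eq_stW hm, fW, ← G1_half_dotProduct (by linarith) (by linarith),
    insert1_dotProduct_insert1, mul_add]

theorem stV_eq_tPow (hm : 3 < m) (k : Fin n) (v : Drop1 k → ℝ) :
    stV m lam k v = cV n m (lam k) * (m / (m + n - 2) * (m / (m + n - 4)) *
      tPow m 1 ((m + n) / 2 - 2) (insert1 k lam v)) := by
  have hn : (1 : ℝ) ≤ n := by exact_mod_cast k.pos
  rw [← fV_eq_stV hm, fV, ← G2_half_dotProduct (by linarith) (by linarith),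
    insert1_dotProduct_insert1, mul_add]

theorem stU_eq_tPow (hm : 2 < m) {i j : Fin n} (hij : i ≠ j) (u : Drop2 i j → ℝ) :
    stU m lam i j u = cU n m (lam i) (lam j) * (m / (m + n - 2) * (m / (m + n - 4)) *
      tPow m 1 ((m + n) / 2 - 2) (insert2 i j lam u)) := by
  have hn : (2 : ℝ) ≤ n := by exact_mod_cast two_le_of_fin_ne hij
  rw [← fU_eq_stU hm lam hij, fU, ← G2_half_dotProduct (by linarith) (by linarith),
    insert2_dotProduct_insert2 hij, mul_add, mul_add]

theorem ellPDF_G1_eq_tPow (hm : 0 < m) (h : 2 < m + n) (z : Fin n → ℝ) :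
    ellPDF 0 1 (G1 n m) z =
      c1 n m * (m / (m + n - 2) * tPow m 1 ((m + n) / 2 - 1) z) := by
  rw [ellPDF_zero_one, Fintype.card_fin, G1_half_dotProduct hm h, c1]

theorem ellPDF_G2_eq_tPow (hm : 0 < m) (h : 4 < m + n) (z : Fin n → ℝ) :
    ellPDF 0 1 (G2 n m) z = c2 n m * (m / (m + n - 2) * (m / (m + n - 4)) *
      tPow m 1 ((m + n) / 2 - 2) z) := by
  rw [ellPDF_zero_one, Fintype.card_fin, G2_half_dotProduct hm h, c2]

theorem one_add_mul_tPow {ι : Type*} [Fintype ι] (hm : 0 < m) (p : ℝ) (z : ι → ℝ) :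
    (1 + z ⬝ᵥ z / m) * tPow m 1 p z = tPow m 1 (p - 1) z := by
  have hpos := tPow_base_pos hm one_pos z
  rw [tPow, tPow, show -(p - 1) = 1 + -p by ring, Real.rpow_add hpos, Real.rpow_one]

theorem tailExp_stW (hm : 1 < m) (k : Fin n) (K : ℝ → ℝ) :
    c0 n m / cW n m (lam k) *
        tailExp (stW m lam k) (drop1 k lam) (fun w => K (γ ⬝ᵥ insert1 k lam w)) =
      c0 n m * (m / (m + n - 2)) * faceInt m ((m + n) / 2 - 1) γ lam k K := by
  have hc := (cW_pos k.pos hm (lam k)).ne'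
  rw [tailExp, faceInt, ← integral_const_mul, ← integral_const_mul]
  congr 1
  funext w
  rw [stW_eq_tPow hm]
  field_simp

theorem tailExp_stV (hm : 3 < m) (k : Fin n) (K : ℝ → ℝ) :
    c0 n m / cV n m (lam k) *
        tailExp (stV m lam k) (drop1 k lam) (fun v => K (γ ⬝ᵥ insert1 k lam v)) =
      c0 n m * (m / (m + n - 2) * (m / (m + n - 4))) *
        faceInt m ((m + n) / 2 - 2) γ lam k K := by
  have hc := (cV_pos k.pos hm (lam k)).ne'
  rw [tailExp, faceInt, ← integral_const_mul, ← integral_const_mul]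
  congr 1
  funext v
  rw [stV_eq_tPow hm]
  field_simp

theorem tailExp_stU (hm : 2 < m) {i j : Fin n} (hij : i ≠ j) (K : ℝ → ℝ) :
    c0 n m / cU n m (lam i) (lam j) *
        tailExp (stU m lam i j) (drop2 i j lam) (fun u => K (γ ⬝ᵥ insert2 i j lam u)) =
      c0 n m * (m / (m + n - 2) * (m / (m + n - 4))) *
        edgeInt m ((m + n) / 2 - 2) γ lam i j K := by
  have hc := (cU_pos (two_le_of_fin_ne hij) hm (lam i) (lam j)).ne'
  rw [tailExp, edgeInt, ← integral_const_mul, ← integral_const_mul]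
  congr 1
  funext u
  rw [stU_eq_tPow hm hij]
  field_simp

theorem tailExp_ellPDF_G2 (hm : 4 < m) (K : ℝ → ℝ) :
    m ^ 2 / ((m - 2) * (m - 4)) * tailExp (ellPDF 0 1 (G2 n m)) lam (fun x => K (γ ⬝ᵥ x)) =
      c0 n m * (m / (m + n - 2) * (m / (m + n - 4))) *
        tailInt m ((m + n) / 2 - 2) γ lam K := by
  have : (0 : ℝ) ≤ n := n.cast_nonneg
  have hc := c2_ne_zero (n := n) hm
  rw [← c0_div_c2 (n := n) hm, tailExp, tailInt, ← integral_const_mul, ← integral_const_mul]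
  congr 1
  funext x
  rw [ellPDF_G2_eq_tPow (by linarith) (by linarith)]
  field_simp

theorem tailFn_gsePDF_G1 (hm : 2 < m) (K : ℝ → ℝ) :
    m / (m - 2) * tailFn (gsePDF 0 1 (G1 n m) (fun z => K (γ ⬝ᵥ z))) lam =
      2 * c0 n m * (m / (m + n - 2)) * tailInt m ((m + n) / 2 - 1) γ lam K := by
  have : (0 : ℝ) ≤ n := n.cast_nonneg
  have hc := c1_ne_zero (n := n) hm
  rw [← c0_div_c1 (n := n) hm, tailFn, tailInt, ← integral_const_mul, ← integral_const_mul]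
  congr 1
  funext z
  rw [gsePDF, ellPDF_G1_eq_tPow (by linarith) (by linarith), msqrt_one, inv_one, one_mulVec,
    sub_zero]
  field_simp

theorem one_add_mul_stPDF (hm : 0 < m) (z : Fin n → ℝ) :
    (1 + z ⬝ᵥ z / m) * stPDF 0 1 m z = c0 n m * tPow m 1 ((m + n) / 2 - 1) z := by
  rw [stPDF_zero_one (Fintype.card_fin n) hm, ← one_add_mul_tPow hm]
  ring

theorem tailExp_stPDF (hm : 0 < m) (K : ℝ → ℝ) :
    tailExp (stPDF 0 1 m) lam (fun z => (1 + z ⬝ᵥ z / m) * K (γ ⬝ᵥ z)) =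
      c0 n m * tailInt m ((m + n) / 2 - 1) γ lam K := by
  rw [tailExp, tailInt, ← integral_const_mul]
  congr 1
  funext z
  rw [mul_right_comm, one_add_mul_stPDF hm, mul_assoc]

variable {H H' H'' : ℝ → ℝ} {B : ℝ}

theorem hasTailExp_stPDF_iff (hm : 0 < m) (K : ℝ → ℝ) :
    HasTailExp (stPDF 0 1 m) lam (fun z => (1 + z ⬝ᵥ z / m) * K (γ ⬝ᵥ z)) ↔
      IntegrableOn (fun z => tPow m 1 ((m + n) / 2 - 1) z * K (γ ⬝ᵥ z)) (orthant lam) := by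
  have hfun : (fun z : Fin n → ℝ => (1 + z ⬝ᵥ z / m) * K (γ ⬝ᵥ z) * stPDF 0 1 m z) =
      fun z => c0 n m * (tPow m 1 ((m + n) / 2 - 1) z * K (γ ⬝ᵥ z)) := by
    funext z
    rw [mul_right_comm, one_add_mul_stPDF hm, mul_assoc]
  rw [HasTailExp, hfun]
  exact integrable_const_mul_iff (c0_pos hm).ne'.isUnit _

theorem tailIntegrable_of_hasTailExp (hm : 4 < m) (hn : 2 ≤ n) (hH : BddTwiceDiff H H' H'' B)
    (hfirst : HasTailExp (stPDF 0 1 m) lam (fun z => (1 + z ⬝ᵥ z / m) * H' (γ ⬝ᵥ z)))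
    (hface : ∀ k, HasTailExp (stV m lam k) (drop1 k lam) (fun v => H' (γ ⬝ᵥ insert1 k lam v)))
    (hsecond : HasTailExp (ellPDF 0 1 (G2 n m)) lam (fun x => H'' (γ ⬝ᵥ x))) :
    TailIntegrable m ((m + n) / 2) γ lam H' H'' := by
  have hn' : (2 : ℝ) ≤ n := by exact_mod_cast hn
  have hm0 : 0 < m := by linarith
  have hm3 : 3 < m := by linarith
  have hmn : 4 < m + n := by linarith
  have hn2 : 0 < m + n - 2 := by linarith
  have hn4 : 0 < m + n - 4 := by linarith
  refine tailIntegrable_of_integrableOn hm0 (by linarith) hn hH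
    ((hasTailExp_stPDF_iff hm0 H').1 hfirst) (fun k => ?_) ?_
  · have hc := cV_pos k.pos hm3 (lam k)
    refine ((hface k).const_mul (cV n m (lam k) * (m / (m + n - 2) * (m / (m + n - 4))))⁻¹).congr
      (Eventually.of_forall fun v => ?_)
    simp only [stV_eq_tPow hm3]
    field_simp
  · have hc := c2_ne_zero (n := n) hm
    refine (hsecond.const_mul (c2 n m * (m / (m + n - 2) * (m / (m + n - 4))))⁻¹).congr
      (Eventually.of_forall fun x => ?_)
    simp only [ellPDF_G2_eq_tPow hm0 hmn]
    field_simp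

end translate

section tailMoments

variable {S : Type*} [MeasurableSpace S] {P : Measure S} {n : ℕ} {m B : ℝ}
  {γ lam : Fin n → ℝ} {H H' H'' : ℝ → ℝ} {Z : S → Fin n → ℝ}

theorem setIntegral_mul_gsstPDF (hm : 0 < m) (φ : (Fin n → ℝ) → ℝ) :
    ∫ z in orthant lam, φ z * gsstPDF 0 1 γ m H z =
      2 * c0 n m * ∫ z in orthant lam, φ z * tPow m 1 ((m + n) / 2) z * H (γ ⬝ᵥ z) := by
  rw [← integral_const_mul]
  congr 1
  funext z
  rw [gsstPDF_zero_one, stPDF_zero_one (Fintype.card_fin n) hm]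
  ring

theorem MTCE_eq (hm : 1 < m) (hH : ∀ x, HasDerivAt H (H' x) x) (hHB : ∀ x, |H x| ≤ B)
    (hH0 : ∀ x, 0 ≤ H x)
    (hI : IntegrableOn (fun z => tPow m 1 ((m + n) / 2 - 1) z * H' (γ ⬝ᵥ z)) (orthant lam))
    (hZ : HasDensity P Z (gsstPDF 0 1 γ m H)) (k : Fin n) :
    MTCE P Z lam k = 1 / tailFn (gsstPDF 0 1 γ m H) lam * (2 * c0 n m * (m / (m + n - 2)) *
      (faceInt m ((m + n) / 2 - 1) γ lam k H + γ k * tailInt m ((m + n) / 2 - 1) γ lam H')) := by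
  have hn : (1 : ℝ) ≤ n := by exact_mod_cast k.pos
  have hm0 : 0 < m := by linarith
  have h2 : 0 < m + n - 2 := by linarith
  have hsucc : (m + n) / 2 - 1 + 1 = (m + n) / 2 := by ring
  have hcoeff : 2 * ((m + n) / 2 - 1) / m = (m + n - 2) / m := by ring
  have hcont : Continuous H := continuous_iff_continuousAt.2 fun x => (hH x).continuousAt
  have hint : Integrable fun z => z k * tPow m 1 ((m + n) / 2) z * H (γ ⬝ᵥ z) := by
    simpa only [zero_add] using integrable_mul_comp_dotProduct hcont hHB γ 0
      (integrable_coord_mul_tPow hm0 one_pos (by rw [Fintype.card_fin]; linarith) k)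
  have hparts := tailInt_coord hm0 (by linarith) hH (SeqBounded.of_bounded hHB) k
    (by rw [hsucc]; exact hint.integrableOn) hI
  rw [hsucc, hcoeff] at hparts
  rw [MTCE, condMean, hZ.integral_cond (measurable_gsstPDF_zero_one hm0 hcont.measurable)
    (gsstPDF_zero_one_nonneg hm0 hH0) lam (φ := fun z => z k) (by fun_prop),
    setIntegral_mul_gsstPDF hm0, ← hparts]
  field_simp

theorem MTCov_eq_sub [IsFiniteMeasure P] (hm : 2 < m) (hH : Measurable H) (hHB : ∀ x, H x ≤ B)
    (hH0 : ∀ x, 0 ≤ H x) (hZ : HasDensity P Z (gsstPDF 0 1 γ m H))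
    (hpos : 0 < tailFn (gsstPDF 0 1 γ m H) lam) (i j : Fin n) :
    MTCov P Z lam i j = 1 / tailFn (gsstPDF 0 1 γ m H) lam * (2 * c0 n m *
      ∫ z in orthant lam, z i * z j * tPow m 1 ((m + n) / 2) z * H (γ ⬝ᵥ z)) -
        MTCE P Z lam i * MTCE P Z lam j := by
  have hm0 : 0 < m := by linarith
  have hmeas := measurable_gsstPDF_zero_one (γ := γ) hm0 hH
  have hnonneg := gsstPDF_zero_one_nonneg (γ := γ) hm0 hH0
  rw [MTCov, condCov_apply_eq_sub (hZ.measure_tail_ne_zero hmeas hnonneg hpos)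
    (memLp_two_of_hasDensity hm hH hH0 hHB hZ),
    hZ.integral_cond hmeas hnonneg lam (φ := fun z => z i * z j) (by fun_prop),
    setIntegral_mul_gsstPDF hm0]
  rfl

section

variable [IsFiniteMeasure P] (hm : 2 < m) (hH : BddTwiceDiff H H' H'' B) (hH0 : ∀ x, 0 ≤ H x)
  (hI : TailIntegrable m ((m + n) / 2) γ lam H' H'') (hZ : HasDensity P Z (gsstPDF 0 1 γ m H))
  (hpos : 0 < tailFn (gsstPDF 0 1 γ m H) lam)
include hm hH hH0 hI hZ hpos

theorem MTCov_eq_of_ne {i j : Fin n} (hij : i ≠ j) :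
    MTCov P Z lam i j = 2 / tailFn (gsstPDF 0 1 γ m H) lam *
      (c0 n m * (m / (m + n - 2) * (m / (m + n - 4))) *
        (edgeInt m ((m + n) / 2 - 2) γ lam i j H +
        γ j * faceInt m ((m + n) / 2 - 2) γ lam i H' +
        γ i * faceInt m ((m + n) / 2 - 2) γ lam j H' +
        γ i * γ j * tailInt m ((m + n) / 2 - 2) γ lam H'')) -
        MTCE P Z lam i * MTCE P Z lam j := by
  have hn : (2 : ℝ) ≤ n := by exact_mod_cast two_le_of_fin_ne hij
  have h2 : 0 < m + n - 2 := by linarith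
  have h4 : 0 < m + n - 4 := by linarith
  have hcoeff1 : 2 * ((m + n) / 2 - 1) / m = (m + n - 2) / m := by ring
  have hcoeff2 : 2 * ((m + n) / 2 - 2) / m = (m + n - 4) / m := by ring
  rw [MTCov_eq_sub hm hH.continuous.measurable (fun x => (le_abs_self _).trans (hH.bdd x)) hH0 hZ
    hpos, ← tailInt_coord_mul_coord (by linarith) (by linarith) hH hI hij,
    hcoeff1, hcoeff2]
  field_simp

theorem MTCov_eq_self (hn : 2 ≤ n) (i : Fin n) :
    MTCov P Z lam i i = 2 / tailFn (gsstPDF 0 1 γ m H) lam *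
      (c0 n m * (m / (m + n - 2)) * (lam i * faceInt m ((m + n) / 2 - 1) γ lam i H) +
        c0 n m * (m / (m + n - 2) * (m / (m + n - 4))) *
        (γ i * faceInt m ((m + n) / 2 - 2) γ lam i H' +
        γ i ^ 2 * tailInt m ((m + n) / 2 - 2) γ lam H'')) +
      2 * c0 n m * (m / (m + n - 2)) * tailInt m ((m + n) / 2 - 1) γ lam H /
        tailFn (gsstPDF 0 1 γ m H) lam - MTCE P Z lam i ^ 2 := by
  have hn' : (2 : ℝ) ≤ n := by exact_mod_cast hn
  have hm0 : 0 < m := by linarith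
  have h2 : 0 < m + n - 2 := by linarith
  have h4 : 0 < m + n - 4 := by linarith
  have hcoeff1 : 2 * ((m + n) / 2 - 1) / m = (m + n - 2) / m := by ring
  have hcoeff2 : 2 * ((m + n) / 2 - 2) / m = (m + n - 4) / m := by ring
  have hsq := tailInt_coord_sq hm0 (by linarith) hn hH hI i
  rw [hcoeff1, hcoeff2] at hsq
  have hmoment : ∫ z in orthant lam, z i * z i * tPow m 1 ((m + n) / 2) z * H (γ ⬝ᵥ z) =
      m / (m + n - 2) * (m / (m + n - 4)) * ((m + n - 4) / m *
        (lam i * faceInt m ((m + n) / 2 - 1) γ lam i H + tailInt m ((m + n) / 2 - 1) γ lam H) +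
        γ i * faceInt m ((m + n) / 2 - 2) γ lam i H' +
        γ i ^ 2 * tailInt m ((m + n) / 2 - 2) γ lam H'') := by
    rw [← hsq]
    field_simp
  rw [MTCov_eq_sub hm hH.continuous.measurable (fun x => (le_abs_self _).trans (hH.bdd x)) hH0 hZ
    hpos, hmoment, ← sq]
  field_simp
  ring

end

theorem MTCE_eq_tailExp (hm : 1 < m) (hH : ∀ x, HasDerivAt H (H' x) x) (hHB : ∀ x, |H x| ≤ B)
    (hH0 : ∀ x, 0 ≤ H x)
    (hI : IntegrableOn (fun z => tPow m 1 ((m + n) / 2 - 1) z * H' (γ ⬝ᵥ z)) (orthant lam))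
    (hZ : HasDensity P Z (gsstPDF 0 1 γ m H)) (k : Fin n) :
    MTCE P Z lam k = 1 / tailFn (gsstPDF 0 1 γ m H) lam *
      (2 * (c0 n m / cW n m (lam k)) *
          tailExp (stW m lam k) (drop1 k lam) (fun w => H (γ ⬝ᵥ insert1 k lam w)) +
        2 * m * γ k / (m + n - 2) *
          tailExp (stPDF 0 1 m) lam (fun z => (1 + z ⬝ᵥ z / m) * H' (γ ⬝ᵥ z))) := by
  rw [MTCE_eq hm hH hHB hH0 hI hZ k, mul_assoc 2 (c0 n m / _), tailExp_stW hm,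
    tailExp_stPDF (by linarith)]
  ring

section

variable [IsFiniteMeasure P] (hm : 4 < m) (hH : BddTwiceDiff H H' H'' B) (hH0 : ∀ x, 0 ≤ H x)
  (hI : TailIntegrable m ((m + n) / 2) γ lam H' H'') (hZ : HasDensity P Z (gsstPDF 0 1 γ m H))
  (hpos : 0 < tailFn (gsstPDF 0 1 γ m H) lam)
include hm hH hH0 hI hZ hpos

theorem MTCov_eq_tailExp_of_ne {i j : Fin n} (hij : i ≠ j) :
    MTCov P Z lam i j = 2 / tailFn (gsstPDF 0 1 γ m H) lam *
      (c0 n m / cU n m (lam i) (lam j) *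
          tailExp (stU m lam i j) (drop2 i j lam) (fun u => H (γ ⬝ᵥ insert2 i j lam u)) +
        c0 n m / cV n m (lam i) * γ j *
          tailExp (stV m lam i) (drop1 i lam) (fun v => H' (γ ⬝ᵥ insert1 i lam v)) +
        c0 n m / cV n m (lam j) * γ i *
          tailExp (stV m lam j) (drop1 j lam) (fun v => H' (γ ⬝ᵥ insert1 j lam v)) +
        m ^ 2 / ((m - 2) * (m - 4)) * γ i * γ j *
          tailExp (ellPDF 0 1 (G2 n m)) lam (fun x => H'' (γ ⬝ᵥ x))) -
      MTCE P Z lam i * MTCE P Z lam j := by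
  have hm2 : 2 < m := by linarith
  have hm3 : 3 < m := by linarith
  rw [MTCov_eq_of_ne hm2 hH hH0 hI hZ hpos hij]
  linear_combination (-2 / tailFn (gsstPDF 0 1 γ m H) lam) *
    (tailExp_stU (γ := γ) (lam := lam) hm2 hij H +
      γ j * tailExp_stV (γ := γ) (lam := lam) hm3 i H' +
      γ i * tailExp_stV (γ := γ) (lam := lam) hm3 j H' +
      γ i * γ j * tailExp_ellPDF_G2 (γ := γ) (lam := lam) hm H'')

theorem MTCov_eq_tailExp_self (hn : 2 ≤ n) (i : Fin n) :
    MTCov P Z lam i i = 2 / tailFn (gsstPDF 0 1 γ m H) lam *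
      (c0 n m / cW n m (lam i) * lam i *
          tailExp (stW m lam i) (drop1 i lam) (fun w => H (γ ⬝ᵥ insert1 i lam w)) +
        c0 n m / cV n m (lam i) * γ i *
          tailExp (stV m lam i) (drop1 i lam) (fun v => H' (γ ⬝ᵥ insert1 i lam v)) +
        m ^ 2 / ((m - 2) * (m - 4)) * γ i ^ 2 *
          tailExp (ellPDF 0 1 (G2 n m)) lam (fun x => H'' (γ ⬝ᵥ x))) +
      m / (m - 2) * (tailFn (gsePDF 0 1 (G1 n m) (fun z => H (γ ⬝ᵥ z))) lam /
        tailFn (gsstPDF 0 1 γ m H) lam) -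
      MTCE P Z lam i ^ 2 := by
  have hm1 : 1 < m := by linarith
  have hm2 : 2 < m := by linarith
  have hm3 : 3 < m := by linarith
  rw [MTCov_eq_self hm2 hH hH0 hI hZ hpos hn]
  linear_combination (-1 / tailFn (gsstPDF 0 1 γ m H) lam) *
    (2 * lam i * tailExp_stW (γ := γ) (lam := lam) hm1 i H +
      2 * γ i * tailExp_stV (γ := γ) (lam := lam) hm3 i H' +
      2 * γ i ^ 2 * tailExp_ellPDF_G2 (γ := γ) (lam := lam) hm H'' +
      tailFn_gsePDF_G1 (γ := γ) (lam := lam) hm2 H)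

end

end tailMoments

/-! ### Skewing by the Student distribution function -/

section student

variable {m : ℝ}

theorem tPDF_base_pos (hm : 0 < m) (x : ℝ) : 0 < 1 + x ^ 2 / m := by positivity

theorem tPDF_pos (hm : 0 < m) (x : ℝ) : 0 < tPDF m x := by
  have := Real.Gamma_pos_of_pos (half_pos hm)
  have := Real.Gamma_pos_of_pos (half_pos (by linarith : 0 < m + 1))
  have := Real.pi_pos
  have := tPDF_base_pos hm x
  unfold tPDF
  positivity

theorem hasDerivAt_tPDF (hm : 0 < m) (x : ℝ) :
    HasDerivAt (tPDF m) (-(m + 1) / m * ((1 + x ^ 2 / m)⁻¹ * x * tPDF m x)) x := by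
  have hbase : HasDerivAt (fun x : ℝ => 1 + x ^ 2 / m) (2 * x / m) x := by
    simpa using (((hasDerivAt_id x).pow 2).div_const m).const_add 1
  have hpos := tPDF_base_pos hm x
  refine ((hbase.rpow_const (p := -(m + 1) / 2) (Or.inl hpos.ne')).const_mul
    (Real.Gamma ((m + 1) / 2) / (Real.Gamma (m / 2) * √(m * Real.pi)))).congr_deriv ?_
  rw [tPDF, Real.rpow_sub hpos, Real.rpow_one]
  ring

theorem continuous_tPDF (hm : 0 < m) : Continuous (tPDF m) :=
  continuous_iff_continuousAt.2 fun x => (hasDerivAt_tPDF hm x).continuousAt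

theorem tPDF_le (hm : 0 < m) (x : ℝ) : tPDF m x ≤ tPDF m 0 := by
  have := Real.Gamma_pos_of_pos (half_pos hm)
  have := Real.Gamma_pos_of_pos (half_pos (by linarith : 0 < m + 1))
  have hx : 0 ≤ x ^ 2 / m := by positivity
  unfold tPDF
  refine mul_le_mul_of_nonneg_left ?_ (by positivity)
  refine Real.rpow_le_rpow_of_nonpos (by simp) ?_ (by linarith)
  simpa using hx

theorem abs_tPDF_le (hm : 0 < m) (x : ℝ) : |tPDF m x| ≤ tPDF m 0 := by
  rw [abs_of_pos (tPDF_pos hm x)]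
  exact tPDF_le hm x

theorem integrable_tPDF (hm : 0 < m) : Integrable (tPDF m) := by
  have h := integrable_rpow_neg_one_add_norm_sq (E := ℝ) (μ := volume) (r := m + 1)
    (by simpa using hm)
  have hscaled := (h.comp_div (Real.sqrt_pos.2 hm).ne').const_mul
    (Real.Gamma ((m + 1) / 2) / (Real.Gamma (m / 2) * √(m * Real.pi)))
  refine hscaled.congr (Eventually.of_forall fun x => ?_)
  simp only [tPDF, norm_div, Real.norm_eq_abs, div_pow, sq_abs, Real.sq_sqrt hm.le]

theorem hasDerivAt_tCDF (hm : 0 < m) (x : ℝ) : HasDerivAt (tCDF m) (tPDF m x) x := by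
  have hint := integrable_tPDF hm
  have e : tCDF m = fun x => tCDF m 0 + ∫ s in (0 : ℝ)..x, tPDF m s := by
    funext y
    rw [tCDF, tCDF, ← intervalIntegral.integral_Iic_sub_Iic hint.integrableOn hint.integrableOn]
    ring
  rw [e]
  exact (intervalIntegral.integral_hasDerivAt_right hint.intervalIntegrable
    (continuous_tPDF hm).aestronglyMeasurable.stronglyMeasurableAtFilter
    (continuous_tPDF hm).continuousAt).const_add _

theorem tCDF_pos (hm : 0 < m) (x : ℝ) : 0 < tCDF m x := by
  rw [tCDF, setIntegral_pos_iff_support_of_nonneg_ae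
    (Eventually.of_forall fun s => (tPDF_pos hm s).le) (integrable_tPDF hm).integrableOn]
  have : Function.support (tPDF m) = Set.univ := by
    ext s
    simpa using (tPDF_pos hm s).ne'
  rw [this, Set.univ_inter]
  simp

theorem tCDF_le (hm : 0 < m) (x : ℝ) : tCDF m x ≤ ∫ s, tPDF m s :=
  setIntegral_le_integral (integrable_tPDF hm)
    (Eventually.of_forall fun s => (tPDF_pos hm s).le)

theorem abs_deriv_tPDF_le (hm : 0 < m) (x : ℝ) :
    |-(m + 1) / m * ((1 + x ^ 2 / m)⁻¹ * x * tPDF m x)| ≤ (m + 1) / m * (m + 1) * tPDF m 0 := by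
  have hpos := tPDF_base_pos hm x
  have hfrac : |(1 + x ^ 2 / m)⁻¹ * x| ≤ m + 1 := by
    rw [abs_mul, abs_of_pos (inv_pos.2 hpos), inv_mul_le_iff₀ hpos]
    have hexpand : (1 + x ^ 2 / m) * (m + 1) = m + 1 + x ^ 2 + x ^ 2 / m := by field_simp; ring
    have hquot : 0 ≤ x ^ 2 / m := by positivity
    rw [hexpand]
    nlinarith [sq_abs x, sq_nonneg (|x| - 1)]
  have habs : |-(m + 1) / m| = (m + 1) / m := by
    rw [neg_div, abs_neg, abs_of_pos (by positivity)]
  rw [abs_mul, abs_mul _ (tPDF m x), habs, abs_of_pos (tPDF_pos hm x), mul_assoc]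
  refine mul_le_mul_of_nonneg_left ?_ (by positivity)
  exact mul_le_mul hfrac (tPDF_le hm x) (tPDF_pos hm x).le (by positivity)

theorem bddTwiceDiff_tCDF (hm : 0 < m) : BddTwiceDiff (tCDF m) (tPDF m)
    (fun x => -(m + 1) / m * ((1 + x ^ 2 / m)⁻¹ * x * tPDF m x)) (∫ s, tPDF m s) where
  bdd x := by rw [abs_of_pos (tCDF_pos hm x)]; exact tCDF_le hm x
  deriv := hasDerivAt_tCDF hm
  deriv' := hasDerivAt_tPDF hm
  cont := by
    have h := continuous_tPDF hm
    have hinv : Continuous fun x : ℝ => (1 + x ^ 2 / m)⁻¹ :=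
      Continuous.inv₀ (by fun_prop) fun x => (tPDF_base_pos hm x).ne'
    fun_prop

theorem tCDF_second_coeff (hm : 4 < m) :
    m ^ 2 / ((m - 2) * (m - 4)) * (-(m + 1) / m) = -((m + 1) * m / ((m - 2) * (m - 4))) := by
  have h2 : m - 2 ≠ 0 := by linarith
  have h4 : m - 4 ≠ 0 := by linarith
  field_simp

end student

section conditions

variable {n : ℕ} {m B : ℝ} {γ lam : Fin n → ℝ} {H H' H'' : ℝ → ℝ}

theorem integrableOn_tPow_mul_comp (hm : 0 < m) {p : ℝ} (hp : n < 2 * p) (hH : Continuous H)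
    (hB : ∀ x, |H x| ≤ B) :
    IntegrableOn (fun z => tPow m 1 p z * H (γ ⬝ᵥ z)) (orthant lam) := by
  have hint := integrable_mul_comp_dotProduct hH hB γ 0
    (integrable_tPow hm one_pos (by rwa [Fintype.card_fin]))
  simpa only [zero_add] using hint.integrableOn

theorem tailIntegrable_of_bounded (hm : 4 < m) (hn : 2 ≤ n) (hH : BddTwiceDiff H H' H'' B)
    {B' B'' : ℝ} (hB' : ∀ x, |H' x| ≤ B') (hB'' : ∀ x, |H'' x| ≤ B'') :
    TailIntegrable m ((m + n) / 2) γ lam H' H'' := by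
  have hm0 : 0 < m := by linarith
  refine tailIntegrable_of_integrableOn hm0 (by linarith) hn hH
    (integrableOn_tPow_mul_comp hm0 (by linarith) hH.continuous' hB') (fun k => ?_)
    (integrableOn_tPow_mul_comp hm0 (by linarith) hH.cont hB'')
  have hb : 0 < 1 + lam k ^ 2 / m := by positivity
  have hp : (Fintype.card (Drop1 k) : ℝ) < 2 * ((m + n) / 2 - 2) := by
    rw [cast_card_drop1]
    linarith
  simp only [insert1_eq_ins, tPow_ins, dotProduct_ins, add_comm (del k γ ⬝ᵥ _)]
  exact (integrable_mul_comp_dotProduct hH.continuous' hB' (del k γ) (γ k * lam k)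
    (integrable_tPow hm0 hb hp)).integrableOn

theorem tailIntegrable_zero {ρ : ℝ} : TailIntegrable m ρ γ lam (fun _ => 0) (fun _ => 0) := by
  constructor <;> simp

theorem bddTwiceDiff_const (c : ℝ) :
    BddTwiceDiff (fun _ => c) (fun _ => 0) (fun _ => 0) |c| where
  bdd _ := le_rfl
  deriv x := hasDerivAt_const x c
  deriv' x := hasDerivAt_const x 0
  cont := continuous_const

theorem IsSkewing.bddTwiceDiff (hH : IsSkewing H) (hC : ContDiff ℝ 2 H) :
    BddTwiceDiff H (deriv H) (deriv (deriv H)) 1 := by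
  have hC' : ContDiff ℝ 1 (deriv H) := ((contDiff_succ_iff_deriv (n := 1)).1 hC).2.2
  exact {
    bdd x := abs_le.2 ⟨by linarith [hH.nonneg x], hH.le_one x⟩
    deriv x := (hC.differentiable two_ne_zero x).hasDerivAt
    deriv' x := (hC'.differentiable one_ne_zero x).hasDerivAt
    cont := hC'.continuous_deriv le_rfl }

theorem isOpen_orthant (t : Fin n → ℝ) : IsOpen (orthant t) := by
  simp only [orthant, Set.ofPred_forall]
  exact isOpen_iInter_of_finite fun i => isOpen_lt continuous_const (continuous_apply i)

theorem tailFn_gsstPDF_pos (hm : 0 < m) (hH : Continuous H) (hB : ∀ x, |H x| ≤ B)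
    (hH0 : ∀ x, 0 < H x) : 0 < tailFn (gsstPDF 0 1 γ m H) lam := by
  have hpos : ∀ z : Fin n → ℝ, 0 < gsstPDF 0 1 γ m H z := fun z => by
    have := stPDF_zero_one_pos hm z
    have := hH0 (γ ⬝ᵥ z)
    rw [gsstPDF_zero_one]
    positivity
  have hint : IntegrableOn (gsstPDF 0 1 γ m H) (orthant lam) := by
    have htPow := integrableOn_tPow_mul_comp (γ := γ) (lam := lam) (p := (m + n) / 2) hm
      (by linarith) hH hB
    refine (htPow.const_mul (2 * c0 n m)).congr (Eventually.of_forall fun z => ?_)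
    simp only [gsstPDF_zero_one, stPDF_zero_one (Fintype.card_fin n) hm, mul_assoc]
  have hsupp : Function.support (gsstPDF 0 1 γ m H) = Set.univ :=
    Set.eq_univ_of_forall fun z => (hpos z).ne'
  rw [tailFn, setIntegral_pos_iff_support_of_nonneg_ae
    (Eventually.of_forall fun z => (hpos z).le) hint, hsupp, Set.univ_inter]
  exact (isOpen_orthant lam).measure_pos _ ⟨fun i => lam i + 1, fun i => lt_add_one (lam i)⟩

end conditions

section studentMoments

variable {S : Type*} [MeasurableSpace S] {P : Measure S} {n : ℕ} {m : ℝ} {γ lam : Fin n → ℝ}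
  {Z : S → Fin n → ℝ}

theorem tailExp_const_mul {ι : Type*} [Fintype ι] (f : (ι → ℝ) → ℝ) (t : ι → ℝ) (c : ℝ)
    (h : (ι → ℝ) → ℝ) : tailExp f t (fun x => c * h x) = c * tailExp f t h := by
  simp only [tailExp, mul_assoc, integral_const_mul]

theorem MTCE_tCDF (hm : 2 < m) (hZ : HasDensity P Z (gsstPDF 0 1 γ m (tCDF m))) (k : Fin n) :
    MTCE P Z lam k = 1 / tailFn (gsstPDF 0 1 γ m (tCDF m)) lam *
      (2 * (c0 n m / cW n m (lam k)) *
          tailExp (stW m lam k) (drop1 k lam) (fun w => tCDF m (γ ⬝ᵥ insert1 k lam w)) +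
        2 * m * γ k / (m + n - 2) *
          tailExp (stPDF 0 1 m) lam (fun z => (1 + z ⬝ᵥ z / m) * tPDF m (γ ⬝ᵥ z))) := by
  have hm0 : 0 < m := by linarith
  exact MTCE_eq_tailExp (by linarith) (hasDerivAt_tCDF hm0) (bddTwiceDiff_tCDF hm0).bdd
    (fun x => (tCDF_pos hm0 x).le) (integrableOn_tPow_mul_comp hm0 (by linarith)
      (continuous_tPDF hm0) (abs_tPDF_le hm0)) hZ k

section

variable [IsFiniteMeasure P] (hm : 4 < m) (hZ : HasDensity P Z (gsstPDF 0 1 γ m (tCDF m)))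
include hm hZ

theorem MTCov_tCDF_of_ne {i j : Fin n} (hij : i ≠ j) :
    MTCov P Z lam i j = 2 / tailFn (gsstPDF 0 1 γ m (tCDF m)) lam *
      (c0 n m / cU n m (lam i) (lam j) *
          tailExp (stU m lam i j) (drop2 i j lam) (fun u => tCDF m (γ ⬝ᵥ insert2 i j lam u)) +
        c0 n m / cV n m (lam i) * γ j *
          tailExp (stV m lam i) (drop1 i lam) (fun v => tPDF m (γ ⬝ᵥ insert1 i lam v)) -
        (m + 1) * m / ((m - 2) * (m - 4)) * γ i * γ j *
          tailExp (ellPDF 0 1 (G2 n m)) lam (fun x =>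
            (1 + (γ ⬝ᵥ x) ^ 2 / m)⁻¹ * (γ ⬝ᵥ x) * tPDF m (γ ⬝ᵥ x)) +
        c0 n m / cV n m (lam j) * γ i *
          tailExp (stV m lam j) (drop1 j lam) (fun v => tPDF m (γ ⬝ᵥ insert1 j lam v))) -
      MTCE P Z lam i * MTCE P Z lam j := by
  have hm0 : 0 < m := by linarith
  have hT := bddTwiceDiff_tCDF hm0
  rw [MTCov_eq_tailExp_of_ne hm hT (fun x => (tCDF_pos hm0 x).le)
    (tailIntegrable_of_bounded hm (two_le_of_fin_ne hij) hT (abs_tPDF_le hm0)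
      (abs_deriv_tPDF_le hm0)) hZ (tailFn_gsstPDF_pos hm0 hT.continuous hT.bdd (tCDF_pos hm0)) hij,
    tailExp_const_mul]
  linear_combination 2 / tailFn (gsstPDF 0 1 γ m (tCDF m)) lam * γ i * γ j *
    tailExp (ellPDF 0 1 (G2 n m)) lam (fun x =>
      (1 + (γ ⬝ᵥ x) ^ 2 / m)⁻¹ * (γ ⬝ᵥ x) * tPDF m (γ ⬝ᵥ x)) * tCDF_second_coeff hm

theorem MTCov_tCDF_self (hn : 2 ≤ n) (i : Fin n) :
    MTCov P Z lam i i = 2 / tailFn (gsstPDF 0 1 γ m (tCDF m)) lam *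
      (c0 n m / cW n m (lam i) * lam i *
          tailExp (stW m lam i) (drop1 i lam) (fun w => tCDF m (γ ⬝ᵥ insert1 i lam w)) +
        c0 n m / cV n m (lam i) * γ i *
          tailExp (stV m lam i) (drop1 i lam) (fun v => tPDF m (γ ⬝ᵥ insert1 i lam v)) -
        (m + 1) * m / ((m - 2) * (m - 4)) * γ i ^ 2 *
          tailExp (ellPDF 0 1 (G2 n m)) lam (fun x =>
            (1 + (γ ⬝ᵥ x) ^ 2 / m)⁻¹ * (γ ⬝ᵥ x) * tPDF m (γ ⬝ᵥ x))) +
      m / (m - 2) * (tailFn (gsePDF 0 1 (G1 n m) (fun z => tCDF m (γ ⬝ᵥ z))) lam /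
        tailFn (gsstPDF 0 1 γ m (tCDF m)) lam) -
      MTCE P Z lam i ^ 2 := by
  have hm0 : 0 < m := by linarith
  have hT := bddTwiceDiff_tCDF hm0
  rw [MTCov_eq_tailExp_self hm hT (fun x => (tCDF_pos hm0 x).le)
    (tailIntegrable_of_bounded hm hn hT (abs_tPDF_le hm0) (abs_deriv_tPDF_le hm0)) hZ
    (tailFn_gsstPDF_pos hm0 hT.continuous hT.bdd (tCDF_pos hm0)) hn i, tailExp_const_mul]
  linear_combination 2 / tailFn (gsstPDF 0 1 γ m (tCDF m)) lam * γ i ^ 2 *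
    tailExp (ellPDF 0 1 (G2 n m)) lam (fun x =>
      (1 + (γ ⬝ᵥ x) ^ 2 / m)⁻¹ * (γ ⬝ᵥ x) * tPDF m (γ ⬝ᵥ x)) * tCDF_second_coeff hm

end

end studentMoments

/-! ### The symmetric case -/

section symmetric

variable {S : Type*} [MeasurableSpace S] {P : Measure S} {n : ℕ} {m : ℝ} {lam : Fin n → ℝ}
  {Z : S → Fin n → ℝ}

theorem gsstPDF_half (μ γ : Fin n → ℝ) (Sig : Matrix (Fin n) (Fin n) ℝ) (m : ℝ) :
    gsstPDF μ Sig γ m (fun _ => 1 / 2) = stPDF μ Sig m := by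
  funext y
  rw [gsstPDF]
  ring

theorem gsePDF_half (μ : Fin n → ℝ) (Sig : Matrix (Fin n) (Fin n) ℝ) (G : ℝ → ℝ) :
    gsePDF μ Sig G (fun _ => 1 / 2) = ellPDF μ Sig G := by
  funext y
  rw [gsePDF]
  ring

theorem tailExp_const {ι : Type*} [Fintype ι] (f : (ι → ℝ) → ℝ) (t : ι → ℝ) (c : ℝ) :
    tailExp f t (fun _ => c) = c * tailFn f t := by
  rw [tailExp, tailFn, integral_const_mul]

theorem tailFn_stPDF_pos (hm : 0 < m) : 0 < tailFn (stPDF 0 1 m) lam := by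
  have h := bddTwiceDiff_const (1 / 2)
  rw [← gsstPDF_half 0 0]
  exact tailFn_gsstPDF_pos hm h.continuous h.bdd fun _ => one_half_pos

theorem MTCE_stPDF (hm : 1 < m) (hZ : HasDensity P Z (stPDF 0 1 m)) (k : Fin n) :
    MTCE P Z lam k = 1 / tailFn (stPDF 0 1 m) lam *
      (c0 n m / cW n m (lam k) * tailFn (stW m lam k) (drop1 k lam)) := by
  have h := bddTwiceDiff_const (1 / 2)
  rw [← gsstPDF_half 0 0] at hZ
  rw [MTCE_eq_tailExp hm h.deriv h.bdd (fun _ => one_half_pos.le) (by simp) hZ k,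
    gsstPDF_half, tailExp_const, Pi.zero_apply]
  ring

section

variable [IsFiniteMeasure P] (hm : 2 < m) (hZ : HasDensity P Z (stPDF 0 1 m))
include hm hZ

theorem MTCov_stPDF_of_ne {i j : Fin n} (hij : i ≠ j) :
    MTCov P Z lam i j = 1 / tailFn (stPDF 0 1 m) lam *
      (c0 n m / cU n m (lam i) (lam j) * tailFn (stU m lam i j) (drop2 i j lam)) -
      MTCE P Z lam i * MTCE P Z lam j := by
  have hpos := tailFn_stPDF_pos (lam := lam) (by linarith : 0 < m)
  have hedge := tailExp_stU (γ := 0) (lam := lam) hm hij fun _ => 1 / 2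
  rw [tailExp_const] at hedge
  rw [← gsstPDF_half 0 0] at hZ hpos
  rw [MTCov_eq_of_ne hm (bddTwiceDiff_const (1 / 2)) (fun _ => one_half_pos.le)
    tailIntegrable_zero hZ hpos hij, gsstPDF_half]
  simp only [Pi.zero_apply, zero_mul, add_zero]
  linear_combination (-2 / tailFn (stPDF 0 1 m) lam) * hedge

theorem MTCov_stPDF_self (hn : 2 ≤ n) (i : Fin n) :
    MTCov P Z lam i i = 1 / tailFn (stPDF 0 1 m) lam *
      (c0 n m / cW n m (lam i) * lam i * tailFn (stW m lam i) (drop1 i lam)) +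
      m / (m - 2) * (tailFn (ellPDF 0 1 (G1 n m)) lam / tailFn (stPDF 0 1 m) lam) -
      MTCE P Z lam i ^ 2 := by
  have hpos := tailFn_stPDF_pos (lam := lam) (by linarith : 0 < m)
  have hface := tailExp_stW (γ := 0) (lam := lam) (by linarith : 1 < m) i fun _ => 1 / 2
  have hbulk := tailFn_gsePDF_G1 (n := n) (γ := 0) (lam := lam) hm fun _ => 1 / 2
  rw [tailExp_const] at hface
  rw [gsePDF_half] at hbulk
  rw [← gsstPDF_half 0 0] at hZ hpos
  rw [MTCov_eq_self hm (bddTwiceDiff_const (1 / 2)) (fun _ => one_half_pos.le)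
    tailIntegrable_zero hZ hpos hn i, gsstPDF_half]
  simp only [Pi.zero_apply, zero_mul, add_zero, zero_pow two_ne_zero]
  linear_combination (-2 * lam i / tailFn (stPDF 0 1 m) lam) * hface -
    (1 / tailFn (stPDF 0 1 m) lam) * hbulk

end

end symmetric

end SkewStudent

end

open SkewStudent in
theorem mainTheorem3 {S : Type*} [MeasurableSpace S] (P : Measure S) [IsProbabilityMeasure P]
    (n : ℕ) (hn : 2 ≤ n) (m : ℝ) (hm : 0 < m)
    (μ γ : Fin n → ℝ) (Sig : Matrix (Fin n) (Fin n) ℝ) (hSig : Sig.PosDef)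
    (Y Z : S → Fin n → ℝ) (hZ : Z = fun s => standardize μ Sig (Y s)) :
    -- the density in generator form, cumulative generators and normalizing constants
    ((∀ H : ℝ → ℝ, gsstPDF μ Sig γ m H = gsePDF μ Sig (stGen n m) (fun z => H (γ ⬝ᵥ z))) ∧
      c0 n m = Real.Gamma ((m + n) / 2) /
        (Real.Gamma (m / 2) * (m * Real.pi) ^ ((n : ℝ) / 2)) ∧
      (∀ t : ℝ, 0 ≤ t →
        G1 n m t = m / (m + n - 2) * (1 + 2 * t / m) ^ (-(m + n - 2) / 2)) ∧
      (4 < m + n → ∀ t : ℝ, 0 ≤ t →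
        G2 n m t = m / (m + n - 2) * (m / (m + n - 4)) *
          (1 + 2 * t / m) ^ (-(m + n - 4) / 2)) ∧
      (2 < m →
        c1 n m = (m + n - 2) * Real.Gamma ((n : ℝ) / 2) / ((2 * Real.pi) ^ ((n : ℝ) / 2) * m) *
          (∫ t in Set.Ioi (0 : ℝ),
            t ^ ((n : ℝ) / 2 - 1) * (1 + 2 * t / m) ^ (-(m + n - 2) / 2))⁻¹ ∧
        c1 n m = (m + n - 2) * Real.Gamma ((n : ℝ) / 2) /
          ((m * Real.pi) ^ ((n : ℝ) / 2) * m * beta ((n : ℝ) / 2) ((m - 2) / 2)) ∧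
        c0 n m / c1 n m = m / (m - 2)) ∧
      (4 < m →
        c2 n m = (m + n - 2) * (m + n - 4) * Real.Gamma ((n : ℝ) / 2) /
            ((2 * Real.pi) ^ ((n : ℝ) / 2) * m ^ 2) *
          (∫ t in Set.Ioi (0 : ℝ),
            t ^ ((n : ℝ) / 2 - 1) * (1 + 2 * t / m) ^ (-(m + n - 4) / 2))⁻¹ ∧
        c2 n m = (m + n - 2) * (m + n - 4) * Real.Gamma ((n : ℝ) / 2) /
          ((m * Real.pi) ^ ((n : ℝ) / 2) * m ^ 2 * beta ((n : ℝ) / 2) ((m - 4) / 2)) ∧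
        c0 n m / c2 n m = m ^ 2 / ((m - 2) * (m - 4)))) ∧
    -- the vectors `W_{-k}`, `V_{-k}`, `U_{-ij}`
    (∀ lam : Fin n → ℝ,
      (1 < m → ∀ k,
        (∀ w : Drop1 k → ℝ, fW m lam k w = cW n m (lam k) * (m / (m + n - 2)) *
          (1 + lam k ^ 2 / m) ^ (-(m + n - 2) / 2) *
          (1 + w ⬝ᵥ ((scaleW m lam k)⁻¹ *ᵥ w) / (m - 1)) ^ (-(m + n - 2) / 2)) ∧
        fW m lam k = stW m lam k ∧
        cW n m (lam k) = Real.Gamma ((m + n - 2) / 2) * (m + n - 2) /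
          (Real.Gamma ((m - 1) / 2) * Real.pi ^ (((n : ℝ) - 1) / 2) * m ^ ((m + n) / 2)) *
          (m + lam k ^ 2) ^ ((m - 1) / 2) ∧
        c0 n m / cW n m (lam k) = Real.Gamma ((m - 1) / 2) * m ^ (m / 2) /
          (2 * Real.Gamma (m / 2) * √Real.pi) * (m + lam k ^ 2) ^ (-(m - 1) / 2)) ∧
      (3 < m → ∀ k,
        (∀ v : Drop1 k → ℝ, fV m lam k v = cV n m (lam k) *
          (m / (m + n - 2)) * (m / (m + n - 4)) *
          (1 + lam k ^ 2 / m) ^ (-(m + n - 4) / 2) *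
          (1 + v ⬝ᵥ ((scaleV m lam k)⁻¹ *ᵥ v) / (m - 3)) ^ (-(m + n - 4) / 2)) ∧
        fV m lam k = stV m lam k ∧
        cV n m (lam k) = Real.Gamma ((m + n - 4) / 2) * (m + n - 2) * (m + n - 4) /
          (Real.Gamma ((m - 3) / 2) * Real.pi ^ (((n : ℝ) - 1) / 2) * m ^ ((m + n) / 2)) *
          (m + lam k ^ 2) ^ ((m - 3) / 2) ∧
        c0 n m / cV n m (lam k) = Real.Gamma ((m - 3) / 2) * m ^ (m / 2) /
          (4 * Real.Gamma (m / 2) * √Real.pi) * (m + lam k ^ 2) ^ (-(m - 3) / 2)) ∧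
      (2 < m → ∀ i j, i ≠ j →
        (∀ u : Drop2 i j → ℝ, fU m lam i j u = cU n m (lam i) (lam j) *
          (m / (m + n - 2)) * (m / (m + n - 4)) *
          (1 + (lam i ^ 2 + lam j ^ 2) / m) ^ (-(m + n - 4) / 2) *
          (1 + u ⬝ᵥ ((scaleU m lam i j)⁻¹ *ᵥ u) / (m - 2)) ^ (-(m + n - 4) / 2)) ∧
        fU m lam i j = stU m lam i j ∧
        cU n m (lam i) (lam j) = Real.Gamma ((m + n - 4) / 2) * (m + n - 2) * (m + n - 4) /
          (Real.Gamma ((m - 2) / 2) * Real.pi ^ (((n : ℝ) - 2) / 2) * m ^ ((m + n) / 2)) *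
          (m + lam i ^ 2 + lam j ^ 2) ^ ((m - 2) / 2) ∧
        c0 n m / cU n m (lam i) (lam j) = m ^ (m / 2) / (2 * (m - 2) * Real.pi) *
          (m + lam i ^ 2 + lam j ^ 2) ^ (-(m - 2) / 2))) ∧
    -- the standardized vector `Z`, and the passage from `Z` to `Y`
    (∀ H : ℝ → ℝ, IsSkewing H → HasDensity P Y (gsstPDF μ Sig γ m H) →
      HasDensity P Z (gsstPDF 0 1 γ m H) ∧
      (2 < m →
        (∀ i, MemLp (fun s => Y s i) 2 P ∧ MemLp (fun s => Z s i) 2 P) ∧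
        ∀ q : Fin n → ℝ, (∀ i, 0 < q i ∧ q i < 1) →
          ∀ lam : Fin n → ℝ, lam = standardize μ Sig (VaRVec P Y q) →
          0 < tailFn (gsstPDF 0 1 γ m H) lam →
          condMean P Y {s | ∀ i, lam i < Z s i} = μ + msqrt Sig *ᵥ MTCE P Z lam ∧
          condCov P Y {s | ∀ i, lam i < Z s i} = msqrt Sig * MTCov P Z lam * msqrt Sig ∧
          (Sig.IsDiag →
            MTCE P Y (VaRVec P Y q) = μ + msqrt Sig *ᵥ MTCE P Z lam ∧
            MTCov P Y (VaRVec P Y q) = msqrt Sig * MTCov P Z lam * msqrt Sig))) ∧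
    -- the entries of `Ω`, general skewing function
    (4 < m → ∀ H : ℝ → ℝ, IsSkewing H → ContDiff ℝ 2 H →
      HasDensity P Y (gsstPDF μ Sig γ m H) → ∀ lam : Fin n → ℝ,
      0 < tailFn (gsstPDF 0 1 γ m H) lam →
      HasTailExp (stPDF 0 1 m) lam (fun z => (1 + z ⬝ᵥ z / m) * deriv H (γ ⬝ᵥ z)) →
      (∀ k, HasTailExp (stV m lam k) (drop1 k lam)
        (fun v => deriv H (γ ⬝ᵥ insert1 k lam v))) →
      HasTailExp (ellPDF 0 1 (G2 n m)) lam (fun x => deriv (deriv H) (γ ⬝ᵥ x)) →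
      (∀ k, MTCE P Z lam k = 1 / tailFn (gsstPDF 0 1 γ m H) lam *
        (2 * (c0 n m / cW n m (lam k)) *
            tailExp (stW m lam k) (drop1 k lam) (fun w => H (γ ⬝ᵥ insert1 k lam w)) +
          2 * m * γ k / (m + n - 2) *
            tailExp (stPDF 0 1 m) lam (fun z => (1 + z ⬝ᵥ z / m) * deriv H (γ ⬝ᵥ z)))) ∧
      (∀ i j, i ≠ j → MTCov P Z lam i j = 2 / tailFn (gsstPDF 0 1 γ m H) lam *
        (c0 n m / cU n m (lam i) (lam j) *
            tailExp (stU m lam i j) (drop2 i j lam) (fun u => H (γ ⬝ᵥ insert2 i j lam u)) +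
          c0 n m / cV n m (lam i) * γ j *
            tailExp (stV m lam i) (drop1 i lam) (fun v => deriv H (γ ⬝ᵥ insert1 i lam v)) +
          c0 n m / cV n m (lam j) * γ i *
            tailExp (stV m lam j) (drop1 j lam) (fun v => deriv H (γ ⬝ᵥ insert1 j lam v)) +
          m ^ 2 / ((m - 2) * (m - 4)) * γ i * γ j *
            tailExp (ellPDF 0 1 (G2 n m)) lam (fun x => deriv (deriv H) (γ ⬝ᵥ x))) -
        MTCE P Z lam i * MTCE P Z lam j) ∧
      (∀ i, MTCov P Z lam i i = 2 / tailFn (gsstPDF 0 1 γ m H) lam *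
        (c0 n m / cW n m (lam i) * lam i *
            tailExp (stW m lam i) (drop1 i lam) (fun w => H (γ ⬝ᵥ insert1 i lam w)) +
          c0 n m / cV n m (lam i) * γ i *
            tailExp (stV m lam i) (drop1 i lam) (fun v => deriv H (γ ⬝ᵥ insert1 i lam v)) +
          m ^ 2 / ((m - 2) * (m - 4)) * γ i ^ 2 *
            tailExp (ellPDF 0 1 (G2 n m)) lam (fun x => deriv (deriv H) (γ ⬝ᵥ x))) +
        m / (m - 2) * (tailFn (gsePDF 0 1 (G1 n m) (fun z => H (γ ⬝ᵥ z))) lam /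
          tailFn (gsstPDF 0 1 γ m H) lam) -
        MTCE P Z lam i ^ 2)) ∧
    -- the skew Student-t distribution, `H` the Student-t distribution function
    (4 < m → HasDensity P Y (gsstPDF μ Sig γ m (tCDF m)) → ∀ lam : Fin n → ℝ,
      (∀ k, MTCE P Z lam k = 1 / tailFn (gsstPDF 0 1 γ m (tCDF m)) lam *
        (2 * (c0 n m / cW n m (lam k)) *
            tailExp (stW m lam k) (drop1 k lam) (fun w => tCDF m (γ ⬝ᵥ insert1 k lam w)) +
          2 * m * γ k / (m + n - 2) *
            tailExp (stPDF 0 1 m) lam (fun z => (1 + z ⬝ᵥ z / m) * tPDF m (γ ⬝ᵥ z)))) ∧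
      (∀ i j, i ≠ j → MTCov P Z lam i j = 2 / tailFn (gsstPDF 0 1 γ m (tCDF m)) lam *
        (c0 n m / cU n m (lam i) (lam j) *
            tailExp (stU m lam i j) (drop2 i j lam) (fun u => tCDF m (γ ⬝ᵥ insert2 i j lam u)) +
          c0 n m / cV n m (lam i) * γ j *
            tailExp (stV m lam i) (drop1 i lam) (fun v => tPDF m (γ ⬝ᵥ insert1 i lam v)) -
          (m + 1) * m / ((m - 2) * (m - 4)) * γ i * γ j *
            tailExp (ellPDF 0 1 (G2 n m)) lam (fun x =>
              (1 + (γ ⬝ᵥ x) ^ 2 / m)⁻¹ * (γ ⬝ᵥ x) * tPDF m (γ ⬝ᵥ x)) +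
          c0 n m / cV n m (lam j) * γ i *
            tailExp (stV m lam j) (drop1 j lam) (fun v => tPDF m (γ ⬝ᵥ insert1 j lam v))) -
        MTCE P Z lam i * MTCE P Z lam j) ∧
      (∀ i, MTCov P Z lam i i = 2 / tailFn (gsstPDF 0 1 γ m (tCDF m)) lam *
        (c0 n m / cW n m (lam i) * lam i *
            tailExp (stW m lam i) (drop1 i lam) (fun w => tCDF m (γ ⬝ᵥ insert1 i lam w)) +
          c0 n m / cV n m (lam i) * γ i *
            tailExp (stV m lam i) (drop1 i lam) (fun v => tPDF m (γ ⬝ᵥ insert1 i lam v)) -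
          (m + 1) * m / ((m - 2) * (m - 4)) * γ i ^ 2 *
            tailExp (ellPDF 0 1 (G2 n m)) lam (fun x =>
              (1 + (γ ⬝ᵥ x) ^ 2 / m)⁻¹ * (γ ⬝ᵥ x) * tPDF m (γ ⬝ᵥ x))) +
        m / (m - 2) * (tailFn (gsePDF 0 1 (G1 n m) (fun z => tCDF m (γ ⬝ᵥ z))) lam /
          tailFn (gsstPDF 0 1 γ m (tCDF m)) lam) -
        MTCE P Z lam i ^ 2)) ∧
    -- the symmetric Student-t distribution, `H = 1/2`
    (2 < m → HasDensity P Y (gsstPDF μ Sig γ m (fun _ => 1 / 2)) →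
      HasDensity P Z (stPDF 0 1 m) ∧
      ∀ lam : Fin n → ℝ,
      (∀ k, MTCE P Z lam k = 1 / tailFn (stPDF 0 1 m) lam *
        (c0 n m / cW n m (lam k) * tailFn (stW m lam k) (drop1 k lam))) ∧
      (∀ i j, i ≠ j → MTCov P Z lam i j = 1 / tailFn (stPDF 0 1 m) lam *
        (c0 n m / cU n m (lam i) (lam j) * tailFn (stU m lam i j) (drop2 i j lam)) -
        MTCE P Z lam i * MTCE P Z lam j) ∧
      (∀ i, MTCov P Z lam i i = 1 / tailFn (stPDF 0 1 m) lam *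
        (c0 n m / cW n m (lam i) * lam i * tailFn (stW m lam i) (drop1 i lam)) +
        m / (m - 2) * (tailFn (ellPDF 0 1 (G1 n m)) lam / tailFn (stPDF 0 1 m) lam) -
        MTCE P Z lam i ^ 2)) := by
  subst hZ
  have hn1 : 1 ≤ n := by omega
  have hn0 : n ≠ 0 := by omega
  have hmn : 2 < m + n := by linarith [(Nat.ofNat_le_cast (α := ℝ)).2 hn]
  refine ⟨?generators, fun lam => ⟨fun h k => ?W, fun h k => ?V, fun h i j hij => ?U⟩,
    fun H hH hY => ⟨hasDensity_standardize hSig hm hH.1 hY, fun h => ⟨fun i => ?moments, ?tail⟩⟩,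
    fun h H hH hC hY lam hpos h1 h2 h3 => ?general, fun h hY lam => ?student,
    fun h hY => ?symmetric⟩
  case generators => exact ⟨gsstPDF_eq_gsePDF hm μ γ hSig, c0_eq hm, fun t => G1_eq hm hmn,
    fun h t => G2_eq hm h, fun h => ⟨c1_eq_integral h hn0, c1_eq_beta h hn0, c0_div_c1 h⟩,
    fun h => ⟨c2_eq_integral h hn0, c2_eq_beta h hn0, c0_div_c2 h⟩⟩
  case W => exact ⟨fW_eq h lam k, fW_eq_stW h lam k, cW_eq hn1 h _, c0_div_cW hn1 h _⟩
  case V => exact ⟨fV_eq h lam k, fV_eq_stV h lam k, cV_eq hn1 h _, c0_div_cV hn1 h _⟩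
  case U => exact ⟨fU_eq h lam hij, fU_eq_stU h lam hij, cU_eq hn h _ _, c0_div_cU hn h _ _⟩
  case moments => exact ⟨memLp_two_of_hasDensity_gsstPDF hSig h hH hY i,
    memLp_two_standardize hSig h hH hY i⟩
  case tail =>
    rintro q - lam rfl hpos
    have hmean := condMean_standardize_tail hSig h hH hY hpos
    have hcov := condCov_standardize_tail hSig h hH hY hpos
    exact ⟨hmean, hcov, fun hdiag => ⟨(MTCE_eq_of_isDiag hSig hdiag _).trans hmean,
      (MTCov_eq_of_isDiag hSig hdiag _).trans hcov⟩⟩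
  case general =>
    have hB := hH.bddTwiceDiff hC
    have hI := tailIntegrable_of_hasTailExp h hn hB h1 h2 h3
    have hD := hasDensity_standardize hSig hm hH.1 hY
    exact ⟨MTCE_eq_tailExp (by linarith) hB.deriv hB.bdd hH.nonneg hI.first hD,
      fun i j => MTCov_eq_tailExp_of_ne h hB hH.nonneg hI hD hpos,
      MTCov_eq_tailExp_self h hB hH.nonneg hI hD hpos hn⟩
  case student =>
    have hD := hasDensity_standardize hSig hm (bddTwiceDiff_tCDF hm).continuous.measurable hY
    exact ⟨MTCE_tCDF (by linarith) hD, fun i j => MTCov_tCDF_of_ne h hD, MTCov_tCDF_self h hD hn⟩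
  case symmetric =>
    have hD := gsstPDF_half 0 γ 1 m ▸ hasDensity_standardize hSig hm measurable_const hY
    exact ⟨hD, fun lam => ⟨MTCE_stPDF (by linarith) hD, fun i j => MTCov_stPDF_of_ne h hD,
      MTCov_stPDF_self h hD hn⟩⟩
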